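/- For Gaussian integers $A,B\in\mathbb{Z}[i]$ with $4A^3+27B^2\neq 0$, let $E_{A,B}$ be the elliptic curve $y^2=x^3+Ax+B$ over $\mathbb{Q}(i)$. The equation is called minimal if $\gcd(A^3,B^2)$ is not divisible by the 12th power of any non-unit of $\mathbb{Z}[i]$, and its height is $\max(N(A)^3,N(B)^2)$, where $N(x+iy)=x^2+y^2$. For a finite abelian group $G$ and a real number $X>0$, let $N'_G(X)$ be the number of pairs $(A,B)\in\mathbb{Z}[i]^2$ with $4A^3+27B^2\neq0$ for which the equation $y^2=x^3+Ax+B$ is minimal, of height less than $X$, and the torsion subgroup $E_{A,B}(\mathbb{Q}(i))_{\mathrm{tors}}$ has a subgroup isomorphic to $G$. Let $G$ be one of the following groups, and let $d(G)$ be the number given for it: - $d(G)=3$ for $\mathbb{Z}/2\times\mathbb{Z}/2$; - $d(G)=4$ for $\mathbb{Z}/4$; - $d(G)=6$ for $\mathbb{Z}/5$, $\mathbb{Z}/6$, $\mathbb{Z}/2\times\mathbb{Z}/4$; - $d(G)=12$ for $\mathbb{Z}/7$, $\mathbb{Z}/8$, $\mathbb{Z}/2\times\mathbb{Z}/6$,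 $\mathbb{Z}/4\times\mathbb{Z}/4$; - $d(G)=18$ for $\mathbb{Z}/9$, $\mathbb{Z}/10$; - $d(G)=24$ for $\mathbb{Z}/12$, $\mathbb{Z}/2\times\mathbb{Z}/8$. Then there are constants $K_1,K_2,X_0>0$, depending only on $G$, such that $$K_1X^{1/d(G)}\le N'_G(X)\quad\text{for all } X\ge X_0,\qquad N'_G(X)\le K_2X^{1/d(G)}\quad\text{for all } X>0.$$ -/

import Mathlib

/-- The field `ℚ(i)`, realised as the field of fractions of the ring `ℤ[i]` of Gaussian integers. -/
abbrev GaussianRat : Type := FractionRing GaussianInt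

/-- The Weierstrass curve `y² = x³ + A x + B` over `ℚ(i)`, for `A, B ∈ ℤ[i]`. -/
noncomputable def shortCurve (A B : GaussianInt) : WeierstrassCurve GaussianRat where
  a₁ := 0
  a₂ := 0
  a₃ := 0
  a₄ := algebraMap GaussianInt GaussianRat A
  a₆ := algebraMap GaussianInt GaussianRat B

/-- The equation `y² = x³ + A x + B` defines an elliptic curve. -/
def IsEllipticPair (A B : GaussianInt) : Prop := 4 * A ^ 3 + 27 * B ^ 2 ≠ 0

/-- Minimality: no twelfth power of a non-unit of `ℤ[i]` is a common divisor of `A³` and `B²`,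
i.e. divides `gcd(A³, B²)`. -/
def IsMinimalPair (A B : GaussianInt) : Prop :=
  ∀ d : GaussianInt, ¬ IsUnit d → ¬ (d ^ 12 ∣ A ^ 3 ∧ d ^ 12 ∣ B ^ 2)

/-- The height `max (N(A)³, N(B)²)`, where `N(x + iy) = x² + y²`. -/
def pairHeight (A B : GaussianInt) : ℤ := max (A.norm ^ 3) (B.norm ^ 2)

open Classical in
/-- The torsion subgroup of the group of `ℚ(i)`-rational points of `y² = x³ + A x + B` has a
subgroup isomorphic to `G`. -/
def TorsionContains (G : Type) [AddCommGroup G] (A B : GaussianInt) : Prop :=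
  ∃ φ : G →+ AddCommGroup.torsion (shortCurve A B).toAffine.Point, Function.Injective φ

/-- The pairs `(A, B)` such that `y² = x³ + A x + B` is a minimal Weierstrass equation of an
elliptic curve over `ℚ(i)`, of height less than `X`, whose torsion subgroup contains `G`. -/
def curvesContaining (G : Type) [AddCommGroup G] (X : ℝ) : Set (GaussianInt × GaussianInt) :=
  {p | IsEllipticPair p.1 p.2 ∧ IsMinimalPair p.1 p.2 ∧ (pairHeight p.1 p.2 : ℝ) < X ∧
    TorsionContains G p.1 p.2}

/-- The counting function `N'_G(X)`. -/
noncomputable def countContaining (G : Type) [AddCommGroup G] (X : ℝ) : ℕ :=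
  (curvesContaining G X).ncard

/-- The table of groups `G` with a finite constant `d(G)`: `TorsionTable G d` says that `G` is
in the table and `d(G) = d`. -/
inductive TorsionTable : (G : Type) → [AddCommGroup G] → ℕ → Prop
  | z4 : TorsionTable (ZMod 4) 4
  | z5 : TorsionTable (ZMod 5) 6
  | z6 : TorsionTable (ZMod 6) 6
  | z7 : TorsionTable (ZMod 7) 12
  | z8 : TorsionTable (ZMod 8) 12
  | z9 : TorsionTable (ZMod 9) 18
  | z10 : TorsionTable (ZMod 10) 18
  | z12 : TorsionTable (ZMod 12) 24
  | z2z2 : TorsionTable (ZMod 2 × ZMod 2) 3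
  | z2z4 : TorsionTable (ZMod 2 × ZMod 4) 6
  | z2z6 : TorsionTable (ZMod 2 × ZMod 6) 12
  | z2z8 : TorsionTable (ZMod 2 × ZMod 8) 24
  | z4z4 : TorsionTable (ZMod 4 × ZMod 4) 12

/-! The curves with the required torsion form a one-parameter family, so counting them amounts to
counting lattice points. In each case there are forms F and G in variables s, t of weights 1 and w,
of weighted degrees 2m and 3m and without common zero, such that the curves in question are, up to
scale, y² = x³ + F(s,t) x + G(s,t). For X = Y^(12m) the height condition reads |A| < Y^(2m), |B| <
Y^(3m), and this corresponds to |s| ≪ Y, |t| ≪ Y^w. A disc of radius R contains about R² Gaussian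
integers, so there are about Y^(2+2w) = X^(1/d) pairs (s,t), where d = 6m/(1+w).

Upper bound: a minimal (A,B) satisfies q⁴A = F(s,t), q⁶B = G(s,t) with s, t integral and q bounded
(`WeightedPair.exists_integral_of_isMinimalPair` for the Tate families). Since F and G have no
common zero, compactness bounds s and t (`WeightedPair.exists_norm_le`).

Lower bound: a positive proportion of all pairs (s,t) is coprime (`exists_le_ncard_coprimePairs`). A
coprime pair yields a minimal equation after division by powers of some q bounded by a fixed
constant (`WeightedPair.exists_minimal`), because the ideal (F,G) contains C·s^K and C·t^K. Singular
members are rare (`WeightedPair.card_degenerate_le`), and only boundedly many pairs give the same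
curve, because F³/G² is not constant (`WeightedPair.card_fiber_le`).

Parametrisations: if 2P and 3P are nonzero, P can be moved to the origin of a Tate normal form with
parameters b, c (`exists_tateCurve`). The condition nP = 0, and the presence of a second generator,
then cut out a rational curve in the (b,c)-plane. Writing its parameter as t/s and clearing
denominators gives binary forms (`TateForms`) with m = 2k, w = 1, d = 6k. The groups ℤ/2 × ℤ/2 (m =
w = 1) and ℤ/4 (m = w = 2) are parametrised directly on the short equation. A square root of -1 is
needed only for ℤ/4 × ℤ/4. -/

/-! ### Counting Gaussian integers and coprime pairs in discs. -/

/-- The nonzero Gaussian integers of absolute value at most `R`. -/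
def nonzeroBall (R : ℝ) : Set GaussianInt := {z | z ≠ 0 ∧ ‖(z : ℂ)‖ ≤ R}

theorem GaussianInt.one_le_norm_toComplex {z : GaussianInt} (hz : z ≠ 0) : 1 ≤ ‖(z : ℂ)‖ := by
  have h : (1 : ℝ) ≤ Complex.normSq (z : ℂ) := by
    rw [← GaussianInt.intCast_real_norm]
    exact_mod_cast GaussianInt.norm_pos.2 hz
  rw [Complex.normSq_eq_norm_sq] at h
  nlinarith [_root_.norm_nonneg (z : ℂ)]

theorem GaussianInt.norm_eq_sq (z : GaussianInt) : (z.norm : ℝ) = ‖(z : ℂ)‖ ^ 2 := by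
  rw [GaussianInt.intCast_real_norm, Complex.normSq_eq_norm_sq]

/-- The Gaussian integers whose coordinates have absolute value at most `⌊R⌋`. -/
noncomputable def gaussianBox (R : ℝ) : Finset GaussianInt :=
  (Finset.Icc (-⌊R⌋) ⌊R⌋ ×ˢ Finset.Icc (-⌊R⌋) ⌊R⌋).image fun p => (⟨p.1, p.2⟩ : GaussianInt)

theorem mem_gaussianBox {R : ℝ} {z : GaussianInt} (h : ‖(z : ℂ)‖ ≤ R) : z ∈ gaussianBox R := by
  have h1 := (Complex.abs_re_le_norm (z : ℂ)).trans h
  have h2 := (Complex.abs_im_le_norm (z : ℂ)).trans h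
  rw [← GaussianInt.intCast_re, abs_le] at h1
  rw [← GaussianInt.intCast_im, abs_le] at h2
  refine Finset.mem_image.2 ⟨(z.re, z.im), ?_, rfl⟩
  simp only [Finset.mem_product, Finset.mem_Icc]
  refine ⟨⟨?_, Int.le_floor.2 h1.2⟩, ?_, Int.le_floor.2 h2.2⟩
  · rw [neg_le]; exact Int.le_floor.2 (by push_cast; linarith)
  · rw [neg_le]; exact Int.le_floor.2 (by push_cast; linarith)

theorem card_gaussianBox_le {R : ℝ} (hR : 1 ≤ R) : ((gaussianBox R).card : ℝ) ≤ 9 * R ^ 2 := by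
  have h0 : 0 ≤ ⌊R⌋ := Int.floor_nonneg.2 (by linarith)
  have h1 : ((Finset.Icc (-⌊R⌋) ⌊R⌋).card : ℝ) ≤ 3 * R := by
    rw [Int.card_Icc]
    have h2 : (((⌊R⌋ + 1 - -⌊R⌋).toNat : ℤ) : ℝ) = ((⌊R⌋ + 1 - -⌊R⌋ : ℤ) : ℝ) := by
      rw [Int.toNat_of_nonneg (by omega)]
    have h3 := Int.floor_le R
    push_cast at h2
    rw [h2]
    linarith
  calc ((gaussianBox R).card : ℝ)
      ≤ ((Finset.Icc (-⌊R⌋) ⌊R⌋ ×ˢ Finset.Icc (-⌊R⌋) ⌊R⌋).card : ℝ) := by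
        exact_mod_cast Finset.card_image_le
    _ = (Finset.Icc (-⌊R⌋) ⌊R⌋).card * ((Finset.Icc (-⌊R⌋) ⌊R⌋).card : ℝ) := by
        rw [Finset.card_product]; push_cast; ring
    _ ≤ (3 * R) * (3 * R) := by gcongr
    _ = 9 * R ^ 2 := by ring

theorem finite_nonzeroBall (R : ℝ) : (nonzeroBall R).Finite :=
  (gaussianBox R).finite_toSet.subset fun _ hz => mem_gaussianBox hz.2

/-- Leaving out 0 makes the quadratic bound valid for R < 1 too, where the ball is empty. The sieve
below needs this for the radii R/|g|, which may be small. -/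
theorem ncard_nonzeroBall_le {R : ℝ} (hR : 0 < R) : ((nonzeroBall R).ncard : ℝ) ≤ 9 * R ^ 2 := by
  rcases le_or_gt 1 R with h | h
  · refine le_trans ?_ (card_gaussianBox_le h)
    rw [← Set.ncard_coe_finset]
    exact_mod_cast Set.ncard_le_ncard (t := ↑(gaussianBox R))
      (fun z (hz : z ∈ nonzeroBall R) => mem_gaussianBox hz.2) (Finset.finite_toSet _)
  · have : nonzeroBall R = ∅ := by
      ext z
      simp only [nonzeroBall, Set.mem_ofPred_eq, Set.mem_empty_iff_false, iff_false, not_and, not_le]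
      exact fun hz => h.trans_le (GaussianInt.one_le_norm_toComplex hz)
    rw [this]
    simp
    positivity

/-- The square of points with both coordinates between 1 and ⌊R/2⌋ fits into the ball, and ⌊R/2⌋ ≥
R/4 once R ≥ 2. -/
theorem le_ncard_nonzeroBall {R : ℝ} (hR : 2 ≤ R) : R ^ 2 / 16 ≤ ((nonzeroBall R).ncard : ℝ) := by
  set n : ℕ := ⌊R / 2⌋₊ with hn
  have hn1 : (n : ℝ) ≤ R / 2 := Nat.floor_le (by linarith)
  have hn2 : R / 2 < n + 1 := Nat.lt_floor_add_one _
  have hn3 : (1 : ℝ) ≤ n := by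
    have : 1 ≤ n := Nat.le_floor (by push_cast; linarith)
    exact_mod_cast this
  let f : ℕ × ℕ → GaussianInt := fun p => ⟨p.1, p.2⟩
  have hf : Function.Injective f := by
    rintro ⟨a, b⟩ ⟨c, d⟩ h
    simpa [f] using h
  let T := (Finset.Icc 1 n ×ˢ Finset.Icc 1 n).image f
  have hT : T.card = n * n := by
    rw [Finset.card_image_of_injective _ hf, Finset.card_product]
    simp
  have hsub : (T : Set GaussianInt) ⊆ nonzeroBall R := by
    intro z hz
    simp only [T, Finset.coe_image, Set.mem_image, Finset.mem_coe, Finset.mem_product,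
      Finset.mem_Icc] at hz
    obtain ⟨⟨a, b⟩, ⟨⟨ha1, ha2⟩, hb1, hb2⟩, rfl⟩ := hz
    simp only at ha1 ha2 hb1 hb2
    refine ⟨fun h => ?_, ?_⟩
    · have := congrArg Zsqrtd.re h
      simp [f] at this
      omega
    · refine (Complex.norm_le_abs_re_add_abs_im _).trans ?_
      rw [← GaussianInt.intCast_re, ← GaussianInt.intCast_im]
      have ha : (a : ℝ) ≤ n := by exact_mod_cast ha2
      have hb : (b : ℝ) ≤ n := by exact_mod_cast hb2
      simp only [f, Int.cast_natCast, Nat.abs_cast]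
      linarith
  have h1 : (n * n : ℝ) ≤ (nonzeroBall R).ncard := by
    have := Set.ncard_le_ncard hsub (finite_nonzeroBall R)
    rw [Set.ncard_coe_finset, hT] at this
    exact_mod_cast this
  nlinarith

/-- Comparison with the Eisenstein sum of weight 4 over ℤ², since the sup norm of the coordinates is
at most |z|. It controls the pairs with a large common divisor. -/
theorem summable_norm_toComplex_inv_pow_four :
    Summable fun z : GaussianInt => (‖(z : ℂ)‖ ^ 4)⁻¹ := by
  have h := EisensteinSeries.summable_one_div_norm_rpow (k := 4) (by norm_num)
  let e : GaussianInt → Fin 2 → ℤ := fun z => ![z.re, z.im]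
  have he : Function.Injective e := by
    intro a b hab
    have h0 := congrFun hab 0
    have h1 := congrFun hab 1
    simp [e] at h0 h1
    exact Zsqrtd.ext h0 h1
  refine Summable.of_nonneg_of_le (fun z => by positivity) (fun z => ?_) (h.comp_injective he)
  by_cases hz : z = 0
  · simp [hz]
  have hle : ‖e z‖ ≤ ‖(z : ℂ)‖ := by
    refine (pi_norm_le_iff_of_nonneg (norm_nonneg _)).2 fun i => ?_
    fin_cases i
    · simpa [e, Int.norm_eq_abs, GaussianInt.intCast_re] using Complex.abs_re_le_norm (z : ℂ)
    · simpa [e, Int.norm_eq_abs, GaussianInt.intCast_im] using Complex.abs_im_le_norm (z : ℂ)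
  have hpos : 0 < ‖e z‖ := by
    refine norm_pos_iff.2 fun h0 => hz ?_
    apply he
    rw [h0]
    ext i; fin_cases i <;> simp [e]
  have : ‖e z‖ ^ (-4 : ℝ) = (‖e z‖ ^ 4)⁻¹ := by
    rw [Real.rpow_neg hpos.le]; norm_cast
  simp only [Function.comp_apply, this]
  gcongr

/-- Pairs of coprime nonzero Gaussian integers in the product of two balls. -/
def coprimePairs (R R' : ℝ) : Set (GaussianInt × GaussianInt) :=
  {p | p.1 ∈ nonzeroBall R ∧ p.2 ∈ nonzeroBall R' ∧ IsCoprime p.1 p.2}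

theorem coprimePairs_subset (R R' : ℝ) : coprimePairs R R' ⊆ nonzeroBall R ×ˢ nonzeroBall R' :=
  fun _ hp => ⟨hp.1, hp.2.1⟩

theorem finite_coprimePairs (R R' : ℝ) : (coprimePairs R R').Finite :=
  ((finite_nonzeroBall R).prod (finite_nonzeroBall R')).subset (coprimePairs_subset R R')

theorem ncard_coprimePairs_le {R R' : ℝ} (hR : 0 < R) (hR' : 0 < R') :
    ((coprimePairs R R').ncard : ℝ) ≤ 81 * R ^ 2 * R' ^ 2 := by
  have h := Set.ncard_le_ncard (coprimePairs_subset R R')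
    ((finite_nonzeroBall R).prod (finite_nonzeroBall R'))
  rw [Set.ncard_prod] at h
  calc ((coprimePairs R R').ncard : ℝ) ≤ (nonzeroBall R).ncard * (nonzeroBall R').ncard := by
        exact_mod_cast h
    _ ≤ (9 * R ^ 2) * (9 * R' ^ 2) := by
        gcongr
        · exact ncard_nonzeroBall_le hR
        · exact ncard_nonzeroBall_le hR'
    _ = _ := by ring

theorem coprimePairs_mono {R R' T T' : ℝ} (h : R ≤ T) (h' : R' ≤ T') :
    coprimePairs R R' ⊆ coprimePairs T T' :=
  fun _ hp => ⟨⟨hp.1.1, hp.1.2.trans h⟩, ⟨hp.2.1.1, hp.2.1.2.trans h'⟩, hp.2.2⟩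

theorem exists_coprime_factor {a b : GaussianInt} (hb : b ≠ 0) :
    ∃ g a' b' : GaussianInt, g ≠ 0 ∧ a = g * a' ∧ b = g * b' ∧ IsCoprime a' b' := by
  classical
  let _ := EuclideanDomain.gcdMonoid GaussianInt
  refine ⟨GCDMonoid.gcd a b, a / GCDMonoid.gcd a b, b / GCDMonoid.gcd a b,
    gcd_ne_zero_of_right hb, ?_, ?_, isCoprime_div_gcd_div_gcd hb⟩
  · exact (EuclideanDomain.mul_div_cancel' (gcd_ne_zero_of_right hb) (gcd_dvd_left _ _)).symm
  · exact (EuclideanDomain.mul_div_cancel' (gcd_ne_zero_of_right hb) (gcd_dvd_right _ _)).symm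

/-- The pairs (ga', gb') are sorted by a greatest common divisor g, which satisfies |g| ≤ |ga'| ≤ R
because a' is nonzero. -/
theorem ncard_prod_le_sum_coprimePairs (R R' : ℝ) :
    (nonzeroBall R ×ˢ nonzeroBall R').ncard ≤
      ∑ g ∈ (finite_nonzeroBall R).toFinset,
        (coprimePairs (R / ‖(g : ℂ)‖) (R' / ‖(g : ℂ)‖)).ncard := by
  classical
  have hsub : nonzeroBall R ×ˢ nonzeroBall R' ⊆
      ⋃ g ∈ (finite_nonzeroBall R).toFinset, (fun p : GaussianInt × GaussianInt => (g * p.1, g * p.2)) ''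
        coprimePairs (R / ‖(g : ℂ)‖) (R' / ‖(g : ℂ)‖) := by
    rintro ⟨a, b⟩ ⟨⟨ha, haR⟩, hb, hbR⟩
    simp only at ha haR hb hbR
    obtain ⟨g, a', b', hg, rfl, rfl, hco⟩ := exists_coprime_factor (a := a) hb
    rw [GaussianInt.toComplex_mul, norm_mul] at haR hbR
    have ha' : a' ≠ 0 := right_ne_zero_of_mul ha
    have hb' : b' ≠ 0 := right_ne_zero_of_mul hb
    have hgpos : 0 < ‖(g : ℂ)‖ := one_pos.trans_le (GaussianInt.one_le_norm_toComplex hg)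
    simp only [Set.mem_iUnion]
    refine ⟨g, ?_, (a', b'), ⟨⟨ha', ?_⟩, ⟨hb', ?_⟩, hco⟩, rfl⟩
    · rw [Set.Finite.mem_toFinset]
      exact ⟨hg, le_trans (le_mul_of_one_le_right hgpos.le
        (GaussianInt.one_le_norm_toComplex ha')) haR⟩
    · rw [le_div_iff₀ hgpos]; simpa [mul_comm] using haR
    · rw [le_div_iff₀ hgpos]; simpa [mul_comm] using hbR
  refine (Set.ncard_le_ncard hsub ?_).trans ?_
  · exact Set.Finite.biUnion (Finset.finite_toSet _) fun g _ => (finite_coprimePairs _ _).image _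
  · refine (Finset.set_ncard_biUnion_le _ _).trans (Finset.sum_le_sum fun g _ => ?_)
    exact Set.ncard_image_le (finite_coprimePairs _ _)

/-- A positive proportion of the pairs of nonzero Gaussian integers in a product of two balls
is coprime. -/
theorem exists_le_ncard_coprimePairs :
    ∃ κ : ℝ, 0 < κ ∧ ∀ R R' : ℝ, 2 ≤ R → 2 ≤ R' →
      κ * (R ^ 2 * R' ^ 2) ≤ ((coprimePairs R R').ncard : ℝ) := by
  classical
  -- There are at least R²R'²/256 pairs in all. Those with gcd outside the finite set s number at
  -- most 81·R²R'²·Σ|g|⁻⁴, and the tolerance 1/(512·81) makes this at most half of the total. For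
  -- each g in s there are at most C pairs with gcd g, hence R²R'²/512 ≤ |s|·C and no Möbius
  -- inversion is needed.
  obtain ⟨s, hs⟩ := (summable_iff_vanishing_norm.1 summable_norm_toComplex_inv_pow_four)
    (1 / (512 * 81)) (by norm_num)
  refine ⟨1 / (512 * (s.card + 1)), by positivity, fun R R' hR hR' => ?_⟩
  have hR0 : 0 < R := by linarith
  have hR0' : 0 < R' := by linarith
  set C : ℝ := ((coprimePairs R R').ncard : ℝ)
  set U := (finite_nonzeroBall R).toFinset
  have hU : ∀ g ∈ U, 1 ≤ ‖(g : ℂ)‖ := fun g hg =>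
    GaussianInt.one_le_norm_toComplex ((Set.Finite.mem_toFinset _).1 hg).1
  have h1 : (R ^ 2 / 16) * (R' ^ 2 / 16) ≤
      ∑ g ∈ U, ((coprimePairs (R / ‖(g : ℂ)‖) (R' / ‖(g : ℂ)‖)).ncard : ℝ) := by
    have h2 := ncard_prod_le_sum_coprimePairs R R'
    rw [Set.ncard_prod] at h2
    calc (R ^ 2 / 16) * (R' ^ 2 / 16) ≤ (nonzeroBall R).ncard * (nonzeroBall R').ncard := by
          gcongr
          · exact le_ncard_nonzeroBall hR
          · exact le_ncard_nonzeroBall hR'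
      _ ≤ _ := by exact_mod_cast h2
  have h3 : ∑ g ∈ U, ((coprimePairs (R / ‖(g : ℂ)‖) (R' / ‖(g : ℂ)‖)).ncard : ℝ) ≤
      ∑ g ∈ U ∩ s, C + ∑ g ∈ U \ s, 81 * (R ^ 2 * R' ^ 2) * (‖(g : ℂ)‖ ^ 4)⁻¹ := by
    rw [← Finset.sum_inter_add_sum_sdiff U s]
    refine add_le_add (Finset.sum_le_sum fun g hg => ?_) (Finset.sum_le_sum fun g hg => ?_)
    · have hg1 := hU g (Finset.mem_of_mem_inter_left hg)
      refine Nat.cast_le.2 (Set.ncard_le_ncard ?_ (finite_coprimePairs _ _))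
      exact coprimePairs_mono (div_le_self hR0.le hg1) (div_le_self hR0'.le hg1)
    · have hg1 := hU g (Finset.mem_sdiff.1 hg).1
      have hg0 : 0 < ‖(g : ℂ)‖ := by linarith
      refine (ncard_coprimePairs_le (by positivity) (by positivity)).trans (le_of_eq ?_)
      field_simp
  have h4 : ∑ g ∈ U ∩ s, C ≤ s.card * C := by
    rw [Finset.sum_const, nsmul_eq_mul]
    gcongr
    exact Finset.inter_subset_right
  have h5 : ∑ g ∈ U \ s, 81 * (R ^ 2 * R' ^ 2) * (‖(g : ℂ)‖ ^ 4)⁻¹ ≤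
      81 * (R ^ 2 * R' ^ 2) * (1 / (512 * 81)) := by
    rw [← Finset.mul_sum]
    gcongr
    exact (le_abs_self _).trans (hs _ Finset.sdiff_disjoint).le
  have hC : 0 ≤ C := Nat.cast_nonneg _
  have h6 : R ^ 2 * R' ^ 2 ≤ 512 * (s.card * C) := by linarith
  rw [div_mul_eq_mul_div, one_mul, div_le_iff₀ (by positivity)]
  nlinarith

/-! ### Weighted pairs of forms: size estimates, fibres and common divisors. -/

/-- A pair of forms `F`, `G` in two variables of weights `1` and `w`, of weighted degrees `2 * m`
and `3 * m`, with integral coefficients and without common zeros.  The forms are given by their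
values on all commutative rings. -/
structure WeightedPair (m w : ℕ) where
  F : ∀ {R : Type} [CommRing R], R → R → R
  G : ∀ {R : Type} [CommRing R], R → R → R
  map_F : ∀ {R S : Type} [CommRing R] [CommRing S] (φ : R →+* S) (s t : R),
    φ (F s t) = F (φ s) (φ t)
  map_G : ∀ {R S : Type} [CommRing R] [CommRing S] (φ : R →+* S) (s t : R),
    φ (G s t) = G (φ s) (φ t)
  homog_F : ∀ {R : Type} [CommRing R] (c s t : R), F (c * s) (c ^ w * t) = c ^ (2 * m) * F s t
  homog_G : ∀ {R : Type} [CommRing R] (c s t : R), G (c * s) (c ^ w * t) = c ^ (3 * m) * G s t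
  C : ℤ
  C_ne_zero : C ≠ 0
  K : ℕ
  resultant_left : ∀ {R : Type} [CommRing R] (s t : R),
    ∃ u v : R, u * F s t + v * G s t = C * s ^ K
  resultant_right : ∀ {R : Type} [CommRing R] (s t : R),
    ∃ u v : R, u * F s t + v * G s t = C * t ^ K
  nonconstant : ∃ i j : ℤ, F 1 i ^ 3 * G 1 j ^ 2 ≠ F 1 j ^ 3 * G 1 i ^ 2

namespace WeightedPair

variable {m w : ℕ} (D : WeightedPair m w)

/-- Naturality in the ring replaces a polynomial expression: F evaluated in the ring of continuous
functions on ℂ², at the two coordinates, is a continuous function, and evaluation at a point is a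
ring homomorphism. -/
theorem continuous_F : Continuous fun p : ℂ × ℂ => D.F p.1 p.2 := by
  let X : C(ℂ × ℂ, ℂ) := ⟨Prod.fst, continuous_fst⟩
  let Y : C(ℂ × ℂ, ℂ) := ⟨Prod.snd, continuous_snd⟩
  have h : (fun p : ℂ × ℂ => D.F p.1 p.2) = D.F X Y := by
    funext p
    exact (D.map_F ((Pi.evalRingHom _ p).comp ContinuousMap.coeFnRingHom) X Y).symm
  rw [h]
  exact ContinuousMap.continuous _

theorem continuous_G : Continuous fun p : ℂ × ℂ => D.G p.1 p.2 := by
  let X : C(ℂ × ℂ, ℂ) := ⟨Prod.fst, continuous_fst⟩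
  let Y : C(ℂ × ℂ, ℂ) := ⟨Prod.snd, continuous_snd⟩
  have h : (fun p : ℂ × ℂ => D.G p.1 p.2) = D.G X Y := by
    funext p
    exact (D.map_G ((Pi.evalRingHom _ p).comp ContinuousMap.coeFnRingHom) X Y).symm
  rw [h]
  exact ContinuousMap.continuous _

theorem eq_zero_of_F_G_eq_zero {s t : ℂ} (hF : D.F s t = 0) (hG : D.G s t = 0) :
    s = 0 ∧ t = 0 := by
  have hC : (D.C : ℂ) ≠ 0 := Int.cast_ne_zero.2 D.C_ne_zero
  obtain ⟨u, v, h⟩ := D.resultant_left s t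
  obtain ⟨u', v', h'⟩ := D.resultant_right s t
  rw [hF, hG, mul_zero, mul_zero, add_zero] at h h'
  exact ⟨eq_zero_of_pow_eq_zero ((mul_eq_zero.1 h.symm).resolve_left hC),
    eq_zero_of_pow_eq_zero ((mul_eq_zero.1 h'.symm).resolve_left hC)⟩

/-- If `F (s, t)` and `G (s, t)` are small, then so are `s` and `t`. -/
theorem exists_norm_le (hm : m ≠ 0) (hw : w ≠ 0) : ∃ δ : ℝ, 0 < δ ∧ ∀ (s t : ℂ) (R : ℝ), 0 < R →
    ‖D.F s t‖ ≤ δ * R ^ (2 * m) → ‖D.G s t‖ ≤ δ * R ^ (3 * m) → ‖s‖ ≤ R ∧ ‖t‖ ≤ R ^ w := by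
  -- The constant δ is the minimum of max(|F|,|G|) on the unit sphere, positive because F and G have
  -- no common zero there.
  have hcpt : IsCompact (Metric.sphere (0 : ℂ × ℂ) 1) := isCompact_sphere _ _
  have hne : (Metric.sphere (0 : ℂ × ℂ) 1).Nonempty := NormedSpace.sphere_nonempty.2 zero_le_one
  obtain ⟨p, hp, hmin⟩ := hcpt.exists_isMinOn hne
    (f := fun p => max ‖D.F p.1 p.2‖ ‖D.G p.1 p.2‖)
    (D.continuous_F.norm.max D.continuous_G.norm).continuousOn
  set δ := max ‖D.F p.1 p.2‖ ‖D.G p.1 p.2‖ with hδ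
  have hδpos : 0 < δ := by
    by_contra h
    have h1 : ‖D.F p.1 p.2‖ = 0 := le_antisymm ((le_max_left _ _).trans (not_lt.1 h)) (norm_nonneg _)
    have h2 : ‖D.G p.1 p.2‖ = 0 :=
      le_antisymm ((le_max_right _ _).trans (not_lt.1 h)) (norm_nonneg _)
    obtain ⟨h3, h4⟩ := D.eq_zero_of_F_G_eq_zero (norm_eq_zero.1 h1) (norm_eq_zero.1 h2)
    have h5 : p = 0 := Prod.ext h3 h4
    simp [h5] at hp
  refine ⟨δ, hδpos, fun s t R hR hF hG => ?_⟩
  -- M is the weighted size of (s,t): scaling by M⁻¹ with weights 1 and w puts the pair on the unit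
  -- sphere, where the minimum δ applies.
  set M : ℝ := max ‖s‖ (‖t‖ ^ ((w : ℝ)⁻¹)) with hM
  have hMt : (‖t‖ ^ ((w : ℝ)⁻¹)) ^ w = ‖t‖ := Real.rpow_inv_natCast_pow (norm_nonneg _) hw
  have hsM : ‖s‖ ≤ M := le_max_left _ _
  have hM0 : 0 ≤ M := (norm_nonneg s).trans hsM
  have htM : ‖t‖ ≤ M ^ w := by
    rw [← hMt]
    exact pow_le_pow_left₀ (by positivity) (le_max_right _ _) _
  suffices h : M ≤ R from ⟨hsM.trans h, htM.trans (pow_le_pow_left₀ hM0 h _)⟩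
  rcases hM0.eq_or_lt with h0 | hMpos
  · rw [← h0]; exact hR.le
  have hMc : (M : ℂ) ≠ 0 := Complex.ofReal_ne_zero.2 hMpos.ne'
  have hnM : ‖(M : ℂ)‖ = M := by simp [abs_of_pos hMpos]
  set s' : ℂ := s / M with hs'
  set t' : ℂ := t / (M : ℂ) ^ w with ht'
  have hs : s = M * s' := by rw [hs']; field_simp
  have ht : t = (M : ℂ) ^ w * t' := by rw [ht']; field_simp
  have hsn : ‖s'‖ = ‖s‖ / M := by rw [hs', norm_div, hnM]
  have htn : ‖t'‖ = ‖t‖ / M ^ w := by rw [ht', norm_div, norm_pow, hnM]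
  have hmem : (s', t') ∈ Metric.sphere (0 : ℂ × ℂ) 1 := by
    rw [mem_sphere_zero_iff_norm, Prod.norm_def, hsn, htn]
    refine le_antisymm (max_le ?_ ?_) (le_max_iff.2 ?_)
    · exact (div_le_one hMpos).2 hsM
    · exact (div_le_one (by positivity)).2 htM
    · rcases max_choice ‖s‖ (‖t‖ ^ ((w : ℝ)⁻¹)) with h | h
      · left; rw [← hM] at h; rw [← h, div_self hMpos.ne']
      · right
        rw [← hM] at h
        rw [← hMt, ← h, div_self (by positivity)]
  have hge : δ ≤ max ‖D.F s' t'‖ ‖D.G s' t'‖ := hmin hmem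
  have hFs : ‖D.F s t‖ = M ^ (2 * m) * ‖D.F s' t'‖ := by
    rw [hs, ht, D.homog_F, norm_mul, norm_pow, hnM]
  have hGs : ‖D.G s t‖ = M ^ (3 * m) * ‖D.G s' t'‖ := by
    rw [hs, ht, D.homog_G, norm_mul, norm_pow, hnM]
  rcases le_max_iff.1 hge with h | h
  · have h1 : δ * M ^ (2 * m) ≤ δ * R ^ (2 * m) := by
      refine le_trans ?_ (hFs ▸ hF)
      rw [mul_comm]; gcongr
    exact le_of_pow_le_pow_left₀ (by omega) hR.le (le_of_mul_le_mul_left h1 hδpos)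
  · have h1 : δ * M ^ (3 * m) ≤ δ * R ^ (3 * m) := by
      refine le_trans ?_ (hGs ▸ hG)
      rw [mul_comm]; gcongr
    exact le_of_pow_le_pow_left₀ (by omega) hR.le (le_of_mul_le_mul_left h1 hδpos)

/-- Weighted homogeneity reduces the estimate to the unit ball, where F and G are bounded by
compactness. -/
theorem exists_norm_F_G_le : ∃ B : ℝ, 0 < B ∧ ∀ (s t : ℂ) (R : ℝ), 0 < R →
    ‖s‖ ≤ R → ‖t‖ ≤ R ^ w → ‖D.F s t‖ ≤ B * R ^ (2 * m) ∧ ‖D.G s t‖ ≤ B * R ^ (3 * m) := by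
  have hcpt : IsCompact (Metric.closedBall (0 : ℂ × ℂ) 1) := isCompact_closedBall _ _
  obtain ⟨B₁, h₁⟩ := hcpt.exists_bound_of_continuousOn D.continuous_F.continuousOn
  obtain ⟨B₂, h₂⟩ := hcpt.exists_bound_of_continuousOn D.continuous_G.continuousOn
  refine ⟨max 1 (max B₁ B₂), by positivity, fun s t R hR hs ht => ?_⟩
  have hRc : (R : ℂ) ≠ 0 := Complex.ofReal_ne_zero.2 hR.ne'
  have hnR : ‖(R : ℂ)‖ = R := by simp [abs_of_pos hR]
  have hmem : (s / R, t / (R : ℂ) ^ w) ∈ Metric.closedBall (0 : ℂ × ℂ) 1 := by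
    rw [mem_closedBall_zero_iff, Prod.norm_def, norm_div, norm_div, norm_pow, hnR]
    exact max_le ((div_le_one hR).2 hs) ((div_le_one (by positivity)).2 ht)
  have hs' : s = R * (s / R) := by field_simp
  have ht' : t = (R : ℂ) ^ w * (t / (R : ℂ) ^ w) := by field_simp
  constructor
  · rw [hs', ht', D.homog_F, norm_mul, norm_pow, hnR, mul_comm]
    gcongr
    exact (h₁ _ hmem).trans ((le_max_left _ _).trans (le_max_right _ _))
  · rw [hs', ht', D.homog_G, norm_mul, norm_pow, hnR, mul_comm]
    gcongr
    exact (h₂ _ hmem).trans ((le_max_right _ _).trans (le_max_right _ _))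

/-- The dehomogenisations of the forms, as complex polynomials. -/
noncomputable def f : Polynomial ℂ := D.F 1 Polynomial.X

noncomputable def g : Polynomial ℂ := D.G 1 Polynomial.X

theorem eval_f (τ : ℂ) : D.f.eval τ = D.F 1 τ := by
  have := D.map_F (Polynomial.evalRingHom τ) 1 Polynomial.X
  simpa [f] using this

theorem eval_g (τ : ℂ) : D.g.eval τ = D.G 1 τ := by
  have := D.map_G (Polynomial.evalRingHom τ) 1 Polynomial.X
  simpa [g] using this

theorem F_eq_pow_mul {K : Type} [Field K] {s t : K} (hs : s ≠ 0) :
    D.F s t = s ^ (2 * m) * D.F 1 (t / s ^ w) := by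
  rw [← D.homog_F]
  congr 1 <;> field_simp

theorem G_eq_pow_mul {K : Type} [Field K] {s t : K} (hs : s ≠ 0) :
    D.G s t = s ^ (3 * m) * D.G 1 (t / s ^ w) := by
  rw [← D.homog_G]
  congr 1 <;> field_simp

theorem exists_eval_ne : ∃ i j : ℂ,
    D.f.eval i ^ 3 * D.g.eval j ^ 2 ≠ D.f.eval j ^ 3 * D.g.eval i ^ 2 := by
  obtain ⟨i, j, h⟩ := D.nonconstant
  refine ⟨i, j, fun h' => h ?_⟩
  have hF : ∀ i : ℤ, D.F (1 : ℂ) (i : ℂ) = ((D.F 1 i : ℤ) : ℂ) := fun i => by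
    simpa using (D.map_F (Int.castRingHom ℂ) 1 i).symm
  have hG : ∀ i : ℤ, D.G (1 : ℂ) (i : ℂ) = ((D.G 1 i : ℤ) : ℂ) := fun i => by
    simpa using (D.map_G (Int.castRingHom ℂ) 1 i).symm
  rw [eval_f, eval_f, eval_g, eval_g, hF, hF, hG, hG] at h'
  exact_mod_cast h'

/-- A vanishing combination of f³ and g² would satisfy, at the two points of `nonconstant`, two
linear equations in (a,b) with nonzero determinant. -/
theorem pencil_ne_zero {a b : ℂ} (h : a ≠ 0 ∨ b ≠ 0) :
    Polynomial.C b * D.f ^ 3 - Polynomial.C a * D.g ^ 2 ≠ 0 := by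
  intro h0
  obtain ⟨i, j, hij⟩ := D.exists_eval_ne
  have hi := congrArg (Polynomial.eval i) h0
  have hj := congrArg (Polynomial.eval j) h0
  simp only [Polynomial.eval_sub, Polynomial.eval_mul, Polynomial.eval_pow, Polynomial.eval_C,
    Polynomial.eval_zero] at hi hj
  have hij' := sub_ne_zero.2 hij
  rcases h with h | h
  · apply mul_ne_zero h hij'
    linear_combination D.f.eval j ^ 3 * hi - D.f.eval i ^ 3 * hj
  · apply mul_ne_zero h hij'
    linear_combination D.g.eval j ^ 2 * hi - D.g.eval i ^ 2 * hj

theorem natDegree_pencil_le (a b : ℂ) :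
    (Polynomial.C b * D.f ^ 3 - Polynomial.C a * D.g ^ 2).natDegree ≤
      3 * D.f.natDegree + 2 * D.g.natDegree := by
  refine (Polynomial.natDegree_sub_le _ _).trans (max_le ?_ ?_)
  · exact (Polynomial.natDegree_C_mul_le _ _).trans
      (Polynomial.natDegree_pow_le.trans (by omega))
  · exact (Polynomial.natDegree_C_mul_le _ _).trans
      (Polynomial.natDegree_pow_le.trans (by omega))

theorem card_roots_toFinset_pencil_le (a b : ℂ) :
    (Polynomial.C b * D.f ^ 3 - Polynomial.C a * D.g ^ 2).roots.toFinset.card ≤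
      3 * D.f.natDegree + 2 * D.g.natDegree :=
  (Multiset.toFinset_card_le _).trans
    ((Polynomial.card_roots' _).trans (D.natDegree_pencil_le a b))

theorem div_pow_mem_roots {a b s t : ℂ} (h : a ≠ 0 ∨ b ≠ 0) (hs : s ≠ 0)
    (hst : b * D.F s t ^ 3 = a * D.G s t ^ 2) :
    t / s ^ w ∈ (Polynomial.C b * D.f ^ 3 - Polynomial.C a * D.g ^ 2).roots.toFinset := by
  rw [Multiset.mem_toFinset, Polynomial.mem_roots (D.pencil_ne_zero h), Polynomial.IsRoot.def]
  simp only [Polynomial.eval_sub, Polynomial.eval_mul, Polynomial.eval_pow, Polynomial.eval_C,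
    eval_f, eval_g]
  rw [D.F_eq_pow_mul hs, D.G_eq_pow_mul hs] at hst
  have hs6 : s ^ (6 * m) ≠ 0 := pow_ne_zero _ hs
  apply mul_left_cancel₀ hs6
  rw [mul_zero]
  have e1 : s ^ (6 * m) = (s ^ (2 * m)) ^ 3 := by rw [← pow_mul]; congr 1; ring
  have e2 : s ^ (6 * m) = (s ^ (3 * m)) ^ 2 := by rw [← pow_mul]; congr 1; ring
  linear_combination hst + (b * D.F 1 (t / s ^ w) ^ 3) * e1 - (a * D.G 1 (t / s ^ w) ^ 2) * e2

/-- The number of pairs with given values of `F` and `G` is bounded. -/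
theorem card_fiber_le (hm : m ≠ 0) {α β : GaussianInt} (hαβ : IsEllipticPair α β)
    (S : Finset (GaussianInt × GaussianInt))
    (hS : ∀ p ∈ S, p.1 ≠ 0 ∧ D.F p.1 p.2 = α ∧ D.G p.1 p.2 = β) :
    S.card ≤ 6 * m * (3 * D.f.natDegree + 2 * D.g.natDegree) := by
  classical
  -- The ratio α³ : β², which is the j-invariant in another guise, forces τ = t/s^w to be a root of
  -- this pencil member. This leaves boundedly many τ.
  set P := Polynomial.C ((β : ℂ) ^ 2) * D.f ^ 3 - Polynomial.C ((α : ℂ) ^ 3) * D.g ^ 2 with hP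
  have hne : (α : ℂ) ^ 3 ≠ 0 ∨ (β : ℂ) ^ 2 ≠ 0 := by
    by_contra! h
    apply hαβ
    have h1 : α = 0 := GaussianInt.toComplex_eq_zero.1 (eq_zero_of_pow_eq_zero h.1)
    have h2 : β = 0 := GaussianInt.toComplex_eq_zero.1 (eq_zero_of_pow_eq_zero h.2)
    simp [h1, h2]
  have hval : ∀ p ∈ S, (p.1 : ℂ) ≠ 0 ∧ D.F (p.1 : ℂ) (p.2 : ℂ) = α ∧
      D.G (p.1 : ℂ) (p.2 : ℂ) = β := fun p hp => by
    obtain ⟨h1, h2, h3⟩ := hS p hp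
    rw [← h2, ← h3, D.map_F, D.map_G]
    exact ⟨fun h => h1 (GaussianInt.toComplex_eq_zero.1 h), rfl, rfl⟩
  let τ : GaussianInt × GaussianInt → ℂ := fun p => (p.2 : ℂ) / (p.1 : ℂ) ^ w
  have key := Finset.card_le_mul_card_image_of_maps_to (f := τ) (s := S) (t := P.roots.toFinset)
    (fun p hp => ?_) (6 * m) (fun x _ => ?_)
  · exact key.trans (Nat.mul_le_mul_left _ (D.card_roots_toFinset_pencil_le _ _))
  · obtain ⟨h1, h2, h3⟩ := hval p hp
    exact D.div_pow_mem_roots hne h1 (by rw [h2, h3]; ring)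
  -- For fixed τ the discriminant form 4F³ + 27G², of weighted degree 6m, determines s^(6m). Hence s
  -- has at most 6m values, and t = τ s^w.
  · set c : ℂ := (4 * (α : ℂ) ^ 3 + 27 * (β : ℂ) ^ 2) / (4 * D.F 1 x ^ 3 + 27 * D.G 1 x ^ 2) with hc
    have hn := Polynomial.card_nthRoots (6 * m) c
    refine le_trans ?_ ((Multiset.toFinset_card_le _).trans hn)
    refine Finset.card_le_card_of_injOn (fun p => (p.1 : ℂ)) (fun p hp => ?_) ?_
    · obtain ⟨hp, hx⟩ := Finset.mem_filter.1 hp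
      obtain ⟨h1, h2, h3⟩ := hval p hp
      rw [D.F_eq_pow_mul h1] at h2
      rw [D.G_eq_pow_mul h1] at h3
      change (p.2 : ℂ) / (p.1 : ℂ) ^ w = x at hx
      rw [hx] at h2 h3
      have hdisc : 4 * (α : ℂ) ^ 3 + 27 * (β : ℂ) ^ 2 ≠ 0 := by
        intro h
        apply hαβ
        rw [← GaussianInt.toComplex_eq_zero, ← h]
        simp only [map_add, map_mul, map_pow, map_ofNat]
      have e1 : (p.1 : ℂ) ^ (6 * m) = ((p.1 : ℂ) ^ (2 * m)) ^ 3 := by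
        rw [← pow_mul]; congr 1; ring
      have e2 : (p.1 : ℂ) ^ (6 * m) = ((p.1 : ℂ) ^ (3 * m)) ^ 2 := by
        rw [← pow_mul]; congr 1; ring
      have hprod : (p.1 : ℂ) ^ (6 * m) * (4 * D.F 1 x ^ 3 + 27 * D.G 1 x ^ 2) =
          4 * (α : ℂ) ^ 3 + 27 * (β : ℂ) ^ 2 := by
        rw [← h2, ← h3]
        linear_combination (4 * D.F 1 x ^ 3) * e1 + (27 * D.G 1 x ^ 2) * e2
      rw [Finset.mem_coe, Multiset.mem_toFinset, Polynomial.mem_nthRoots (by omega), hc, ← hprod]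
      rw [mul_div_cancel_right₀]
      intro h0
      rw [h0, mul_zero] at hprod
      exact hdisc hprod.symm
    · intro p hp p' hp' h
      obtain ⟨hp, hx⟩ := Finset.mem_filter.1 hp
      obtain ⟨hp', hx'⟩ := Finset.mem_filter.1 hp'
      have h1 := (hval p hp).1
      have h1' := (hval p' hp').1
      change (p.1 : ℂ) = p'.1 at h
      change (p.2 : ℂ) / (p.1 : ℂ) ^ w = x at hx
      change (p'.2 : ℂ) / (p'.1 : ℂ) ^ w = x at hx'
      rw [div_eq_iff (pow_ne_zero _ h1)] at hx
      rw [div_eq_iff (pow_ne_zero _ h1'), ← h, ← hx] at hx'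
      exact Prod.ext (GaussianInt.toComplex_inj.1 h) (GaussianInt.toComplex_inj.1 hx'.symm)

/-- The number of degenerate pairs `(s, t)` with `s` in a given finite set is bounded. -/
theorem card_degenerate_le (S : Finset (GaussianInt × GaussianInt)) (U : Finset GaussianInt)
    (hS : ∀ p ∈ S, p.1 ≠ 0 ∧ p.1 ∈ U ∧ ¬ IsEllipticPair (D.F p.1 p.2) (D.G p.1 p.2)) :
    S.card ≤ (3 * D.f.natDegree + 2 * D.g.natDegree) * U.card := by
  classical
  refine Finset.card_le_mul_card_image_of_maps_to (f := Prod.fst) (fun p hp => (hS p hp).2.1) _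
    fun s _ => ?_
  -- Singular means 4F³ = -27G², a single member of the pencil, so each s admits boundedly many t.
  refine le_trans ?_ (D.card_roots_toFinset_pencil_le (-27) 4)
  refine Finset.card_le_card_of_injOn (fun p => (p.2 : ℂ) / (p.1 : ℂ) ^ w) (fun p hp => ?_) ?_
  · obtain ⟨hp, -⟩ := Finset.mem_filter.1 hp
    obtain ⟨h1, -, h3⟩ := hS p hp
    rw [IsEllipticPair, not_not] at h3
    refine D.div_pow_mem_roots (by norm_num)
      (fun h => h1 (GaussianInt.toComplex_eq_zero.1 h)) ?_
    have h4 := congrArg GaussianInt.toComplex h3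
    simp only [map_add, map_mul, map_pow, map_ofNat, map_zero, D.map_F, D.map_G] at h4
    linear_combination h4
  · intro p hp p' hp' h
    obtain ⟨hp, hx⟩ := Finset.mem_filter.1 hp
    obtain ⟨hp', hx'⟩ := Finset.mem_filter.1 hp'
    have h1 : (p.1 : ℂ) ≠ 0 := fun h => (hS p hp).1 (GaussianInt.toComplex_eq_zero.1 h)
    have h2 : p.1 = p'.1 := hx.trans hx'.symm
    simp only [← h2] at h
    rw [div_left_inj' (pow_ne_zero _ h1)] at h
    exact Prod.ext h2 (GaussianInt.toComplex_inj.1 h)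

/-- d divides C·s^K and C·t^K, and the powers s^K, t^K are again coprime. -/
theorem dvd_of_dvd {R : Type} [CommRing R] {s t d : R} (hst : IsCoprime s t) (hF : d ∣ D.F s t)
    (hG : d ∣ D.G s t) : d ∣ (D.C : R) := by
  obtain ⟨u, v, h⟩ := D.resultant_left s t
  obtain ⟨u', v', h'⟩ := D.resultant_right s t
  obtain ⟨x, y, hxy⟩ := hst.pow (m := D.K) (n := D.K)
  have h1 : d ∣ (D.C : R) * s ^ D.K := h ▸ dvd_add (hF.mul_left _) (hG.mul_left _)
  have h2 : d ∣ (D.C : R) * t ^ D.K := h' ▸ dvd_add (hF.mul_left _) (hG.mul_left _)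
  have h3 := dvd_add (h1.mul_left x) (h2.mul_left y)
  convert h3 using 1
  linear_combination -(D.C : R) * hxy

end WeightedPair

/-! ### Counting minimal equations parametrised by a weighted pair. -/

theorem pairHeight_lt_iff {A B : GaussianInt} {X : ℝ} :
    (pairHeight A B : ℝ) < X ↔ ‖(A : ℂ)‖ ^ 6 < X ∧ ‖(B : ℂ)‖ ^ 4 < X := by
  rw [pairHeight, Int.cast_max, max_lt_iff, Int.cast_pow, Int.cast_pow, GaussianInt.norm_eq_sq,
    GaussianInt.norm_eq_sq, ← pow_mul, ← pow_mul]

theorem pairHeight_lt_pow_iff {A B : GaussianInt} {m : ℕ} {Y : ℝ} (hY : 0 ≤ Y) :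
    (pairHeight A B : ℝ) < Y ^ (12 * m) ↔ ‖(A : ℂ)‖ < Y ^ (2 * m) ∧ ‖(B : ℂ)‖ < Y ^ (3 * m) := by
  have e1 : Y ^ (12 * m) = (Y ^ (2 * m)) ^ 6 := by rw [← pow_mul]; congr 1; ring
  have e2 : Y ^ (12 * m) = (Y ^ (3 * m)) ^ 4 := by rw [← pow_mul]; congr 1; ring
  rw [pairHeight_lt_iff]
  nth_rewrite 1 [e1]
  rw [e2, pow_lt_pow_iff_left₀ (norm_nonneg _) (by positivity) (by norm_num),
    pow_lt_pow_iff_left₀ (norm_nonneg _) (by positivity) (by norm_num)]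

theorem finite_curvesContaining (G : Type) [AddCommGroup G] (X : ℝ) :
    (curvesContaining G X).Finite := by
  refine ((gaussianBox (max 1 X) ×ˢ gaussianBox (max 1 X)).finite_toSet).subset fun p hp => ?_
  obtain ⟨h1, h2⟩ := pairHeight_lt_iff.1 hp.2.2.1
  have key : ∀ (x : ℝ) (n : ℕ), n ≠ 0 → x ^ n < X → x ≤ max 1 X := fun x n hn hx => by
    rcases le_or_gt x 1 with h | h
    · exact h.trans (le_max_left _ _)
    · exact ((le_self_pow₀ h.le hn).trans hx.le).trans (le_max_right _ _)
  rw [Finset.coe_product]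
  exact ⟨mem_gaussianBox (key _ 6 (by norm_num) h1), mem_gaussianBox (key _ 4 (by norm_num) h2)⟩

/-- A nonzero coefficient has absolute value at least 1, so the height is at least 1. This lets the
upper bound hold for every X > 0. -/
theorem one_lt_of_mem_curvesContaining {G : Type} [AddCommGroup G] {X : ℝ}
    {p : GaussianInt × GaussianInt} (hp : p ∈ curvesContaining G X) : 1 < X := by
  obtain ⟨h1, h2⟩ := pairHeight_lt_iff.1 hp.2.2.1
  by_cases hA : p.1 = 0
  · have hB : p.2 ≠ 0 := fun hB => hp.1 (by simp [hA, hB])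
    exact (one_le_pow₀ (GaussianInt.one_le_norm_toComplex hB)).trans_lt h2
  · exact (one_le_pow₀ (GaussianInt.one_le_norm_toComplex hA)).trans_lt h1

namespace WeightedPair

variable {m w : ℕ} (D : WeightedPair m w) {G : Type} [AddCommGroup G]

/-- The triple (q,s,t) determines (A,B), while q, s, t range over boxes with O(1), O(Y²) and
O(Y^(2w)) elements. -/
theorem ncard_curvesContaining_le (hm : m ≠ 0) (hw : w ≠ 0) (Q : ℝ)
    (hU : ∀ A B : GaussianInt, IsEllipticPair A B → IsMinimalPair A B → TorsionContains G A B →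
      ∃ q s t : GaussianInt, q ≠ 0 ∧ ‖(q : ℂ)‖ ≤ Q ∧ q ^ 4 * A = D.F s t ∧ q ^ 6 * B = D.G s t) :
    ∃ K : ℝ, 0 < K ∧ ∀ Y : ℝ, 0 < Y →
      ((curvesContaining G (Y ^ (12 * m))).ncard : ℝ) ≤ K * Y ^ (2 + 2 * w) := by
  classical
  obtain ⟨δ, hδ, hbound⟩ := D.exists_norm_le hm hw
  -- κ absorbs the factors q⁴ and q⁶: Q⁴ and Q⁶ are at most δκ, and κ ≥ 1 gives κ ≤ κ^(2m) and κ ≤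
  -- κ^(3m).
  set κ : ℝ := max 1 (max (Q ^ 4 / δ) (Q ^ 6 / δ)) with hκ
  have hκ1 : 1 ≤ κ := le_max_left _ _
  have hκ4 : Q ^ 4 ≤ δ * κ := by
    rw [← div_le_iff₀' hδ]; exact (le_max_left _ _).trans (le_max_right _ _)
  have hκ6 : Q ^ 6 ≤ δ * κ := by
    rw [← div_le_iff₀' hδ]; exact (le_max_right _ _).trans (le_max_right _ _)
  set N := (gaussianBox Q).card
  -- The summand 1 only ensures positivity, since N vanishes for negative Q.
  refine ⟨N * (9 * κ ^ 2) * (9 * (κ ^ w) ^ 2) + 1, by positivity, fun Y hY => ?_⟩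
  rcases (curvesContaining G (Y ^ (12 * m))).eq_empty_or_nonempty with h | ⟨p₀, hp₀⟩
  · rw [h]; simp; positivity
  have hY1 : 1 ≤ Y := by
    by_contra! h
    exact absurd (one_lt_of_mem_curvesContaining hp₀) (not_lt.2 (pow_le_one₀ hY.le h.le))
  have hκY : 1 ≤ κ * Y := one_le_mul_of_one_le_of_one_le hκ1 hY1
  choose! q s t hq hqQ hA hB using hU
  let Φ : GaussianInt × GaussianInt → GaussianInt × GaussianInt × GaussianInt :=
    fun p => (q p.1 p.2, s p.1 p.2, t p.1 p.2)
  let T := gaussianBox Q ×ˢ gaussianBox (κ * Y) ×ˢ gaussianBox ((κ * Y) ^ w)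
  have hmaps : ∀ p ∈ curvesContaining G (Y ^ (12 * m)), Φ p ∈ (T : Set _) := by
    rintro ⟨A, B⟩ ⟨h1, h2, h3, h4⟩
    obtain ⟨hAY, hBY⟩ := (pairHeight_lt_pow_iff hY.le).1 h3
    simp only at h1 h2 h4 hAY hBY
    have hqA := congrArg (fun z => ‖GaussianInt.toComplex z‖) (hA A B h1 h2 h4)
    have hqB := congrArg (fun z => ‖GaussianInt.toComplex z‖) (hB A B h1 h2 h4)
    simp only [map_mul, map_pow, norm_mul, norm_pow, D.map_F, D.map_G] at hqA hqB
    have hQ := hqQ A B h1 h2 h4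
    have hst := hbound (s A B : ℂ) (t A B : ℂ) (κ * Y) (by positivity) ?_ ?_
    · simp only [T, Finset.coe_product]
      exact ⟨mem_gaussianBox hQ, mem_gaussianBox hst.1, mem_gaussianBox hst.2⟩
    · rw [← hqA]
      calc ‖(q A B : ℂ)‖ ^ 4 * ‖(A : ℂ)‖ ≤ Q ^ 4 * Y ^ (2 * m) := by gcongr
        _ ≤ (δ * κ) * Y ^ (2 * m) := by gcongr
        _ ≤ (δ * κ ^ (2 * m)) * Y ^ (2 * m) := by
          gcongr; exact le_self_pow₀ hκ1 (by omega)
        _ = δ * (κ * Y) ^ (2 * m) := by rw [mul_pow]; ring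
    · rw [← hqB]
      calc ‖(q A B : ℂ)‖ ^ 6 * ‖(B : ℂ)‖ ≤ Q ^ 6 * Y ^ (3 * m) := by gcongr
        _ ≤ (δ * κ) * Y ^ (3 * m) := by gcongr
        _ ≤ (δ * κ ^ (3 * m)) * Y ^ (3 * m) := by
          gcongr; exact le_self_pow₀ hκ1 (by omega)
        _ = δ * (κ * Y) ^ (3 * m) := by rw [mul_pow]; ring
  have hinj : Set.InjOn Φ (curvesContaining G (Y ^ (12 * m))) := by
    rintro ⟨A, B⟩ ⟨h1, h2, -, h4⟩ ⟨A', B'⟩ ⟨h1', h2', -, h4'⟩ h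
    simp only at h1 h2 h4 h1' h2' h4'
    simp only [Φ, Prod.mk.injEq] at h
    obtain ⟨e1, e2, e3⟩ := h
    have hA1 := hA A B h1 h2 h4
    have hA2 := hA A' B' h1' h2' h4'
    have hB1 := hB A B h1 h2 h4
    have hB2 := hB A' B' h1' h2' h4'
    have hq0 := hq A B h1 h2 h4
    rw [← e1, ← e2, ← e3, ← hA1] at hA2
    rw [← e1, ← e2, ← e3, ← hB1] at hB2
    exact Prod.ext (mul_left_cancel₀ (pow_ne_zero _ hq0) hA2).symm
      (mul_left_cancel₀ (pow_ne_zero _ hq0) hB2).symm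
  have hcard := Set.ncard_le_ncard_of_injOn Φ hmaps hinj (Finset.finite_toSet _)
  rw [Set.ncard_coe_finset, Finset.card_product, Finset.card_product] at hcard
  calc ((curvesContaining G (Y ^ (12 * m))).ncard : ℝ)
      ≤ N * ((gaussianBox (κ * Y)).card * (gaussianBox ((κ * Y) ^ w)).card) := by
        exact_mod_cast hcard
    _ ≤ N * ((9 * (κ * Y) ^ 2) * (9 * ((κ * Y) ^ w) ^ 2)) := by
        gcongr
        · exact card_gaussianBox_le hκY
        · exact card_gaussianBox_le (one_le_pow₀ hκY)
    _ = N * (9 * κ ^ 2) * (9 * (κ ^ w) ^ 2) * Y ^ (2 + 2 * w) := by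
        rw [mul_pow, mul_pow, mul_pow, pow_add, mul_comm 2 w, pow_mul]; ring
    _ ≤ _ := by gcongr; linarith

theorem norm_le_of_dvd {s t q : GaussianInt} (hst : IsCoprime s t) {n : ℕ} (hn : n ≠ 0)
    (hF : q ^ n ∣ D.F s t) (hG : q ^ n ∣ D.G s t) : ‖(q : ℂ)‖ ≤ |(D.C : ℝ)| := by
  obtain ⟨r, hr⟩ := (dvd_pow_self q hn).trans (D.dvd_of_dvd hst hF hG)
  have h := congrArg (fun z => ‖GaussianInt.toComplex z‖) hr
  simp only [map_intCast, map_mul, norm_mul, Complex.norm_intCast] at h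
  rw [h]
  refine le_mul_of_one_le_right (norm_nonneg _) (GaussianInt.one_le_norm_toComplex ?_)
  rintro rfl
  rw [mul_zero] at hr
  exact D.C_ne_zero (by exact_mod_cast hr)

/-- Every coprime pair `(s, t)` gives a minimal equation, up to a bounded scaling factor. -/
theorem exists_minimal {s t : GaussianInt} (hst : IsCoprime s t) :
    ∃ q A B : GaussianInt, q ≠ 0 ∧ ‖(q : ℂ)‖ ≤ |(D.C : ℝ)| ∧ q ^ 4 * A = D.F s t ∧
      q ^ 6 * B = D.G s t ∧ IsMinimalPair A B := by
  classical
  -- The admissible scaling factors form a finite set, as they divide C. One of largest absolute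
  -- value gives a minimal equation: a further factor d could be absorbed into q.
  let U := (gaussianBox |(D.C : ℝ)|).filter
    fun q => q ≠ 0 ∧ q ^ 4 ∣ D.F s t ∧ q ^ 6 ∣ D.G s t
  have hmem : ∀ q : GaussianInt, q ≠ 0 → q ^ 4 ∣ D.F s t → q ^ 6 ∣ D.G s t → q ∈ U := by
    intro q h1 h2 h3
    refine Finset.mem_filter.2 ⟨mem_gaussianBox (D.norm_le_of_dvd hst four_ne_zero h2
      ((pow_dvd_pow q (by norm_num)).trans h3)), h1, h2, h3⟩
  obtain ⟨q, hqU, hmax⟩ := U.exists_max_image (fun q => ‖(q : ℂ)‖)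
    ⟨1, hmem 1 one_ne_zero (by simp) (by simp)⟩
  obtain ⟨-, hq0, ⟨A, hA⟩, ⟨B, hB⟩⟩ := Finset.mem_filter.1 hqU
  refine ⟨q, A, B, hq0, D.norm_le_of_dvd hst four_ne_zero ⟨A, hA⟩
      ((pow_dvd_pow q (by norm_num)).trans ⟨B, hB⟩), hA.symm, hB.symm, ?_⟩
  rintro d hd ⟨h1, h2⟩
  -- Unique factorisation turns d¹² ∣ A³ into d⁴ ∣ A, and likewise d¹² ∣ B² into d⁶ ∣ B.
  have h1' : d ^ 4 ∣ A := by
    rw [← UniqueFactorizationMonoid.pow_dvd_pow_iff_dvd three_ne_zero, ← pow_mul]; exact h1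
  have h2' : d ^ 6 ∣ B := by
    rw [← UniqueFactorizationMonoid.pow_dvd_pow_iff_dvd two_ne_zero, ← pow_mul]; exact h2
  -- For d = 0 both forms vanish, so every number divides them, in particular 2C, which exceeds the
  -- bound |C| for common divisors.
  by_cases hd0 : d = 0
  · have hA0 : A = 0 := by simpa [hd0] using h1'
    have hB0 : B = 0 := by simpa [hd0] using h2'
    have h2q := D.norm_le_of_dvd (q := D.C * (1 + 1)) hst one_ne_zero (by simp [hA, hA0])
      (by simp [hB, hB0])
    simp only [map_mul, map_intCast, map_add, map_one, norm_mul, Complex.norm_intCast] at h2q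
    have h3 : 0 < |(D.C : ℝ)| := abs_pos.2 (Int.cast_ne_zero.2 D.C_ne_zero)
    norm_num at h2q
    linarith
  have h3 := hmax (q * d) (hmem _ (mul_ne_zero hq0 hd0)
    (by rw [hA, mul_pow]; exact mul_dvd_mul_left _ h1')
    (by rw [hB, mul_pow]; exact mul_dvd_mul_left _ h2'))
  rw [GaussianInt.toComplex_mul, norm_mul] at h3
  have hqpos : 0 < ‖(q : ℂ)‖ := one_pos.trans_le (GaussianInt.one_le_norm_toComplex hq0)
  have h4 : ‖(d : ℂ)‖ ≤ 1 := by
    by_contra! h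
    exact absurd h3 (not_le.2 (lt_mul_of_one_lt_right hqpos h))
  apply hd
  rw [← Zsqrtd.norm_eq_one_iff]
  have h5 : (d.norm : ℝ) = 1 := by
    rw [GaussianInt.norm_eq_sq, le_antisymm h4 (GaussianInt.one_le_norm_toComplex hd0), one_pow]
  have h6 : d.norm = 1 := by exact_mod_cast h5
  rw [h6]; rfl

/-- Coprime nonsingular pairs (s,t) are sent to (q,A,B). Fibres are bounded by `card_fiber_le` and q
takes boundedly many values, so the number of curves is at least a constant times the number of such
pairs. -/
theorem le_ncard_curvesContaining (hm : m ≠ 0) (hw : w ≠ 0)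
    (hL : ∀ A B q s t : GaussianInt, q ≠ 0 → s ≠ 0 → t ≠ 0 → IsEllipticPair A B →
      q ^ 4 * A = D.F s t → q ^ 6 * B = D.G s t → TorsionContains G A B) :
    ∃ K Y₀ : ℝ, 0 < K ∧ 0 < Y₀ ∧ ∀ Y : ℝ, Y₀ ≤ Y →
      K * Y ^ (2 + 2 * w) ≤ ((curvesContaining G (Y ^ (12 * m))).ncard : ℝ) := by
  classical
  obtain ⟨κ, hκ, hcop⟩ := exists_le_ncard_coprimePairs
  obtain ⟨b, hb, hFG⟩ := D.exists_norm_F_G_le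
  -- With R = ηY the factor b is swallowed: b·Rⁿ ≤ (bη)·Yⁿ < Yⁿ, giving the strict height bound.
  set η : ℝ := 1 / (b + 1) with hη
  have hη0 : 0 < η := by positivity
  have hη1 : η ≤ 1 := by rw [hη, div_le_one (by positivity)]; linarith
  have hbη : b * η < 1 := by rw [hη, mul_one_div, div_lt_one (by positivity)]; linarith
  set deg := 3 * D.f.natDegree + 2 * D.g.natDegree with hdeg
  set V := gaussianBox |(D.C : ℝ)| with hV
  set L : ℕ := 6 * m * deg with hLdef
  set P : ℝ := (L : ℝ) * V.card + 1 with hP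
  -- There are at most 9·deg·R² singular pairs. From R ≥ 18·deg/κ on, this is at most half of the
  -- lower bound κ·R²·R^(2w) for coprime pairs.
  set R₀ : ℝ := max 2 (18 * deg / κ) with hR₀
  refine ⟨κ / 2 * η ^ (2 + 2 * w) / P, R₀ / η, by positivity, by positivity, fun Y hY => ?_⟩
  have hR : R₀ ≤ η * Y := by rwa [div_le_iff₀' hη0] at hY
  have hY0 : 0 < Y := lt_of_lt_of_le (by positivity) hY
  set R : ℝ := η * Y with hRdef
  have hR2 : 2 ≤ R := (le_max_left _ _).trans hR
  have hRw : R ≤ R ^ w := le_self_pow₀ (by linarith) hw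
  set S : Finset (GaussianInt × GaussianInt) := (finite_coprimePairs R (R ^ w)).toFinset
  have hScard : κ * (R ^ 2 * (R ^ w) ^ 2) ≤ (S.card : ℝ) := by
    have := hcop R (R ^ w) hR2 (hR2.trans hRw)
    rwa [Set.ncard_eq_toFinset_card _ (finite_coprimePairs R (R ^ w))] at this
  have hSmem : ∀ p ∈ S, p ∈ coprimePairs R (R ^ w) := fun p hp =>
    (Set.Finite.mem_toFinset _).1 hp
  set Sb := S.filter fun p => ¬ IsEllipticPair (D.F p.1 p.2) (D.G p.1 p.2) with hSb
  set Sg := S.filter fun p => IsEllipticPair (D.F p.1 p.2) (D.G p.1 p.2) with hSg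
  have hsplit : S.card = Sg.card + Sb.card := (Finset.card_filter_add_card_filter_not _).symm
  have hbad : (Sb.card : ℝ) ≤ κ / 2 * (R ^ 2 * (R ^ w) ^ 2) := by
    have h1 := D.card_degenerate_le Sb (gaussianBox R) fun p hp => by
      obtain ⟨hp, hell⟩ := Finset.mem_filter.1 hp
      exact ⟨(hSmem p hp).1.1, mem_gaussianBox (hSmem p hp).1.2, hell⟩
    have h2 : 18 * deg / κ ≤ R := (le_max_right _ _).trans hR
    rw [div_le_iff₀ hκ] at h2
    calc (Sb.card : ℝ) ≤ deg * (gaussianBox R).card := by exact_mod_cast h1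
      _ ≤ deg * (9 * R ^ 2) := by gcongr; exact card_gaussianBox_le (by linarith)
      _ = (18 * deg) / 2 * R ^ 2 := by ring
      _ ≤ (R * κ) / 2 * R ^ 2 := by gcongr
      _ = κ / 2 * (R ^ 2 * R) := by ring
      _ ≤ κ / 2 * (R ^ 2 * (R ^ w) ^ 2) := by
        gcongr
        exact hRw.trans (le_self_pow₀ (by linarith) two_ne_zero)
  have hgood : κ / 2 * (R ^ 2 * (R ^ w) ^ 2) ≤ (Sg.card : ℝ) := by
    have : (S.card : ℝ) = Sg.card + Sb.card := by exact_mod_cast hsplit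
    linarith
  have hmin : ∀ p ∈ coprimePairs R (R ^ w), ∃ q A B : GaussianInt, q ≠ 0 ∧
      ‖(q : ℂ)‖ ≤ |(D.C : ℝ)| ∧ q ^ 4 * A = D.F p.1 p.2 ∧ q ^ 6 * B = D.G p.1 p.2 ∧
      IsMinimalPair A B := fun p hp => D.exists_minimal hp.2.2
  choose! q A B hq0 hqC hA hB hmin using hmin
  set W := (finite_curvesContaining G (Y ^ (12 * m))).toFinset with hW
  have hbY : ∀ n : ℕ, n ≠ 0 → b * R ^ n < Y ^ n := fun n hn => by
    rw [hRdef, mul_pow, ← mul_assoc]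
    have h1 : b * η ^ n ≤ b * η := by gcongr; exact pow_le_of_le_one hη0.le hη1 hn
    have h2 : 0 < Y ^ n := by positivity
    nlinarith
  have hmaps : ∀ p ∈ Sg, (q p, (A p, B p)) ∈ V ×ˢ W := by
    intro p hp
    obtain ⟨hp, hell⟩ := Finset.mem_filter.1 hp
    have hpc := hSmem p hp
    rw [Finset.mem_product]
    refine ⟨mem_gaussianBox (hqC p hpc), (Set.Finite.mem_toFinset _).2 ?_⟩
    have hell' : IsEllipticPair (A p) (B p) := by
      intro h0
      apply hell
      rw [← hA p hpc, ← hB p hpc]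
      linear_combination (q p) ^ 12 * h0
    refine ⟨hell', hmin p hpc, (pairHeight_lt_pow_iff hY0.le).2 ?_,
      hL _ _ _ _ _ (hq0 p hpc) hpc.1.1 hpc.2.1.1 hell' (hA p hpc) (hB p hpc)⟩
    have hqA := congrArg (fun z => ‖GaussianInt.toComplex z‖) (hA p hpc)
    have hqB := congrArg (fun z => ‖GaussianInt.toComplex z‖) (hB p hpc)
    simp only [map_mul, map_pow, norm_mul, norm_pow, D.map_F, D.map_G] at hqA hqB
    obtain ⟨h1, h2⟩ := hFG (p.1 : ℂ) (p.2 : ℂ) R (by linarith) hpc.1.2 hpc.2.1.2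
    have hq1 := GaussianInt.one_le_norm_toComplex (hq0 p hpc)
    constructor
    · refine lt_of_le_of_lt ?_ (hbY (2 * m) (by omega))
      refine le_trans ?_ h1
      rw [← hqA]
      exact le_mul_of_one_le_left (norm_nonneg _) (one_le_pow₀ hq1)
    · refine lt_of_le_of_lt ?_ (hbY (3 * m) (by omega))
      refine le_trans ?_ h2
      rw [← hqB]
      exact le_mul_of_one_le_left (norm_nonneg _) (one_le_pow₀ hq1)
  -- Fixing (q',A',B') fixes the values q'⁴A' and q'⁶B' of the two forms. A nonempty fibre supplies
  -- the nonsingularity that the fibre bound requires.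
  have hcard := Finset.card_le_mul_card_image_of_maps_to hmaps L fun x hx => by
    obtain ⟨q', A', B'⟩ := x
    by_cases hne : (Sg.filter fun p => (q p, (A p, B p)) = (q', A', B')) = ∅
    · rw [hne]; simp
    obtain ⟨p₀, hp₀⟩ := Finset.nonempty_iff_ne_empty.2 hne
    have hkey : ∀ p ∈ Sg.filter fun p => (q p, (A p, B p)) = (q', A', B'),
        p ∈ Sg ∧ D.F p.1 p.2 = q' ^ 4 * A' ∧ D.G p.1 p.2 = q' ^ 6 * B' := fun p hp => by
      obtain ⟨hp, he⟩ := Finset.mem_filter.1 hp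
      simp only [Prod.mk.injEq] at he
      have hpc := hSmem p (Finset.mem_filter.1 hp).1
      rw [← he.1, ← he.2.1, ← he.2.2, hA p hpc, hB p hpc]
      exact ⟨hp, rfl, rfl⟩
    refine D.card_fiber_le hm (α := q' ^ 4 * A') (β := q' ^ 6 * B') ?_ _ fun p hp => ?_
    · obtain ⟨h1, h2, h3⟩ := hkey p₀ hp₀
      rw [← h2, ← h3]
      exact (Finset.mem_filter.1 h1).2
    · obtain ⟨h1, h2, h3⟩ := hkey p hp
      exact ⟨(hSmem p (Finset.mem_filter.1 h1).1).1.1, h2, h3⟩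
  rw [Finset.card_product] at hcard
  have hWcard : (W.card : ℝ) = (curvesContaining G (Y ^ (12 * m))).ncard := by
    rw [Set.ncard_eq_toFinset_card _ (finite_curvesContaining G _)]
  rw [← hWcard, div_mul_eq_mul_div, div_le_iff₀ (by positivity)]
  calc κ / 2 * η ^ (2 + 2 * w) * Y ^ (2 + 2 * w) = κ / 2 * (R ^ 2 * (R ^ w) ^ 2) := by
        rw [hRdef]; ring
    _ ≤ Sg.card := hgood
    _ ≤ L * (V.card * W.card) := by exact_mod_cast hcard
    _ ≤ W.card * P := by
        rw [hP]
        have : (0 : ℝ) ≤ W.card := Nat.cast_nonneg _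
        nlinarith

/-- If the minimal equations whose torsion contains `G` are the specialisations of a weighted
pair, up to bounded scaling factors, then their number has the expected order of magnitude. -/
theorem countContaining_bounds (hm : m ≠ 0) (hw : w ≠ 0) {d : ℕ} (hd : (1 + w) * d = 6 * m) (Q : ℝ)
    (hU : ∀ A B : GaussianInt, IsEllipticPair A B → IsMinimalPair A B → TorsionContains G A B →
      ∃ q s t : GaussianInt, q ≠ 0 ∧ ‖(q : ℂ)‖ ≤ Q ∧ q ^ 4 * A = D.F s t ∧ q ^ 6 * B = D.G s t)
    (hL : ∀ A B q s t : GaussianInt, q ≠ 0 → s ≠ 0 → t ≠ 0 → IsEllipticPair A B →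
      q ^ 4 * A = D.F s t → q ^ 6 * B = D.G s t → TorsionContains G A B) :
    ∃ K₁ K₂ X₀ : ℝ, 0 < K₁ ∧ 0 < K₂ ∧ 0 < X₀ ∧
      (∀ X : ℝ, X₀ ≤ X → K₁ * X ^ (1 / (d : ℝ)) ≤ (countContaining G X : ℝ)) ∧
      (∀ X : ℝ, 0 < X → (countContaining G X : ℝ) ≤ K₂ * X ^ (1 / (d : ℝ))) := by
  obtain ⟨K₁, Y₀, hK₁, hY₀, h₁⟩ := D.le_ncard_curvesContaining hm hw hL
  obtain ⟨K₂, hK₂, h₂⟩ := D.ncard_curvesContaining_le hm hw Q hU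
  have hm' : (m : ℝ) ≠ 0 := Nat.cast_ne_zero.2 hm
  have hd' : (d : ℝ) ≠ 0 := by
    rintro h
    have : d = 0 := by exact_mod_cast h
    subst this
    omega
  have h12 : 12 * m ≠ 0 := by omega
  have hdR : (1 + w : ℝ) * d = 6 * m := by exact_mod_cast hd
  have hroot : ∀ X : ℝ, 0 < X → (X ^ (((12 * m : ℕ) : ℝ)⁻¹)) ^ (12 * m) = X := fun X hX =>
    Real.rpow_inv_natCast_pow hX.le h12
  -- With Y = X^(1/(12m)) the exponent becomes (2 + 2w)/(12m) = (1 + w)/(6m) = 1/d.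
  have hexp : ∀ X : ℝ, 0 < X → (X ^ (((12 * m : ℕ) : ℝ)⁻¹)) ^ (2 + 2 * w) = X ^ (1 / (d : ℝ)) :=
    fun X hX => by
      rw [← Real.rpow_natCast, ← Real.rpow_mul hX.le]
      congr 1
      push_cast
      field_simp
      linear_combination 2 * hdR
  refine ⟨K₁, K₂, Y₀ ^ (12 * m), hK₁, hK₂, by positivity, fun X hX => ?_, fun X hX => ?_⟩
  · have hX0 : 0 < X := lt_of_lt_of_le (by positivity) hX
    have hY : Y₀ ≤ X ^ (((12 * m : ℕ) : ℝ)⁻¹) := by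
      refine le_of_pow_le_pow_left₀ h12 (by positivity) ?_
      rwa [hroot X hX0]
    have := h₁ _ hY
    rwa [hroot X hX0, hexp X hX0] at this
  · have := h₂ (X ^ (((12 * m : ℕ) : ℝ)⁻¹)) (by positivity)
    rwa [hroot X hX, hexp X hX] at this

end WeightedPair

/-! ### From rational to integral parameters. -/

theorem GaussianRat.exists_coprime_fraction (x : GaussianRat) : ∃ a b : GaussianInt, b ≠ 0 ∧
    IsCoprime a b ∧ x = algebraMap GaussianInt GaussianRat a / algebraMap GaussianInt GaussianRat b := by
  obtain ⟨a, b, h, rfl⟩ := IsFractionRing.exists_reduced_fraction (A := GaussianInt) x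
  exact ⟨a, b, nonZeroDivisors.coe_ne_zero b, h.isCoprime, IsFractionRing.mk'_eq_div _⟩

/-- A minimal equation which is a rational specialisation of a pair of forms, up to a rational
change of scale, is an integral specialisation up to a bounded scaling factor. -/
theorem WeightedPair.exists_integral_of_isMinimalPair {k : ℕ} (D : WeightedPair (2 * k) 1)
    {A B : GaussianInt} (hmin : IsMinimalPair A B) {τ u : GaussianRat} (hu : u ≠ 0)
    (hF : u ^ 4 * algebraMap GaussianInt GaussianRat A = D.F 1 τ)
    (hG : u ^ 6 * algebraMap GaussianInt GaussianRat B = D.G 1 τ) :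
    ∃ q s t : GaussianInt, q ≠ 0 ∧ ‖(q : ℂ)‖ ≤ |(D.C : ℝ)| ∧
      q ^ 4 * A = D.F s t ∧ q ^ 6 * B = D.G s t := by
  set ι := algebraMap GaussianInt GaussianRat with hι
  have hinj : Function.Injective ι := IsFractionRing.injective GaussianInt GaussianRat
  have hι0 : ∀ {z : GaussianInt}, z ≠ 0 → ι z ≠ 0 := fun hz => (map_ne_zero_iff ι hinj).2 hz
  obtain ⟨t, s, hs, hts, rfl⟩ := GaussianRat.exists_coprime_fraction τ
  -- F has degree 4k and G degree 6k, so the scale belonging to the integral pair (s,t) is s^k·u. In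
  -- lowest terms p/r it gives p⁴A = r⁴F(s,t) and p⁶B = r⁶G(s,t).
  obtain ⟨p, r, hr, hpr, hp⟩ := GaussianRat.exists_coprime_fraction (ι s ^ k * u)
  have hr' := hι0 hr
  have hp' : ι p = ι r * (ι s ^ k * u) := by
    rw [hp]
    change ι p = ι r * (ι p / ι r)
    field_simp
  have hp0 : p ≠ 0 := by
    rintro rfl
    rw [map_zero] at hp'
    exact mul_ne_zero hr' (mul_ne_zero (pow_ne_zero _ (hι0 hs)) hu) hp'.symm
  have hF' : p ^ 4 * A = r ^ 4 * D.F s t := by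
    apply hinj
    rw [map_mul, map_mul, map_pow, map_pow, D.map_F, D.F_eq_pow_mul (hι0 hs), pow_one, ← hF, hp']
    ring
  have hG' : p ^ 6 * B = r ^ 6 * D.G s t := by
    apply hinj
    rw [map_mul, map_mul, map_pow, map_pow, D.map_G, D.G_eq_pow_mul (hι0 hs), pow_one, ← hG, hp']
    ring
  have hrA : r ^ 4 ∣ A := (hpr.symm.pow (m := 4) (n := 4)).dvd_of_dvd_mul_left ⟨_, hF'⟩
  have hrB : r ^ 6 ∣ B := (hpr.symm.pow (m := 6) (n := 6)).dvd_of_dvd_mul_left ⟨_, hG'⟩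
  -- r is coprime to p, so r⁴ ∣ A and r⁶ ∣ B. Minimality allows this only for a unit, and the scale
  -- is integral.
  have hunit : IsUnit r := by
    by_contra h
    refine hmin r h ⟨?_, ?_⟩
    · have := pow_dvd_pow_of_dvd hrA 3
      rwa [← pow_mul] at this
    · have := pow_dvd_pow_of_dvd hrB 2
      rwa [← pow_mul] at this
  obtain ⟨r', hr'⟩ := hunit.exists_right_inv
  have hFq : (r' * p) ^ 4 * A = D.F s t := by
    have : (r * r') ^ 4 = 1 := by rw [hr', one_pow]
    linear_combination r' ^ 4 * hF' + D.F s t * this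
  have hGq : (r' * p) ^ 6 * B = D.G s t := by
    have : (r * r') ^ 6 = 1 := by rw [hr', one_pow]
    linear_combination r' ^ 6 * hG' + D.G s t * this
  refine ⟨r' * p, s, t, mul_ne_zero ?_ hp0, ?_, hFq, hGq⟩
  · rintro rfl
    simp at hr'
  · exact D.norm_le_of_dvd hts.symm four_ne_zero ⟨_, hFq.symm⟩
      ((pow_dvd_pow _ (by norm_num)).trans ⟨_, hGq.symm⟩)

/-! ### Explicit addition of points and changes of variables. -/

namespace WeierstrassCurve.Affine

variable {F : Type*} [Field F] [DecidableEq F]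

/-- The slope is supplied as a witness, certified by an equation without division. Additions in
parametrised families then reduce to polynomial identities. -/
theorem Point.some_add_some_of_X_ne {W : Affine F} {x₁ y₁ x₂ y₂ x₃ y₃ : F} (ℓ : F)
    (h₁ : W.Nonsingular x₁ y₁) (h₂ : W.Nonsingular x₂ y₂) (h₃ : W.Nonsingular x₃ y₃)
    (hx : x₁ ≠ x₂) (hℓ : ℓ * (x₁ - x₂) = y₁ - y₂)
    (hx₃ : x₃ = ℓ ^ 2 + W.a₁ * ℓ - W.a₂ - x₁ - x₂)
    (hy₃ : y₃ = -(ℓ * (x₃ - x₁) + y₁) - W.a₁ * x₃ - W.a₃) :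
    Point.some x₁ y₁ h₁ + Point.some x₂ y₂ h₂ = Point.some x₃ y₃ h₃ := by
  have hs : W.slope x₁ x₂ y₁ y₂ = ℓ := by
    rw [slope_of_X_ne hx, ← hℓ, mul_div_cancel_right₀ _ (sub_ne_zero.2 hx)]
  have e1 : W.addX x₁ x₂ ℓ = x₃ := hx₃.symm
  rw [Point.add_of_X_ne hx]
  simp only [hs, e1, addY, negAddY, negY, Point.some.injEq, true_and]
  exact hy₃.symm

theorem Point.some_add_self {W : Affine F} {x₁ y₁ x₃ y₃ : F} (ℓ : F)
    (h₁ : W.Nonsingular x₁ y₁) (h₃ : W.Nonsingular x₃ y₃)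
    (hy : 2 * y₁ + W.a₁ * x₁ + W.a₃ ≠ 0)
    (hℓ : ℓ * (2 * y₁ + W.a₁ * x₁ + W.a₃) = 3 * x₁ ^ 2 + 2 * W.a₂ * x₁ + W.a₄ - W.a₁ * y₁)
    (hx₃ : x₃ = ℓ ^ 2 + W.a₁ * ℓ - W.a₂ - x₁ - x₁)
    (hy₃ : y₃ = -(ℓ * (x₃ - x₁) + y₁) - W.a₁ * x₃ - W.a₃) :
    Point.some x₁ y₁ h₁ + Point.some x₁ y₁ h₁ = Point.some x₃ y₃ h₃ := by
  have e0 : y₁ - W.negY x₁ y₁ = 2 * y₁ + W.a₁ * x₁ + W.a₃ := by simp only [negY]; ring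
  have hne : y₁ ≠ W.negY x₁ y₁ := by rwa [← sub_ne_zero, e0]
  have hs : W.slope x₁ x₁ y₁ y₁ = ℓ := by
    rw [slope_of_Y_ne rfl hne, e0, ← hℓ, mul_div_cancel_right₀ _ hy]
  have e1 : W.addX x₁ x₁ ℓ = x₃ := hx₃.symm
  rw [Point.add_self_of_Y_ne hne]
  simp only [hs, e1, addY, negAddY, negY, Point.some.injEq, true_and]
  exact hy₃.symm

omit [DecidableEq F] in
theorem Point.some_eq_neg_some_iff {W : Affine F} {x y x' y' : F} (h : W.Nonsingular x y)
    (h' : W.Nonsingular x' y') :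
    Point.some x y h = -Point.some x' y' h' ↔ x = x' ∧ y = -y' - W.a₁ * x' - W.a₃ := by
  rw [Point.neg_some]
  simp only [negY, Point.some.injEq]

theorem Point.two_nsmul_some_eq_zero_iff {W : Affine F} {x y : F} (h : W.Nonsingular x y) :
    2 • Point.some x y h = 0 ↔ 2 * y + W.a₁ * x + W.a₃ = 0 := by
  rw [two_nsmul, add_eq_zero_iff_eq_neg, Point.some_eq_neg_some_iff]
  constructor
  · rintro ⟨-, h⟩; linear_combination h
  · intro h; exact ⟨rfl, by linear_combination h⟩

omit [DecidableEq F] in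
theorem equation_of_nonsingular {W : Affine F} {x y : F} (h : W.Nonsingular x y) :
    y ^ 2 + W.a₁ * x * y + W.a₃ * y = x ^ 3 + W.a₂ * x ^ 2 + W.a₄ * x + W.a₆ :=
  (W.equation_iff x y).1 h.1

/-- A two-torsion point which is not one of the multiples of `P` has another first coordinate. -/
theorem Point.X_ne_of_two_nsmul_eq_zero (h2 : (2 : F) ≠ 0) {W : Affine F} {x y x' y' : F}
    (h : W.Nonsingular x y) (h' : W.Nonsingular x' y')
    (hne : Point.some x y h ≠ Point.some x' y' h') (hT : 2 • Point.some x y h = 0)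
    (hT' : 2 • Point.some x' y' h' = 0) : x ≠ x' := by
  rintro rfl
  apply hne
  rw [Point.two_nsmul_some_eq_zero_iff] at hT hT'
  simp only [Point.some.injEq, true_and]
  apply mul_left_cancel₀ h2
  linear_combination hT - hT'

/-- `W` is obtained from `W'` by the admissible change of variables
`(x, y) ↦ (u² x + r, u³ y + u² s x + t)`. -/
structure IsVariableChange (W' W : Affine F) (u r s t : F) : Prop where
  u_ne_zero : u ≠ 0
  a₁ : u * W'.a₁ = W.a₁ + 2 * s
  a₂ : u ^ 2 * W'.a₂ = W.a₂ - s * W.a₁ + 3 * r - s ^ 2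
  a₃ : u ^ 3 * W'.a₃ = W.a₃ + r * W.a₁ + 2 * t
  a₄ : u ^ 4 * W'.a₄ = W.a₄ - s * W.a₃ + 2 * r * W.a₂ - (t + r * s) * W.a₁ + 3 * r ^ 2 - 2 * s * t
  a₆ : u ^ 6 * W'.a₆ = W.a₆ + r * W.a₄ + r ^ 2 * W.a₂ + r ^ 3 - t * W.a₃ - t ^ 2 - r * t * W.a₁

namespace IsVariableChange

variable {W' W : Affine F} {u r s t : F} (h : IsVariableChange W' W u r s t)
include h

omit [DecidableEq F] in
theorem equation_iff (x y : F) :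
    W.Equation (u ^ 2 * x + r) (u ^ 3 * y + u ^ 2 * s * x + t) ↔ W'.Equation x y := by
  have key : (u ^ 3 * y + u ^ 2 * s * x + t) ^ 2 +
      W.a₁ * (u ^ 2 * x + r) * (u ^ 3 * y + u ^ 2 * s * x + t) +
      W.a₃ * (u ^ 3 * y + u ^ 2 * s * x + t) - ((u ^ 2 * x + r) ^ 3 + W.a₂ * (u ^ 2 * x + r) ^ 2 +
      W.a₄ * (u ^ 2 * x + r) + W.a₆) = u ^ 6 * (y ^ 2 + W'.a₁ * x * y + W'.a₃ * y -
      (x ^ 3 + W'.a₂ * x ^ 2 + W'.a₄ * x + W'.a₆)) := by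
    linear_combination (-u ^ 5 * x * y) * h.a₁ + (u ^ 4 * x ^ 2) * h.a₂ - (u ^ 3 * y) * h.a₃ +
      (u ^ 2 * x) * h.a₄ + h.a₆
  rw [Affine.equation_iff, Affine.equation_iff, ← sub_eq_zero, key, mul_eq_zero,
    or_iff_right (pow_ne_zero 6 h.u_ne_zero), sub_eq_zero]

omit [DecidableEq F] in
theorem nonsingular (hW : W.Δ ≠ 0) {x y : F} (hxy : W'.Nonsingular x y) :
    W.Nonsingular (u ^ 2 * x + r) (u ^ 3 * y + u ^ 2 * s * x + t) :=
  (equation_iff_nonsingular_of_Δ_ne_zero hW).1 ((h.equation_iff x y).2 hxy.1)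

/-- The map on points induced by a change of variables. -/
def toFun (hW : W.Δ ≠ 0) : W'.Point → W.Point
  | .zero => .zero
  | .some _ _ hxy => .some _ _ (h.nonsingular hW hxy)

/-- A line of slope ℓ goes to a line of slope uℓ + s, so chords and tangents correspond. What
remains is to insert the coefficient relations. -/
theorem toFun_add (hW : W.Δ ≠ 0) (P Q : W'.Point) :
    h.toFun hW (P + Q) = h.toFun hW P + h.toFun hW Q := by
  have hu := h.u_ne_zero
  rcases P with _ | ⟨x₁, y₁, h₁⟩
  · rw [← Point.zero_def, zero_add]; exact (zero_add _).symm
  rcases Q with _ | ⟨x₂, y₂, h₂⟩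
  · rw [← Point.zero_def, add_zero]; exact (add_zero _).symm
  by_cases hx : x₁ = x₂
  · by_cases hy : y₁ = W'.negY x₂ y₂
    · rw [Point.add_of_Y_eq hx hy]
      subst hx
      refine (Point.add_of_Y_eq rfl ?_).symm
      rw [hy]
      simp only [negY]
      linear_combination -(u ^ 2 * x₁) * h.a₁ - h.a₃
    · obtain rfl : y₁ = y₂ := Y_eq_of_Y_ne h₁.1 h₂.1 hx hy
      subst hx
      rw [Point.add_self_of_Y_ne hy]
      have hd : 2 * y₁ + W'.a₁ * x₁ + W'.a₃ ≠ 0 := by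
        intro h0
        apply hy
        simp only [negY]
        linear_combination h0
      have hℓ : W'.slope x₁ x₁ y₁ y₁ * (2 * y₁ + W'.a₁ * x₁ + W'.a₃) =
          3 * x₁ ^ 2 + 2 * W'.a₂ * x₁ + W'.a₄ - W'.a₁ * y₁ := by
        have e0 : y₁ - W'.negY x₁ y₁ = 2 * y₁ + W'.a₁ * x₁ + W'.a₃ := by simp only [negY]; ring
        rw [slope_of_Y_ne rfl hy, e0, div_mul_cancel₀ _ hd]
      set ℓ := W'.slope x₁ x₁ y₁ y₁
      refine (Point.some_add_self (u * ℓ + s) _ _ ?_ ?_ ?_ ?_).symm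
      · have : 2 * (u ^ 3 * y₁ + u ^ 2 * s * x₁ + t) + W.a₁ * (u ^ 2 * x₁ + r) + W.a₃ =
            u ^ 3 * (2 * y₁ + W'.a₁ * x₁ + W'.a₃) := by
          linear_combination -(u ^ 2 * x₁) * h.a₁ - h.a₃
        rw [this]
        exact mul_ne_zero (pow_ne_zero _ hu) hd
      · linear_combination u ^ 4 * hℓ - (u ^ 3 * ℓ * x₁ + u ^ 3 * y₁) * h.a₁ -
          u * ℓ * h.a₃ + 2 * u ^ 2 * x₁ * h.a₂ + h.a₄
      · simp only [addX]
        linear_combination u * ℓ * h.a₁ - h.a₂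
      · simp only [addX, addY, negAddY, negY]
        linear_combination -(u ^ 2 * (ℓ ^ 2 + W'.a₁ * ℓ - W'.a₂ - x₁ - x₁)) * h.a₁ - h.a₃
  · rw [Point.add_of_X_ne hx]
    have hℓ : W'.slope x₁ x₂ y₁ y₂ * (x₁ - x₂) = y₁ - y₂ := by
      rw [slope_of_X_ne hx, div_mul_cancel₀ _ (sub_ne_zero.2 hx)]
    set ℓ := W'.slope x₁ x₂ y₁ y₂
    refine (Point.some_add_some_of_X_ne (u * ℓ + s) _ _ _ ?_ ?_ ?_ ?_).symm
    · intro h0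
      apply hx
      exact mul_left_cancel₀ (pow_ne_zero 2 hu) (add_right_cancel h0)
    · linear_combination u ^ 3 * hℓ
    · simp only [addX]
      linear_combination u * ℓ * h.a₁ - h.a₂
    · simp only [addX, addY, negAddY, negY]
      linear_combination -(u ^ 2 * (ℓ ^ 2 + W'.a₁ * ℓ - W'.a₂ - x₁ - x₂)) * h.a₁ - h.a₃

/-- The group isomorphism induced by a change of variables. -/
noncomputable def pointEquiv (hW' : W'.Δ ≠ 0) (hW : W.Δ ≠ 0) : W'.Point ≃+ W.Point :=
  AddEquiv.ofBijective (AddMonoidHom.mk' (h.toFun hW) (h.toFun_add hW)) <| by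
    have hu := h.u_ne_zero
    constructor
    · rw [injective_iff_map_eq_zero]
      rintro (_ | ⟨x, y, hxy⟩) h0
      · rfl
      · cases h0
    · rintro (_ | ⟨X, Y, hXY⟩)
      · exact ⟨0, rfl⟩
      set x := (X - r) / u ^ 2 with hx
      set y := (Y - t - u ^ 2 * s * x) / u ^ 3 with hy
      have eX : u ^ 2 * x + r = X := by rw [hx]; field_simp; ring
      have eY : u ^ 3 * y + u ^ 2 * s * x + t = Y := by rw [hy]; field_simp; ring
      have hxy : W'.Nonsingular x y := by
        rw [← equation_iff_nonsingular_of_Δ_ne_zero hW', ← h.equation_iff, eX, eY]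
        exact hXY.1
      refine ⟨.some x y hxy, ?_⟩
      change Point.some _ _ _ = _
      simp only [eX, eY]

theorem pointEquiv_some (hW' : W'.Δ ≠ 0) (hW : W.Δ ≠ 0) {x y : F} (hxy : W'.Nonsingular x y) :
    h.pointEquiv hW' hW (.some x y hxy) = .some _ _ (h.nonsingular hW hxy) := rfl

end IsVariableChange

end WeierstrassCurve.Affine

open WeierstrassCurve

/-! ### Tate normal form and the multiples of its origin. -/

/-- The Tate normal form `y² + (1 - c) x y - b y = x³ - b x²`. -/
def tateCurve {F : Type*} [CommRing F] (b c : F) : WeierstrassCurve.Affine F where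
  a₁ := 1 - c
  a₂ := -b
  a₃ := -b
  a₄ := 0
  a₆ := 0

namespace tateCurve

open WeierstrassCurve.Affine

variable {F : Type*} [Field F] {b c d e τ : F}

theorem equation_iff {x y : F} :
    (tateCurve b c).Equation x y ↔ y ^ 2 + (1 - c) * x * y - b * y = x ^ 3 - b * x ^ 2 := by
  rw [Affine.equation_iff]
  simp only [tateCurve]
  constructor <;> intro h <;> linear_combination h

theorem b_ne_zero (hΔ : (tateCurve b c).Δ ≠ 0) : b ≠ 0 := by
  rintro rfl
  apply hΔ
  simp [tateCurve, Δ, b₂, b₄, b₆, b₈]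

theorem nonsingular (hΔ : (tateCurve b c).Δ ≠ 0) {x y : F}
    (h : y ^ 2 + (1 - c) * x * y - b * y = x ^ 3 - b * x ^ 2) :
    (tateCurve b c).Nonsingular x y :=
  (equation_iff_nonsingular_of_Δ_ne_zero hΔ).1 (equation_iff.2 h)

/-- The distinguished point `(0, 0)` of a curve in Tate normal form. -/
def origin (hΔ : (tateCurve b c).Δ ≠ 0) : (tateCurve b c).Point :=
  .some 0 0 (nonsingular hΔ (by ring))

variable [DecidableEq F] (hΔ : (tateCurve b c).Δ ≠ 0)
include hΔ

omit [DecidableEq F] in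
theorem origin_ne_zero : origin hΔ ≠ 0 := Point.some_ne_zero _

theorem two_nsmul_origin : ∃ h, 2 • origin hΔ = .some b (b * c) h := by
  have hb := b_ne_zero hΔ
  refine ⟨nonsingular hΔ (by ring), ?_⟩
  rw [two_nsmul]
  refine Point.some_add_self 0 _ _ ?_ ?_ ?_ ?_ <;> simp only [tateCurve]
  · simpa using hb
  all_goals ring

theorem three_nsmul_origin : ∃ h, 3 • origin hΔ = .some c (b - c) h := by
  have hb := b_ne_zero hΔ
  obtain ⟨h, h2⟩ := two_nsmul_origin hΔ
  refine ⟨nonsingular hΔ (by ring), ?_⟩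
  rw [succ_nsmul, h2]
  refine Point.some_add_some_of_X_ne c _ _ _ hb (by ring) ?_ ?_ <;> simp only [tateCurve] <;> ring

/-- The parameter d = b/c enters because the line through P and 3P has slope (b - c)/c = d - 1. -/
theorem four_nsmul_origin (hd : b = c * d) :
    ∃ h, 4 • origin hΔ = .some (d * (d - 1)) (d ^ 2 * (c - d + 1)) h := by
  have hb := b_ne_zero hΔ
  obtain ⟨h, h3⟩ := three_nsmul_origin hΔ
  have hc : c ≠ 0 := by rintro rfl; exact hb (by rw [hd, zero_mul])
  refine ⟨nonsingular hΔ (by rw [hd]; ring), ?_⟩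
  rw [succ_nsmul, h3]
  refine Point.some_add_some_of_X_ne (d - 1) _ _ _ hc ?_ ?_ ?_ <;> simp only [tateCurve, hd] <;> ring

/-- With e = c/(d - 1) the slope of the line through P and 4P becomes d(e - 1), and the coordinates
of 5P stay polynomial. -/
theorem five_nsmul_origin (hd : b = c * d) (he : c = e * (d - 1)) :
    ∃ h, 5 • origin hΔ = .some (d * e * (e - 1)) (d * e ^ 2 * (d - e)) h := by
  have hb := b_ne_zero hΔ
  obtain ⟨h, h4⟩ := four_nsmul_origin hΔ hd
  have hc : c ≠ 0 := by rintro rfl; exact hb (by rw [hd, zero_mul])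
  have hd0 : d ≠ 0 := by rintro rfl; exact hb (by rw [hd, mul_zero])
  have hd1 : d - 1 ≠ 0 := fun h => hc (by rw [he, h, mul_zero])
  refine ⟨nonsingular hΔ (by rw [hd, he]; ring), ?_⟩
  rw [succ_nsmul, h4]
  refine Point.some_add_some_of_X_ne (d * (e - 1)) _ _ _ (mul_ne_zero hd0 hd1) ?_ ?_ ?_ <;>
    simp only [tateCurve, hd, he] <;> ring

/-- Here τ = (d - e)/(1 - e), so that the line through P and 5P has slope -eτ. -/
theorem six_nsmul_origin (hd : b = c * d) (he : c = e * (d - 1)) (he1 : e ≠ 1)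
    (hτ : d = e * (1 - τ) + τ) :
    ∃ h, 6 • origin hΔ =
      .some (-(e * (1 - τ)) * τ) ((e * (1 - τ)) ^ 2 * (e * (1 - τ) + 2 * τ - 1)) h := by
  have hb := b_ne_zero hΔ
  obtain ⟨h, h5⟩ := five_nsmul_origin hΔ hd he
  have hc : c ≠ 0 := by rintro rfl; exact hb (by rw [hd, zero_mul])
  have hd0 : d ≠ 0 := by rintro rfl; exact hb (by rw [hd, mul_zero])
  have he0 : e ≠ 0 := by rintro rfl; exact hc (by rw [he, zero_mul])
  refine ⟨nonsingular hΔ (by rw [hd, he, hτ]; ring), ?_⟩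
  rw [succ_nsmul, h5]
  refine Point.some_add_some_of_X_ne (-(e * τ)) _ _ _
    (mul_ne_zero (mul_ne_zero hd0 he0) (sub_ne_zero.2 he1)) ?_ ?_ ?_ <;>
    simp only [tateCurve, hd, he, hτ] <;> ring

theorem two_nsmul_origin_ne_zero : 2 • origin hΔ ≠ 0 := by
  obtain ⟨h, h2⟩ := two_nsmul_origin hΔ
  rw [h2]; exact Point.some_ne_zero _

theorem three_nsmul_origin_ne_zero : 3 • origin hΔ ≠ 0 := by
  obtain ⟨h, h3⟩ := three_nsmul_origin hΔ
  rw [h3]; exact Point.some_ne_zero _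

-- This splits nP = 0 into an equation between two smaller multiples: 7 = 4 + 3, 9 = 5 + 4, 12 = 6 +
-- 6 and so on, so nothing beyond 6P is ever computed. When both halves are equal, only the second
-- coordinate gives a condition.
omit hΔ in
theorem add_nsmul_eq_zero_iff {A : Type*} [AddCommGroup A] (P : A) (m n : ℕ) :
    (m + n) • P = 0 ↔ m • P = -(n • P) := by
  rw [add_nsmul, add_eq_zero_iff_eq_neg]

theorem four_nsmul_origin_eq_zero_iff : 4 • origin hΔ = 0 ↔ c = 0 := by
  have hb := b_ne_zero hΔ
  obtain ⟨h, h3⟩ := three_nsmul_origin hΔ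
  have e1 := add_nsmul_eq_zero_iff (origin hΔ) 3 1
  norm_num at e1
  rw [e1, h3, origin, Point.some_eq_neg_some_iff]
  simp only [tateCurve]
  constructor
  · exact fun h => h.1
  · rintro rfl; exact ⟨rfl, by ring⟩

theorem five_nsmul_origin_eq_zero_iff : 5 • origin hΔ = 0 ↔ b = c := by
  obtain ⟨h, h3⟩ := three_nsmul_origin hΔ
  obtain ⟨h', h2⟩ := two_nsmul_origin hΔ
  have e1 := add_nsmul_eq_zero_iff (origin hΔ) 3 2
  norm_num at e1
  rw [e1, h3, h2, Point.some_eq_neg_some_iff]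
  simp only [tateCurve]
  constructor
  · exact fun h => h.1.symm
  · rintro rfl; exact ⟨rfl, by ring⟩

theorem six_nsmul_origin_eq_zero_iff : 6 • origin hΔ = 0 ↔ b = c + c ^ 2 := by
  obtain ⟨h, h3⟩ := three_nsmul_origin hΔ
  have e1 := add_nsmul_eq_zero_iff (origin hΔ) 3 3
  norm_num at e1
  rw [e1, h3, Point.some_eq_neg_some_iff]
  simp only [tateCurve, true_and]
  constructor
  · intro h; linear_combination h
  · intro h; linear_combination h

theorem seven_nsmul_origin_eq_zero_iff (hd : b = c * d) :
    7 • origin hΔ = 0 ↔ c = d * (d - 1) := by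
  obtain ⟨h, h3⟩ := three_nsmul_origin hΔ
  obtain ⟨h', h4⟩ := four_nsmul_origin hΔ hd
  have e1 := add_nsmul_eq_zero_iff (origin hΔ) 4 3
  norm_num at e1
  rw [e1, h3, h4, Point.some_eq_neg_some_iff]
  simp only [tateCurve]
  constructor
  · exact fun h => h.1.symm
  · intro h; exact ⟨h.symm, by rw [hd, h]; ring⟩

theorem eight_nsmul_origin_eq_zero_iff (hd : b = c * d) :
    8 • origin hΔ = 0 ↔ d * c = (d - 1) * (2 * d - 1) := by
  have hd0 : d ≠ 0 := by rintro rfl; exact b_ne_zero hΔ (by rw [hd, mul_zero])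
  obtain ⟨h', h4⟩ := four_nsmul_origin hΔ hd
  have e1 := add_nsmul_eq_zero_iff (origin hΔ) 4 4
  norm_num at e1
  rw [e1, h4, Point.some_eq_neg_some_iff]
  simp only [tateCurve, true_and]
  constructor
  · intro h
    apply mul_left_cancel₀ hd0
    linear_combination h + hd
  · intro h
    linear_combination d * h - hd

theorem nine_nsmul_origin_eq_zero_iff (hd : b = c * d) (he : c = e * (d - 1)) :
    9 • origin hΔ = 0 ↔ d = e ^ 2 - e + 1 := by
  have hd0 : d ≠ 0 := by rintro rfl; exact b_ne_zero hΔ (by rw [hd, mul_zero])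
  obtain ⟨h', h4⟩ := four_nsmul_origin hΔ hd
  obtain ⟨h'', h5⟩ := five_nsmul_origin hΔ hd he
  have e1 := add_nsmul_eq_zero_iff (origin hΔ) 5 4
  norm_num at e1
  rw [e1, h4, h5, Point.some_eq_neg_some_iff]
  simp only [tateCurve]
  constructor
  · rintro ⟨h, -⟩
    apply mul_left_cancel₀ hd0
    linear_combination -h
  · intro h; exact ⟨by rw [h]; ring, by rw [hd, he, h]; ring⟩

theorem ten_nsmul_origin_eq_zero_iff (hd : b = c * d) (he : c = e * (d - 1)) :
    10 • origin hΔ = 0 ↔ d * (3 * e - e ^ 2 - 1) = e ^ 2 := by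
  have hb := b_ne_zero hΔ
  have hc : c ≠ 0 := by rintro rfl; exact hb (by rw [hd, zero_mul])
  have hd0 : d ≠ 0 := by rintro rfl; exact hb (by rw [hd, mul_zero])
  have he0 : e ≠ 0 := by rintro rfl; exact hc (by rw [he, zero_mul])
  obtain ⟨h'', h5⟩ := five_nsmul_origin hΔ hd he
  have e1 := add_nsmul_eq_zero_iff (origin hΔ) 5 5
  norm_num at e1
  rw [e1, h5, Point.some_eq_neg_some_iff]
  simp only [tateCurve, true_and]
  constructor
  · intro h
    apply mul_left_cancel₀ (mul_ne_zero hd0 he0)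
    rw [hd, he] at h
    linear_combination h
  · intro h
    rw [hd, he]
    linear_combination (d * e) * h

theorem twelve_nsmul_origin_eq_zero_iff (hd : b = c * d) (he : c = e * (d - 1)) (he1 : e ≠ 1)
    (hτ : d = e * (1 - τ) + τ) :
    12 • origin hΔ = 0 ↔ (1 - τ) ^ 2 * e = 3 * τ ^ 2 - 3 * τ + 1 := by
  have hb := b_ne_zero hΔ
  have hc : c ≠ 0 := by rintro rfl; exact hb (by rw [hd, zero_mul])
  have he0 : e ≠ 0 := by rintro rfl; exact hc (by rw [he, zero_mul])
  obtain ⟨h'', h6⟩ := six_nsmul_origin hΔ hd he he1 hτ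
  have e1 := add_nsmul_eq_zero_iff (origin hΔ) 6 6
  norm_num at e1
  rw [e1, h6, Point.some_eq_neg_some_iff]
  simp only [tateCurve, true_and]
  constructor
  · intro h
    have hτ1 : 1 - τ ≠ 0 := fun h0 => hc (by
      have : d - 1 = (e - 1) * (1 - τ) := by rw [hτ]; ring
      rw [he, this, h0]; ring)
    apply mul_left_cancel₀ (mul_ne_zero (pow_ne_zero 2 he0) hτ1)
    rw [hd, he, hτ] at h
    linear_combination h
  · intro h
    rw [hd, he, hτ]
    linear_combination e ^ 2 * (1 - τ) * h

end tateCurve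

/-! ### Invariants under a change of variables, and reduction to Tate normal form. -/

namespace WeierstrassCurve.Affine.IsVariableChange

variable {F : Type*} [Field F] {W' W : Affine F} {u r s t : F} (h : IsVariableChange W' W u r s t)
include h

theorem b₂_eq : u ^ 2 * W'.b₂ = W.b₂ + 12 * r := by
  simp only [b₂]
  linear_combination (u * W'.a₁ + W.a₁ + 2 * s) * h.a₁ + 4 * h.a₂

theorem b₄_eq : u ^ 4 * W'.b₄ = W.b₄ + r * W.b₂ + 6 * r ^ 2 := by
  simp only [b₂, b₄]
  linear_combination 2 * h.a₄ + (u ^ 3 * W'.a₃) * h.a₁ + (W.a₁ + 2 * s) * h.a₃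

theorem b₆_eq : u ^ 6 * W'.b₆ = W.b₆ + 2 * r * W.b₄ + r ^ 2 * W.b₂ + 4 * r ^ 3 := by
  simp only [b₂, b₄, b₆]
  linear_combination (u ^ 3 * W'.a₃ + W.a₃ + r * W.a₁ + 2 * t) * h.a₃ + 4 * h.a₆

theorem c₄_eq : u ^ 4 * W'.c₄ = W.c₄ := by
  simp only [c₄]
  linear_combination (u ^ 2 * W'.b₂ + W.b₂ + 12 * r) * h.b₂_eq - 24 * h.b₄_eq

theorem c₆_eq : u ^ 6 * W'.c₆ = W.c₆ := by
  have e2 := h.b₂_eq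
  have e4 := h.b₄_eq
  have e6 := h.b₆_eq
  simp only [c₆]
  have : u ^ 6 * (-W'.b₂ ^ 3 + 36 * W'.b₂ * W'.b₄ - 216 * W'.b₆) =
    -(u ^ 2 * W'.b₂) ^ 3 + 36 * (u ^ 2 * W'.b₂) * (u ^ 4 * W'.b₄) - 216 * (u ^ 6 * W'.b₆) := by ring
  rw [this, e2, e4, e6]
  ring

/-- Deduced from 1728Δ = c₄³ - c₆², which avoids expanding the discriminant and is where
characteristic 0 is used. -/
theorem Δ_eq [CharZero F] : u ^ 12 * W'.Δ = W.Δ := by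
  have h1 := W'.c_relation
  have h2 := W.c_relation
  rw [← h.c₄_eq, ← h.c₆_eq] at h2
  apply mul_left_cancel₀ (show (1728 : F) ≠ 0 by norm_num)
  linear_combination u ^ 12 * h1 - h2

theorem Δ_ne_zero_iff [CharZero F] : W'.Δ ≠ 0 ↔ W.Δ ≠ 0 := by
  rw [← h.Δ_eq]
  simp [h.u_ne_zero]

end WeierstrassCurve.Affine.IsVariableChange

open WeierstrassCurve.Affine

/-- A point which is killed neither by `2` nor by `3` can be moved to the distinguished point of
a curve in Tate normal form. -/
theorem exists_tateCurve {F : Type*} [Field F] [DecidableEq F] [CharZero F] {W : Affine F}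
    (h₁ : W.a₁ = 0) (h₂ : W.a₂ = 0) (h₃ : W.a₃ = 0) (hW : W.Δ ≠ 0) (P : W.Point)
    (hP2 : 2 • P ≠ 0) (hP3 : 3 • P ≠ 0) :
    ∃ (b c u : F) (hΔ : (tateCurve b c).Δ ≠ 0) (φ : (tateCurve b c).Point ≃+ W.Point),
      u ≠ 0 ∧ u ^ 4 * (tateCurve b c).c₄ = W.c₄ ∧ u ^ 6 * (tateCurve b c).c₆ = W.c₆ ∧
      φ (tateCurve.origin hΔ) = P := by
  rcases P with _ | ⟨x, y, hxy⟩
  · exact absurd (by rw [← Point.zero_def, smul_zero]) hP2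
  have hy : y ≠ 0 := by
    rintro rfl
    apply hP2
    rw [Point.two_nsmul_some_eq_zero_iff, h₁, h₃]
    ring
  have heq := equation_of_nonsingular hxy
  rw [h₁, h₂, h₃] at heq
  -- ℓ is the slope of the tangent at P. Moving P to the origin and making this tangent horizontal
  -- leaves the coefficients a₁ = 2ℓ, a₂ = 3x - ℓ², a₃ = 2y, with a₄ = a₆ = 0.
  set ℓ := (3 * x ^ 2 + W.a₄) / (2 * y) with hℓdef
  have hℓ : ℓ * (2 * y) = 3 * x ^ 2 + W.a₄ := by rw [hℓdef]; field_simp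
  -- Otherwise 2P has first coordinate ℓ² - 2x = x, so that 2P = -P and 3P = 0.
  have ha : 3 * x - ℓ ^ 2 ≠ 0 := by
    intro h0
    apply hP3
    have hneg : W.Nonsingular x (-y) := by
      have := (W.nonsingular_neg x y).2 hxy
      rwa [negY, h₁, h₃, zero_mul, sub_zero, sub_zero] at this
    have hdouble : Point.some x y hxy + Point.some x y hxy = Point.some x (-y) hneg := by
      refine Point.some_add_self ℓ _ _ ?_ ?_ ?_ ?_ <;> simp only [h₁, h₂, h₃]
      · simpa using hy
      · linear_combination hℓ
      · linear_combination h0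
      · ring
    rw [succ_nsmul, two_nsmul, hdouble, add_comm, add_eq_zero_iff_eq_neg,
      Point.some_eq_neg_some_iff, h₁, h₃]
    exact ⟨rfl, by ring⟩
  -- The scale u = a₃/a₂ makes the new a₂ and a₃ equal; their common value is -b.
  set u := 2 * y / (3 * x - ℓ ^ 2) with hu
  have hu0 : u ≠ 0 := div_ne_zero (mul_ne_zero two_ne_zero hy) ha
  have huy : u * (3 * x - ℓ ^ 2) = 2 * y := by rw [hu]; field_simp
  set b := -(3 * x - ℓ ^ 2) / u ^ 2 with hb
  set c := 1 - 2 * ℓ / u with hc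
  have hb' : u ^ 2 * b = -(3 * x - ℓ ^ 2) := by rw [hb]; field_simp
  have hc' : u * (1 - c) = 2 * ℓ := by rw [hc]; field_simp; ring
  have h : IsVariableChange (tateCurve b c) W u x ℓ y := by
    refine ⟨hu0, ?_, ?_, ?_, ?_, ?_⟩ <;> simp only [tateCurve, h₁, h₂, h₃]
    · linear_combination hc'
    · linear_combination -hb'
    · linear_combination -u * hb' + huy
    · linear_combination hℓ
    · linear_combination heq
  have hΔ : (tateCurve b c).Δ ≠ 0 := h.Δ_ne_zero_iff.2 hW
  refine ⟨b, c, u, hΔ, h.pointEquiv hΔ hW, hu0, h.c₄_eq, h.c₆_eq, ?_⟩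
  rw [tateCurve.origin, h.pointEquiv_some]
  simp only [Point.some.injEq]
  constructor <;> ring

/-! ### Embedding the finite groups. -/

section Embeddings

variable {A : Type*} [AddCommGroup A]

theorem exists_zmod_hom_injective {n : ℕ} {P : A} (h : addOrderOf P = n) :
    ∃ φ : ZMod n →+ A, Function.Injective φ ∧ ∀ k : ℕ, φ k = k • P := by
  have h0 : (zmultiplesHom A P) (n : ℤ) = 0 := by
    simp [← h, addOrderOf_nsmul_eq_zero]
  refine ⟨ZMod.lift n ⟨zmultiplesHom A P, h0⟩, ?_, fun k => ?_⟩
  · rw [ZMod.lift_injective]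
    intro m hm
    rw [ZMod.intCast_zmod_eq_zero_iff_dvd, ← h]
    exact addOrderOf_dvd_iff_zsmul_eq_zero.2 (by simpa using hm)
  · have := ZMod.lift_coe n ⟨zmultiplesHom A P, h0⟩ (k : ℤ)
    simpa using this

/-- A kernel element (1,y) would give Q = -yP. Doubling forces 2y = 0, so y is 0 or k and Q would be
0 or kP. The condition `hk` is decidable for each concrete k. -/
theorem exists_zmod_two_prod_hom_injective {k : ℕ} {P Q : A} (hP : addOrderOf P = 2 * k)
    (hQ : Q ≠ 0) (hQ2 : 2 • Q = 0) (hne : Q ≠ k • P)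
    (hk : ∀ y : ZMod (2 * k), 2 * y = 0 → y = 0 ∨ y = (k : ℕ)) :
    ∃ φ : ZMod 2 × ZMod (2 * k) →+ A, Function.Injective φ := by
  obtain ⟨f, hf, hfk⟩ := exists_zmod_hom_injective hP
  obtain ⟨g, hg, hgk⟩ := exists_zmod_hom_injective (addOrderOf_eq_prime hQ2 hQ)
  have hg1 : g 1 = Q := by simpa using hgk 1
  refine ⟨g.coprod f, (injective_iff_map_eq_zero _).2 ?_⟩
  rintro ⟨x, y⟩ h
  rw [AddMonoidHom.coprod_apply] at h
  change g x + f y = 0 at h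
  have hx : x = 0 ∨ x = 1 := (by decide : ∀ x : ZMod 2, x = 0 ∨ x = 1) x
  rcases hx with rfl | rfl
  · rw [map_zero, zero_add] at h
    rw [hf (h.trans (map_zero f).symm)]
    rfl
  · exfalso
    rw [hg1] at h
    have h2 : f (2 * y) = 0 := by
      have h3 := congrArg (2 • ·) h
      simp only [smul_add, hQ2, zero_add, smul_zero] at h3
      rw [← h3, ← map_nsmul]
      simp
    rcases hk y (hf (h2.trans (map_zero f).symm)) with rfl | rfl
    · rw [map_zero, add_zero] at h
      exact hQ h
    · rw [hfk] at h
      apply hne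
      rw [eq_neg_of_add_eq_zero_left h, neg_eq_iff_add_eq_zero, ← two_nsmul, ← mul_nsmul', ← hP,
        addOrderOf_nsmul_eq_zero]

/-- A kernel element, doubled, becomes a relation between 2R and 2P. These are distinct of order
two, hence independent, so both coordinates are even; the same independence then makes them zero. -/
theorem exists_zmod_four_prod_hom_injective {P R : A} (hP : addOrderOf P = 4)
    (hR : addOrderOf R = 4) (hne : 2 • R ≠ 2 • P) :
    ∃ φ : ZMod 4 × ZMod 4 →+ A, Function.Injective φ := by
  obtain ⟨f, hf, hfk⟩ := exists_zmod_hom_injective hP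
  obtain ⟨g, hg, hgk⟩ := exists_zmod_hom_injective hR
  have hf2 : f 2 = 2 • P := by simpa using hfk 2
  have hg2 : g 2 = 2 • R := by simpa using hgk 2
  have hf0 : f 2 ≠ 0 := fun h => absurd (hf (h.trans (map_zero f).symm)) (by decide)
  have hg0 : g 2 ≠ 0 := fun h => absurd (hg (h.trans (map_zero g).symm)) (by decide)
  have hfneg : -f 2 = f 2 := by rw [← map_neg]; exact congrArg f (by decide)
  have hsum : g 2 + f 2 ≠ 0 := fun h => hne (by
    rw [← hf2, ← hg2, eq_neg_of_add_eq_zero_left h, hfneg])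
  refine ⟨g.coprod f, (injective_iff_map_eq_zero _).2 ?_⟩
  rintro ⟨x, y⟩ h
  rw [AddMonoidHom.coprod_apply] at h
  change g x + f y = 0 at h
  have hd : g (2 * x) + f (2 * y) = 0 := by
    rw [two_mul, two_mul, map_add, map_add, add_add_add_comm, h, add_zero]
  have key : ∀ z : ZMod 4, 2 * z = 2 ∨ z = 0 ∨ z = 2 := by decide
  have e0 : (2 : ZMod 4) * 0 = 0 := by decide
  have e2 : (2 : ZMod 4) * 2 = 0 := by decide
  rcases key x with hx | rfl | rfl <;> rcases key y with hy | rfl | rfl <;>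
    simp_all

end Embeddings

/-! ### Short equations over ℚ(i) and families of Tate curves. -/

open WeierstrassCurve.Affine

instance : CharZero GaussianRat :=
  charZero_of_injective_algebraMap (IsFractionRing.injective GaussianInt GaussianRat)

theorem IsEllipticPair.Δ_shortCurve_ne_zero {A B : GaussianInt} (h : IsEllipticPair A B) :
    (shortCurve A B).Δ ≠ 0 := by
  have e : (shortCurve A B).Δ = algebraMap GaussianInt GaussianRat (-16 * (4 * A ^ 3 + 27 * B ^ 2)) := by
    simp only [shortCurve, Δ, b₂, b₄, b₆, b₈, map_mul, map_add, map_neg, map_pow, map_ofNat]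
    ring
  rw [e, map_ne_zero_iff _ (IsFractionRing.injective GaussianInt GaussianRat)]
  refine mul_ne_zero ?_ h
  rw [neg_ne_zero]
  exact OfNat.ofNat_ne_zero 16

theorem c₄_shortCurve (A B : GaussianInt) :
    (shortCurve A B).c₄ = -48 * algebraMap GaussianInt GaussianRat A := by
  simp only [shortCurve, c₄, b₂, b₄]
  ring

theorem c₆_shortCurve (A B : GaussianInt) :
    (shortCurve A B).c₆ = -864 * algebraMap GaussianInt GaussianRat B := by
  simp only [shortCurve, c₆, b₂, b₄, b₆]
  ring

open Classical in
theorem torsionContains_iff {G : Type} [AddCommGroup G] [Finite G] {A B : GaussianInt} :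
    TorsionContains G A B ↔
      ∃ φ : G →+ (shortCurve A B).toAffine.Point, Function.Injective φ := by
  constructor
  · rintro ⟨φ, hφ⟩
    exact ⟨(AddCommGroup.torsion _).subtype.comp φ, Subtype.val_injective.comp hφ⟩
  · rintro ⟨φ, hφ⟩
    refine ⟨φ.codRestrict _ fun g => ?_, fun x y hxy => hφ (congrArg Subtype.val hxy)⟩
    exact AddMonoidHom.isOfFinAddOrder (H := (shortCurve A B).toAffine.Point) φ
      (isOfFinAddOrder_of_finite g)

section Invariants

variable {R : Type} [CommRing R]

/-- The invariant `c₄` of the curve `y² + a₁ x y + ρ a₂ y = x³ + a₂ x²`. -/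
def tateC₄ (ρ a₁ a₂ : R) : R := (a₁ ^ 2 + 4 * a₂) ^ 2 - 24 * (a₁ * (ρ * a₂))

/-- The invariant `c₆` of the curve `y² + a₁ x y + ρ a₂ y = x³ + a₂ x²`. -/
def tateC₆ (ρ a₁ a₂ : R) : R :=
  -(a₁ ^ 2 + 4 * a₂) ^ 3 + 36 * (a₁ ^ 2 + 4 * a₂) * (a₁ * (ρ * a₂)) - 216 * (ρ * a₂) ^ 2

/-- The discriminant of the curve `y² + a₁ x y + ρ a₂ y = x³ + a₂ x²`. -/
def tateDisc (ρ a₁ a₂ : R) : R :=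
  ρ ^ 2 * a₂ ^ 3 *
    (a₁ ^ 3 * ρ + 36 * a₁ * a₂ * ρ - 27 * ρ ^ 2 * a₂ - (a₁ ^ 2 + 4 * a₂) ^ 2)

theorem tate_c_relation (ρ a₁ a₂ : R) :
    1728 * tateDisc ρ a₁ a₂ = tateC₄ ρ a₁ a₂ ^ 3 - tateC₆ ρ a₁ a₂ ^ 2 := by
  simp only [tateDisc, tateC₄, tateC₆]; ring

/-- Rescaling the Tate curve by ρ turns its coefficients 1 - c, -b, -b into a₁, a₂ and ρa₂, and
multiplies c₄ by ρ⁴. -/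
theorem c₄_tateCurve_mul {F : Type} [Field F] {ρ a₁ a₂ b c : F} (h₁ : ρ * (1 - c) = a₁)
    (h₂ : ρ ^ 2 * b = -a₂) : ρ ^ 4 * (tateCurve b c).c₄ = tateC₄ ρ a₁ a₂ := by
  rw [eq_neg_iff_add_eq_zero, add_comm, ← eq_neg_iff_add_eq_zero] at h₂
  simp only [tateCurve, c₄, b₂, b₄, tateC₄, ← h₁, h₂]
  ring

theorem c₆_tateCurve_mul {F : Type} [Field F] {ρ a₁ a₂ b c : F} (h₁ : ρ * (1 - c) = a₁)
    (h₂ : ρ ^ 2 * b = -a₂) : ρ ^ 6 * (tateCurve b c).c₆ = tateC₆ ρ a₁ a₂ := by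
  rw [eq_neg_iff_add_eq_zero, add_comm, ← eq_neg_iff_add_eq_zero] at h₂
  simp only [tateCurve, c₆, b₂, b₄, b₆, tateC₆, ← h₁, h₂]
  ring

end Invariants

/-- A family of curves `y² + a₁ x y + ρ a₂ y = x³ + a₂ x²` whose coefficients are binary forms,
such that `c₄` and the discriminant have no common zero. -/
structure TateForms (k : ℕ) where
  ρ : ∀ {R : Type} [CommRing R], R → R → R
  a₁ : ∀ {R : Type} [CommRing R], R → R → R
  a₂ : ∀ {R : Type} [CommRing R], R → R → R
  map_ρ : ∀ {R S : Type} [CommRing R] [CommRing S] (φ : R →+* S) (s t : R),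
    φ (ρ s t) = ρ (φ s) (φ t)
  map_a₁ : ∀ {R S : Type} [CommRing R] [CommRing S] (φ : R →+* S) (s t : R),
    φ (a₁ s t) = a₁ (φ s) (φ t)
  map_a₂ : ∀ {R S : Type} [CommRing R] [CommRing S] (φ : R →+* S) (s t : R),
    φ (a₂ s t) = a₂ (φ s) (φ t)
  homog_ρ : ∀ {R : Type} [CommRing R] (c s t : R), ρ (c * s) (c * t) = c ^ k * ρ s t
  homog_a₁ : ∀ {R : Type} [CommRing R] (c s t : R), a₁ (c * s) (c * t) = c ^ k * a₁ s t
  homog_a₂ : ∀ {R : Type} [CommRing R] (c s t : R), a₂ (c * s) (c * t) = c ^ (2 * k) * a₂ s t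
  Cs : ℤ
  Ct : ℤ
  Cs_ne_zero : Cs ≠ 0
  Ct_ne_zero : Ct ≠ 0
  Ks : ℕ
  Kt : ℕ
  resultant_left : ∀ {R : Type} [CommRing R] (s t : R), ∃ u v : R,
    u * tateC₄ (ρ s t) (a₁ s t) (a₂ s t) + v * tateDisc (ρ s t) (a₁ s t) (a₂ s t) = Cs * s ^ Ks
  resultant_right : ∀ {R : Type} [CommRing R] (s t : R), ∃ u v : R,
    u * tateC₄ (ρ s t) (a₁ s t) (a₂ s t) + v * tateDisc (ρ s t) (a₁ s t) (a₂ s t) = Ct * t ^ Kt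
  nonconstant : ∃ i j : ℤ,
    tateC₄ (ρ 1 i) (a₁ 1 i) (a₂ 1 i) ^ 3 * tateC₆ (ρ 1 j) (a₁ 1 j) (a₂ 1 j) ^ 2 ≠
    tateC₄ (ρ 1 j) (a₁ 1 j) (a₂ 1 j) ^ 3 * tateC₆ (ρ 1 i) (a₁ 1 i) (a₂ 1 i) ^ 2

namespace TateForms

variable {k : ℕ} (D : TateForms k)

/-- The coefficients `-27 c₄`, `-54 c₆` of a short Weierstrass equation of the family. -/
def toWeightedPair : WeightedPair (2 * k) 1 where
  F s t := -27 * tateC₄ (D.ρ s t) (D.a₁ s t) (D.a₂ s t)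
  G s t := -54 * tateC₆ (D.ρ s t) (D.a₁ s t) (D.a₂ s t)
  map_F φ s t := by
    simp only [tateC₄, map_neg, map_mul, map_sub, map_add, map_pow, map_ofNat, D.map_ρ, D.map_a₁,
      D.map_a₂]
  map_G φ s t := by
    simp only [tateC₆, map_neg, map_mul, map_sub, map_add, map_pow, map_ofNat, D.map_ρ, D.map_a₁,
      D.map_a₂]
  homog_F c s t := by
    simp only [tateC₄, pow_one, D.homog_ρ, D.homog_a₁, D.homog_a₂]
    ring
  homog_G c s t := by
    simp only [tateC₆, pow_one, D.homog_ρ, D.homog_a₁, D.homog_a₂]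
    ring
  -- 93312 = 54·1728: the discriminant is eliminated by 1728Δ = c₄³ - c₆², and 54 clears the factors
  -- -27 and -54. Taking both `Cs`, `Ct` and both exponents gives one constant and one exponent
  -- serving s and t alike.
  C := 93312 * D.Cs * D.Ct
  C_ne_zero := mul_ne_zero (mul_ne_zero (by norm_num) D.Cs_ne_zero) D.Ct_ne_zero
  K := D.Ks + D.Kt
  resultant_left s t := by
    obtain ⟨u, v, h⟩ := D.resultant_left s t
    have hc := tate_c_relation (D.ρ s t) (D.a₁ s t) (D.a₂ s t)
    refine ⟨-(2 * D.Ct * s ^ D.Kt) * (1728 * u + v * tateC₄ (D.ρ s t) (D.a₁ s t) (D.a₂ s t) ^ 2),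
      (D.Ct * s ^ D.Kt) * v * tateC₆ (D.ρ s t) (D.a₁ s t) (D.a₂ s t), ?_⟩
    push_cast
    linear_combination 93312 * (D.Ct * s ^ D.Kt) * h - 54 * (D.Ct * s ^ D.Kt) * v * hc
  resultant_right s t := by
    obtain ⟨u, v, h⟩ := D.resultant_right s t
    have hc := tate_c_relation (D.ρ s t) (D.a₁ s t) (D.a₂ s t)
    refine ⟨-(2 * D.Cs * t ^ D.Ks) * (1728 * u + v * tateC₄ (D.ρ s t) (D.a₁ s t) (D.a₂ s t) ^ 2),
      (D.Cs * t ^ D.Ks) * v * tateC₆ (D.ρ s t) (D.a₁ s t) (D.a₂ s t), ?_⟩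
    push_cast
    linear_combination 93312 * (D.Cs * t ^ D.Ks) * h - 54 * (D.Cs * t ^ D.Ks) * v * hc
  nonconstant := by
    obtain ⟨i, j, h⟩ := D.nonconstant
    refine ⟨i, j, fun h' => h ?_⟩
    apply mul_left_cancel₀ (show (-27 : ℤ) ^ 3 * (-54) ^ 2 ≠ 0 by norm_num)
    linear_combination h'

open Classical in
/-- The number of curves whose torsion contains `G`, if these are the members of a family of
curves in Tate normal form. -/
theorem countContaining_bounds (hk : k ≠ 0) {G : Type} [AddCommGroup G] [Finite G] (g : G)
    (hg2 : 2 • g ≠ 0) (hg3 : 3 • g ≠ 0)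
    (hU : ∀ (b c : GaussianRat) (hΔ : (tateCurve b c).Δ ≠ 0) (φ : G →+ (tateCurve b c).Point),
      Function.Injective φ → φ g = tateCurve.origin hΔ →
      ∃ τ, D.ρ 1 τ ≠ 0 ∧ D.ρ 1 τ * (1 - c) = D.a₁ 1 τ ∧ D.ρ 1 τ ^ 2 * b = -D.a₂ 1 τ)
    (hL : ∀ s t b c : GaussianRat, s ≠ 0 → t ≠ 0 → D.ρ s t ≠ 0 → D.ρ s t * (1 - c) = D.a₁ s t →
      D.ρ s t ^ 2 * b = -D.a₂ s t → (tateCurve b c).Δ ≠ 0 →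
      ∃ φ : G →+ (tateCurve b c).Point, Function.Injective φ) :
    ∃ K₁ K₂ X₀ : ℝ, 0 < K₁ ∧ 0 < K₂ ∧ 0 < X₀ ∧
      (∀ X : ℝ, X₀ ≤ X → K₁ * X ^ (1 / ((6 * k : ℕ) : ℝ)) ≤ (countContaining G X : ℝ)) ∧
      (∀ X : ℝ, 0 < X → (countContaining G X : ℝ) ≤ K₂ * X ^ (1 / ((6 * k : ℕ) : ℝ))) := by
  have hinj := IsFractionRing.injective GaussianInt GaussianRat
  refine D.toWeightedPair.countContaining_bounds (by omega) one_ne_zero (by ring)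
    |(D.toWeightedPair.C : ℝ)| ?_ ?_
  · intro A B hell hmin htor
    obtain ⟨φ, hφ⟩ := torsionContains_iff.1 htor
    obtain ⟨b, c, u, hΔ, ψ, hu, hc4, hc6, hψ⟩ := exists_tateCurve (W := (shortCurve A B).toAffine)
      rfl rfl rfl hell.Δ_shortCurve_ne_zero (φ g)
      (by rw [← map_nsmul]; exact fun h => hg2 (hφ (h.trans (map_zero φ).symm)))
      (by rw [← map_nsmul]; exact fun h => hg3 (hφ (h.trans (map_zero φ).symm)))
    obtain ⟨τ, hρ, h1, h2⟩ := hU b c hΔ (ψ.symm.toAddMonoidHom.comp φ)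
      (ψ.symm.injective.comp hφ) (by simp [← hψ])
    have e4 := c₄_tateCurve_mul h1 h2
    have e6 := c₆_tateCurve_mul h1 h2
    change _ = (shortCurve A B).c₄ at hc4
    change _ = (shortCurve A B).c₆ at hc6
    rw [c₄_shortCurve] at hc4
    rw [c₆_shortCurve] at hc6
    -- The 6 in the scale reconciles c₄ = -48A, c₆ = -864B with the forms -27c₄, -54c₆, since 6⁴ =
    -- 27·48 and 6⁶ = 54·864.
    refine D.toWeightedPair.exists_integral_of_isMinimalPair hmin (τ := τ)
      (u := 6 * D.ρ 1 τ / u) (div_ne_zero (mul_ne_zero (by norm_num) hρ) hu) ?_ ?_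
    · change _ = -27 * tateC₄ _ _ _
      rw [← e4]
      field_simp
      linear_combination 27 * hc4
    · change _ = -54 * tateC₆ _ _ _
      rw [← e6]
      field_simp
      linear_combination 54 * hc6
  · intro A B q s t hq hs ht hell hA hB
    rw [torsionContains_iff]
    set ι := algebraMap GaussianInt GaussianRat with hι
    have hι0 : ∀ {z : GaussianInt}, z ≠ 0 → ι z ≠ 0 := fun hz => (map_ne_zero_iff ι hinj).2 hz
    have hq' := hι0 hq
    have hA' := congrArg ι hA
    have hB' := congrArg ι hB
    rw [map_mul, map_pow, D.toWeightedPair.map_F] at hA'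
    rw [map_mul, map_pow, D.toWeightedPair.map_G] at hB'
    change _ = -27 * tateC₄ (D.ρ (ι s) (ι t)) (D.a₁ (ι s) (ι t)) (D.a₂ (ι s) (ι t)) at hA'
    change _ = -54 * tateC₆ (D.ρ (ι s) (ι t)) (D.a₁ (ι s) (ι t)) (D.a₂ (ι s) (ι t)) at hB'
    have hrel := tate_c_relation (D.ρ (ι s) (ι t)) (D.a₁ (ι s) (ι t)) (D.a₂ (ι s) (ι t))
    -- The discriminant form is divisible by ρ², so ρ = 0 would make the equation with coefficients
    -- A, B singular.
    have hρ : D.ρ (ι s) (ι t) ≠ 0 := by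
      intro h0
      have hdisc : tateDisc (D.ρ (ι s) (ι t)) (D.a₁ (ι s) (ι t)) (D.a₂ (ι s) (ι t)) = 0 := by
        rw [tateDisc, h0]; ring
      rw [hdisc, mul_zero] at hrel
      apply hι0 hell
      rw [map_add, map_mul, map_mul, map_pow, map_pow, map_ofNat, map_ofNat]
      apply mul_left_cancel₀ (pow_ne_zero 12 hq')
      generalize tateC₄ (D.ρ (ι s) (ι t)) (D.a₁ (ι s) (ι t)) (D.a₂ (ι s) (ι t)) = x at *
      generalize tateC₆ (D.ρ (ι s) (ι t)) (D.a₁ (ι s) (ι t)) (D.a₂ (ι s) (ι t)) = y at *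
      have e : ι q ^ 12 * (4 * ι A ^ 3 + 27 * ι B ^ 2) =
        4 * (ι q ^ 4 * ι A) ^ 3 + 27 * (ι q ^ 6 * ι B) ^ 2 := by ring
      rw [e, hA', hB']
      linear_combination 78732 * hrel
    set ρ := D.ρ (ι s) (ι t)
    set c := 1 - D.a₁ (ι s) (ι t) / ρ with hc
    set b := -D.a₂ (ι s) (ι t) / ρ ^ 2 with hb
    have h1 : ρ * (1 - c) = D.a₁ (ι s) (ι t) := by rw [hc]; field_simp; ring
    have h2 : ρ ^ 2 * b = -D.a₂ (ι s) (ι t) := by rw [hb]; field_simp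
    rw [← c₄_tateCurve_mul h1 h2] at hA'
    rw [← c₆_tateCurve_mul h1 h2] at hB'
    have h6ρ : 6 * ρ ≠ 0 := mul_ne_zero (by norm_num) hρ
    -- Completing the square and the cube: r = -b₂/12, s = -a₁/2 and t = -(a₃ + r a₁)/2 for the Tate
    -- curve.
    have hvc : IsVariableChange (shortCurve A B).toAffine (tateCurve b c) (ι q / (6 * ρ))
        (-(tateCurve b c).b₂ / 12) (-(1 - c) / 2)
        ((b + (1 - c) * (tateCurve b c).b₂ / 12) / 2) := by
      refine ⟨div_ne_zero hq' h6ρ, ?_, ?_, ?_, ?_, ?_⟩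
      · simp only [shortCurve, tateCurve]; ring
      · simp only [shortCurve, tateCurve, b₂]; ring
      · simp only [shortCurve, tateCurve]; ring
      · change _ * ι A = _
        rw [div_pow, div_mul_eq_mul_div, hA', div_eq_iff (pow_ne_zero _ h6ρ)]
        simp only [tateCurve, c₄, b₂, b₄]
        ring
      · change _ * ι B = _
        rw [div_pow, div_mul_eq_mul_div, hB', div_eq_iff (pow_ne_zero _ h6ρ)]
        simp only [tateCurve, c₆, b₂, b₄, b₆]
        ring
    have hW := hell.Δ_shortCurve_ne_zero
    have hΔ : (tateCurve b c).Δ ≠ 0 := hvc.Δ_ne_zero_iff.1 hW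
    obtain ⟨φ, hφ⟩ := hL _ _ b c (hι0 hs) (hι0 ht) hρ h1 h2 hΔ
    exact ⟨(hvc.pointEquiv hW hΔ).symm.toAddMonoidHom.comp φ,
      (hvc.pointEquiv hW hΔ).symm.injective.comp hφ⟩

end TateForms

section Meets

variable {R : Type} [CommRing R]

/-- The element `r` belongs to the ideal generated by `x` and `y`. -/
def Meets (x y r : R) : Prop := ∃ u v, u * x + v * y = r

/-- Multiplicativity allows a short Bézout identity for each factor of the discriminant in place of
one enormous identity for the whole. -/
theorem Meets.mul {x y y' r r' : R} (h : Meets x y r) (h' : Meets x y' r') :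
    Meets x (y * y') (r * r') := by
  obtain ⟨u, v, rfl⟩ := h
  obtain ⟨u', v', rfl⟩ := h'
  exact ⟨u * u' * x + u * v' * y' + v * y * u', v * v', by ring⟩

theorem Meets.pow {x y r : R} (h : Meets x y r) (n : ℕ) : Meets x (y ^ n) (r ^ n) := by
  induction n with
  | zero => exact ⟨0, 1, by simp⟩
  | succ n ih => rw [pow_succ, pow_succ]; exact ih.mul h

theorem Meets.congr {x y y' r r' : R} (h : Meets x y r) (hy : y = y') (hr : r = r') :
    ∃ u v, u * x + v * y' = r' := by
  subst hy hr
  exact h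

end Meets

/-! ### The explicit families: c = 1 - a₁/ρ and b = -a₂/ρ² at the parameter t/s. -/

namespace TateForms

/-- The family of curves with torsion subgroup containing `ℤ/5`. -/
def fiveForms : TateForms 1 where
  -- 5P = 0 means b = c, and t/s is this common value.
  ρ s t := s
  a₁ s t := s - t
  a₂ s t := -(s * t)
  map_ρ φ s t := rfl
  map_a₁ φ s t := by simp only [map_sub]
  map_a₂ φ s t := by simp only [map_mul, map_neg]
  homog_ρ c s t := by ring
  homog_a₁ c s t := by ring
  homog_a₂ c s t := by ring
  Cs := 5 * (-1)
  Ct := 5 * (-1)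
  Cs_ne_zero := by norm_num
  Ct_ne_zero := by norm_num
  Ks := 30
  Kt := 30
  resultant_left s t := by
    -- The discriminant is -s⁵t⁵(s² + 11st - t²). Each factor has its own Bézout relation with c₄;
    -- the constants and exponents multiply up to `Cs` and `Ks`. The other families follow the same
    -- pattern.
    have h0 : Meets (tateC₄ (s) (s - t) (-(s * t))) (s) (1 * s ^ 1) :=
      ⟨0,
        1, by simp only [tateC₄]; ring⟩
    have h1 : Meets (tateC₄ (s) (s - t) (-(s * t))) (t) (1 * s ^ 4) :=
      ⟨1,
        -12 * s ^ 3 - 14 * s ^ 2 * t + 12 * s * t ^ 2 - t ^ 3, by simp only [tateC₄]; ring⟩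
    have h2 : Meets (tateC₄ (s) (s - t) (-(s * t))) (s ^ 2 + 11 * s * t - t ^ 2) (5 * s ^ 5) :=
      ⟨122 * s - 11 * t,
        -117 * s ^ 3 - 166 * s ^ 2 * t + 133 * s * t ^ 2 - 11 * t ^ 3, by simp only [tateC₄]; ring⟩
    have hc : Meets (tateC₄ (s) (s - t) (-(s * t))) (-1) (-1) := ⟨0, 1, by ring⟩
    exact ((((h0.pow 5).mul (h1.pow 5)).mul (h2.pow 1)).mul hc).congr
      (by simp only [tateDisc]; ring) (by push_cast; ring)
  resultant_right s t := by
    have h0 : Meets (tateC₄ (s) (s - t) (-(s * t))) (s) (1 * t ^ 4) :=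
      ⟨1,
        -s ^ 3 - 12 * s ^ 2 * t - 14 * s * t ^ 2 + 12 * t ^ 3, by simp only [tateC₄]; ring⟩
    have h1 : Meets (tateC₄ (s) (s - t) (-(s * t))) (t) (1 * t ^ 1) :=
      ⟨0,
        1, by simp only [tateC₄]; ring⟩
    have h2 : Meets (tateC₄ (s) (s - t) (-(s * t))) (s ^ 2 + 11 * s * t - t ^ 2) (5 * t ^ 5) :=
      ⟨11 * s + 122 * t,
        -11 * s ^ 3 - 133 * s ^ 2 * t - 166 * s * t ^ 2 + 117 * t ^ 3, by simp only [tateC₄]; ring⟩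
    have hc : Meets (tateC₄ (s) (s - t) (-(s * t))) (-1) (-1) := ⟨0, 1, by ring⟩
    exact ((((h0.pow 5).mul (h1.pow 5)).mul (h2.pow 1)).mul hc).congr
      (by simp only [tateDisc]; ring) (by push_cast; ring)
  nonconstant := ⟨1, 2, by norm_num [tateC₄, tateC₆]⟩

/-- The family of curves with torsion subgroup containing `ℤ/6`. -/
def sixForms : TateForms 1 where
  -- t/s = c, with b = c + c².
  ρ s t := s
  a₁ s t := s - t
  a₂ s t := -(t * (s + t))
  map_ρ φ s t := rfl
  map_a₁ φ s t := by simp only [map_sub]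
  map_a₂ φ s t := by simp only [map_mul, map_add, map_neg]
  homog_ρ c s t := by ring
  homog_a₁ c s t := by ring
  homog_a₂ c s t := by ring
  Cs := 16 ^ 3 * 16
  Ct := 9 ^ 2 * 16 ^ 3 * 144
  Cs_ne_zero := by norm_num
  Ct_ne_zero := by norm_num
  Ks := 42
  Kt := 30
  resultant_left s t := by
    have h0 : Meets (tateC₄ (s) (s - t) (-(t * (s + t)))) (s) (1 * s ^ 1) :=
      ⟨0,
        1, by simp only [tateC₄]; ring⟩
    have h1 : Meets (tateC₄ (s) (s - t) (-(t * (s + t)))) (t) (1 * s ^ 4) :=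
      ⟨1,
        -12 * s ^ 3 - 30 * s ^ 2 * t - 12 * s * t ^ 2 - 9 * t ^ 3, by simp only [tateC₄]; ring⟩
    have h2 : Meets (tateC₄ (s) (s - t) (-(t * (s + t)))) (s + t) (16 * s ^ 4) :=
      ⟨1,
        15 * s ^ 3 - 27 * s ^ 2 * t - 3 * s * t ^ 2 - 9 * t ^ 3, by simp only [tateC₄]; ring⟩
    have h3 : Meets (tateC₄ (s) (s - t) (-(t * (s + t)))) (s + 9 * t) (16 * s ^ 4) :=
      ⟨729,
        -713 * s ^ 3 - 2331 * s ^ 2 * t - 891 * s * t ^ 2 - 729 * t ^ 3, by simp only [tateC₄]; ring⟩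
    exact ((((h0.pow 2).mul (h1.pow 6)).mul (h2.pow 3)).mul (h3.pow 1)).congr
      (by simp only [tateDisc]; ring) (by push_cast; ring)
  resultant_right s t := by
    have h0 : Meets (tateC₄ (s) (s - t) (-(t * (s + t)))) (s) (9 * t ^ 4) :=
      ⟨1,
        -s ^ 3 - 12 * s ^ 2 * t - 30 * s * t ^ 2 - 12 * t ^ 3, by simp only [tateC₄]; ring⟩
    have h1 : Meets (tateC₄ (s) (s - t) (-(t * (s + t)))) (t) (1 * t ^ 1) :=
      ⟨0,
        1, by simp only [tateC₄]; ring⟩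
    have h2 : Meets (tateC₄ (s) (s - t) (-(t * (s + t)))) (s + t) (16 * t ^ 4) :=
      ⟨1,
        -s ^ 3 - 11 * s ^ 2 * t - 19 * s * t ^ 2 + 7 * t ^ 3, by simp only [tateC₄]; ring⟩
    have h3 : Meets (tateC₄ (s) (s - t) (-(t * (s + t)))) (s + 9 * t) (144 * t ^ 4) :=
      ⟨1,
        -s ^ 3 - 3 * s ^ 2 * t - 3 * s * t ^ 2 + 15 * t ^ 3, by simp only [tateC₄]; ring⟩
    exact ((((h0.pow 2).mul (h1.pow 6)).mul (h2.pow 3)).mul (h3.pow 1)).congr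
      (by simp only [tateDisc]; ring) (by push_cast; ring)
  nonconstant := ⟨1, 2, by norm_num [tateC₄, tateC₆]⟩

/-- The family of curves with torsion subgroup containing `ℤ/7`. -/
def sevenForms : TateForms 2 where
  -- t/s = d, with c = d² - d and b = cd.
  ρ s t := s ^ 2
  a₁ s t := s ^ 2 - t * (t - s)
  a₂ s t := -(s * t ^ 2 * (t - s))
  map_ρ φ s t := by simp only [map_pow]
  map_a₁ φ s t := by simp only [map_mul, map_sub, map_pow]
  map_a₂ φ s t := by simp only [map_mul, map_sub, map_neg, map_pow]
  homog_ρ c s t := by ring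
  homog_a₁ c s t := by ring
  homog_a₂ c s t := by ring
  Cs := 49
  Ct := 49
  Cs_ne_zero := by norm_num
  Ct_ne_zero := by norm_num
  Ks := 129
  Kt := 129
  resultant_left s t := by
    have h0 : Meets (tateC₄ (s ^ 2) (s ^ 2 - t * (t - s)) (-(s * t ^ 2 * (t - s)))) (s) (1 * s ^ 1) :=
      ⟨0,
        1, by simp only [tateC₄]; ring⟩
    have h1 : Meets (tateC₄ (s ^ 2) (s ^ 2 - t * (t - s)) (-(s * t ^ 2 * (t - s)))) (t) (1 * s ^ 8) :=
      ⟨1,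
        -4 * s ^ 7 + 14 * s ^ 6 * t - 35 * s ^ 4 * t ^ 3 + 56 * s ^ 3 * t ^ 4 - 42 * s ^ 2 * t ^ 5 + 12 * s * t ^ 6 - t ^ 7, by simp only [tateC₄]; ring⟩
    have h2 : Meets (tateC₄ (s ^ 2) (s ^ 2 - t * (t - s)) (-(s * t ^ 2 * (t - s)))) (s - t) (1 * s ^ 8) :=
      ⟨1,
        -4 * s ^ 6 * t + 10 * s ^ 5 * t ^ 2 + 10 * s ^ 4 * t ^ 3 - 25 * s ^ 3 * t ^ 4 + 31 * s ^ 2 * t ^ 5 - 11 * s * t ^ 6 + t ^ 7, by simp only [tateC₄]; ring⟩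
    have h3 : Meets (tateC₄ (s ^ 2) (s ^ 2 - t * (t - s)) (-(s * t ^ 2 * (t - s)))) (-s ^ 3 - 5 * s ^ 2 * t + 8 * s * t ^ 2 - t ^ 3) (49 * s ^ 10) :=
      ⟨1710 * s ^ 2 + 3005 * s * t - 444 * t ^ 2,
        1661 * s ^ 7 + 1540 * s ^ 6 * t - 6776 * s ^ 5 * t ^ 2 + 693 * s ^ 4 * t ^ 3 + 6853 * s ^ 3 * t ^ 4 - 12530 * s ^ 2 * t ^ 5 + 4781 * s * t ^ 6 - 444 * t ^ 7, by simp only [tateC₄]; ring⟩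
    exact ((((h0.pow 7).mul (h1.pow 7)).mul (h2.pow 7)).mul (h3.pow 1)).congr
      (by simp only [tateDisc]; ring) (by push_cast; ring)
  resultant_right s t := by
    have h0 : Meets (tateC₄ (s ^ 2) (s ^ 2 - t * (t - s)) (-(s * t ^ 2 * (t - s)))) (s) (1 * t ^ 8) :=
      ⟨1,
        -s ^ 7 - 4 * s ^ 6 * t + 14 * s ^ 5 * t ^ 2 - 35 * s ^ 3 * t ^ 4 + 56 * s ^ 2 * t ^ 5 - 42 * s * t ^ 6 + 12 * t ^ 7, by simp only [tateC₄]; ring⟩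
    have h1 : Meets (tateC₄ (s ^ 2) (s ^ 2 - t * (t - s)) (-(s * t ^ 2 * (t - s)))) (t) (1 * t ^ 1) :=
      ⟨0,
        1, by simp only [tateC₄]; ring⟩
    have h2 : Meets (tateC₄ (s ^ 2) (s ^ 2 - t * (t - s)) (-(s * t ^ 2 * (t - s)))) (s - t) (1 * t ^ 8) :=
      ⟨1,
        -s ^ 7 - 5 * s ^ 6 * t + 9 * s ^ 5 * t ^ 2 + 9 * s ^ 4 * t ^ 3 - 26 * s ^ 3 * t ^ 4 + 30 * s ^ 2 * t ^ 5 - 12 * s * t ^ 6, by simp only [tateC₄]; ring⟩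
    have h3 : Meets (tateC₄ (s ^ 2) (s ^ 2 - t * (t - s)) (-(s * t ^ 2 * (t - s)))) (-s ^ 3 - 5 * s ^ 2 * t + 8 * s * t ^ 2 - t ^ 3) (49 * t ^ 10) :=
      ⟨-444 * s ^ 2 - 2117 * s * t + 4271 * t ^ 2,
        -444 * s ^ 7 - 1673 * s ^ 6 * t + 6832 * s ^ 5 * t ^ 2 - 378 * s ^ 4 * t ^ 3 - 17115 * s ^ 3 * t ^ 4 + 26488 * s ^ 2 * t ^ 5 - 19593 * s * t ^ 6 + 4222 * t ^ 7, by simp only [tateC₄]; ring⟩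
    exact ((((h0.pow 7).mul (h1.pow 7)).mul (h2.pow 7)).mul (h3.pow 1)).congr
      (by simp only [tateDisc]; ring) (by push_cast; ring)
  nonconstant := ⟨1, 2, by norm_num [tateC₄, tateC₆]⟩

/-- The family of curves with torsion subgroup containing `ℤ/8`. -/
def eightForms : TateForms 2 where
  -- t/s = d, with b = (d - 1)(2d - 1) and c = b/d.
  ρ s t := s * t
  a₁ s t := s * t - (t - s) * (2 * t - s)
  a₂ s t := -(t ^ 2 * (t - s) * (2 * t - s))
  map_ρ φ s t := by simp only [map_mul]
  map_a₁ φ s t := by simp only [map_mul, map_sub, map_ofNat]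
  map_a₂ φ s t := by simp only [map_mul, map_sub, map_neg, map_pow, map_ofNat]
  homog_ρ c s t := by ring
  homog_a₁ c s t := by ring
  homog_a₂ c s t := by ring
  Cs := 1
  Ct := 16 ^ 2 * 16 ^ 4 * 16
  Cs_ne_zero := by norm_num
  Ct_ne_zero := by norm_num
  Ks := 170
  Kt := 129
  resultant_left s t := by
    have h0 : Meets (tateC₄ (s * t) (s * t - (t - s) * (2 * t - s)) (-(t ^ 2 * (t - s) * (2 * t - s)))) (s) (1 * s ^ 1) :=
      ⟨0,
        1, by simp only [tateC₄]; ring⟩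
    have h1 : Meets (tateC₄ (s * t) (s * t - (t - s) * (2 * t - s)) (-(t ^ 2 * (t - s) * (2 * t - s)))) (t) (1 * s ^ 8) :=
      ⟨1,
        16 * s ^ 7 - 96 * s ^ 6 * t + 288 * s ^ 5 * t ^ 2 - 480 * s ^ 4 * t ^ 3 + 448 * s ^ 3 * t ^ 4 - 224 * s ^ 2 * t ^ 5 + 64 * s * t ^ 6 - 16 * t ^ 7, by simp only [tateC₄]; ring⟩
    have h2 : Meets (tateC₄ (s * t) (s * t - (t - s) * (2 * t - s)) (-(t ^ 2 * (t - s) * (2 * t - s)))) (s - t) (1 * s ^ 8) :=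
      ⟨1,
        16 * s ^ 6 * t - 80 * s ^ 5 * t ^ 2 + 208 * s ^ 4 * t ^ 3 - 272 * s ^ 3 * t ^ 4 + 176 * s ^ 2 * t ^ 5 - 48 * s * t ^ 6 + 16 * t ^ 7, by simp only [tateC₄]; ring⟩
    have h3 : Meets (tateC₄ (s * t) (s * t - (t - s) * (2 * t - s)) (-(t ^ 2 * (t - s) * (2 * t - s)))) (-s + 2 * t) (1 * s ^ 8) :=
      ⟨16,
        15 * s ^ 7 - 226 * s ^ 6 * t + 1084 * s ^ 5 * t ^ 2 - 2440 * s ^ 4 * t ^ 3 + 2800 * s ^ 3 * t ^ 4 - 1568 * s ^ 2 * t ^ 5 + 448 * s * t ^ 6 - 128 * t ^ 7, by simp only [tateC₄]; ring⟩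
    have h4 : Meets (tateC₄ (s * t) (s * t - (t - s) * (2 * t - s)) (-(t ^ 2 * (t - s) * (2 * t - s)))) (s ^ 2 - 8 * s * t + 8 * t ^ 2) (1 * s ^ 8) :=
      ⟨256,
        -255 * s ^ 6 + 2056 * s ^ 5 * t - 6088 * s ^ 4 * t ^ 2 + 8576 * s ^ 3 * t ^ 3 - 5568 * s ^ 2 * t ^ 4 + 1536 * s * t ^ 5 - 512 * t ^ 6, by simp only [tateC₄]; ring⟩
    exact (((((h0.pow 2).mul (h1.pow 8)).mul (h2.pow 8)).mul (h3.pow 4)).mul (h4.pow 1)).congr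
      (by simp only [tateDisc]; ring) (by push_cast; ring)
  resultant_right s t := by
    have h0 : Meets (tateC₄ (s * t) (s * t - (t - s) * (2 * t - s)) (-(t ^ 2 * (t - s) * (2 * t - s)))) (s) (16 * t ^ 8) :=
      ⟨1,
        -s ^ 7 + 16 * s ^ 6 * t - 96 * s ^ 5 * t ^ 2 + 288 * s ^ 4 * t ^ 3 - 480 * s ^ 3 * t ^ 4 + 448 * s ^ 2 * t ^ 5 - 224 * s * t ^ 6 + 64 * t ^ 7, by simp only [tateC₄]; ring⟩
    have h1 : Meets (tateC₄ (s * t) (s * t - (t - s) * (2 * t - s)) (-(t ^ 2 * (t - s) * (2 * t - s)))) (t) (1 * t ^ 1) :=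
      ⟨0,
        1, by simp only [tateC₄]; ring⟩
    have h2 : Meets (tateC₄ (s * t) (s * t - (t - s) * (2 * t - s)) (-(t ^ 2 * (t - s) * (2 * t - s)))) (s - t) (1 * t ^ 8) :=
      ⟨1,
        -s ^ 7 + 15 * s ^ 6 * t - 81 * s ^ 5 * t ^ 2 + 207 * s ^ 4 * t ^ 3 - 273 * s ^ 3 * t ^ 4 + 175 * s ^ 2 * t ^ 5 - 49 * s * t ^ 6 + 15 * t ^ 7, by simp only [tateC₄]; ring⟩
    have h3 : Meets (tateC₄ (s * t) (s * t - (t - s) * (2 * t - s)) (-(t ^ 2 * (t - s) * (2 * t - s)))) (-s + 2 * t) (16 * t ^ 8) :=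
      ⟨1,
        s ^ 7 - 14 * s ^ 6 * t + 68 * s ^ 5 * t ^ 2 - 152 * s ^ 4 * t ^ 3 + 176 * s ^ 3 * t ^ 4 - 96 * s ^ 2 * t ^ 5 + 32 * s * t ^ 6, by simp only [tateC₄]; ring⟩
    have h4 : Meets (tateC₄ (s * t) (s * t - (t - s) * (2 * t - s)) (-(t ^ 2 * (t - s) * (2 * t - s)))) (s ^ 2 - 8 * s * t + 8 * t ^ 2) (16 * t ^ 9) :=
      ⟨-204 * s + 1393 * t,
        204 * s ^ 7 - 3025 * s ^ 6 * t + 16040 * s ^ 5 * t ^ 2 - 39960 * s ^ 4 * t ^ 3 + 51104 * s ^ 3 * t ^ 4 - 31520 * s ^ 2 * t ^ 5 + 8768 * s * t ^ 6 - 2784 * t ^ 7, by simp only [tateC₄]; ring⟩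
    exact (((((h0.pow 2).mul (h1.pow 8)).mul (h2.pow 8)).mul (h3.pow 4)).mul (h4.pow 1)).congr
      (by simp only [tateDisc]; ring) (by push_cast; ring)
  nonconstant := ⟨1, 2, by norm_num [tateC₄, tateC₆]⟩

/-- The family of curves with torsion subgroup containing `ℤ/9`. -/
def nineForms : TateForms 3 where
  -- t/s = e, with d = e² - e + 1, c = e(d - 1), b = cd.
  ρ s t := s ^ 3
  a₁ s t := s ^ 3 - t ^ 2 * (t - s)
  a₂ s t := -(s * t ^ 2 * (t - s) * (t ^ 2 - t * s + s ^ 2))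
  map_ρ φ s t := by simp only [map_pow]
  map_a₁ φ s t := by simp only [map_mul, map_sub, map_pow]
  map_a₂ φ s t := by simp only [map_mul, map_sub, map_add, map_neg, map_pow]
  homog_ρ c s t := by ring
  homog_a₁ c s t := by ring
  homog_a₂ c s t := by ring
  Cs := 9 ^ 3 * 9
  Ct := 9 ^ 3 * 9
  Cs_ne_zero := by norm_num
  Ct_ne_zero := by norm_num
  Ks := 278
  Kt := 278
  resultant_left s t := by
    have h0 : Meets (tateC₄ (s ^ 3) (s ^ 3 - t ^ 2 * (t - s)) (-(s * t ^ 2 * (t - s) * (t ^ 2 - t * s + s ^ 2)))) (s) (1 * s ^ 1) :=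
      ⟨0,
        1, by simp only [tateC₄]; ring⟩
    have h1 : Meets (tateC₄ (s ^ 3) (s ^ 3 - t ^ 2 * (t - s)) (-(s * t ^ 2 * (t - s) * (t ^ 2 - t * s + s ^ 2)))) (t) (1 * s ^ 12) :=
      ⟨1,
        12 * s ^ 10 * t - 28 * s ^ 9 * t ^ 2 + 18 * s ^ 8 * t ^ 3 + 36 * s ^ 7 * t ^ 4 - 114 * s ^ 6 * t ^ 5 + 180 * s ^ 5 * t ^ 6 - 189 * s ^ 4 * t ^ 7 + 128 * s ^ 3 * t ^ 8 - 54 * s ^ 2 * t ^ 9 + 12 * s * t ^ 10 - t ^ 11, by simp only [tateC₄]; ring⟩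
    have h2 : Meets (tateC₄ (s ^ 3) (s ^ 3 - t ^ 2 * (t - s)) (-(s * t ^ 2 * (t - s) * (t ^ 2 - t * s + s ^ 2)))) (s - t) (1 * s ^ 12) :=
      ⟨1,
        12 * s ^ 9 * t ^ 2 - 16 * s ^ 8 * t ^ 3 + 2 * s ^ 7 * t ^ 4 + 38 * s ^ 6 * t ^ 5 - 76 * s ^ 5 * t ^ 6 + 104 * s ^ 4 * t ^ 7 - 85 * s ^ 3 * t ^ 8 + 43 * s ^ 2 * t ^ 9 - 11 * s * t ^ 10 + t ^ 11, by simp only [tateC₄]; ring⟩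
    have h3 : Meets (tateC₄ (s ^ 3) (s ^ 3 - t ^ 2 * (t - s)) (-(s * t ^ 2 * (t - s) * (t ^ 2 - t * s + s ^ 2)))) (s ^ 2 - s * t + t ^ 2) (9 * s ^ 13) :=
      ⟨-t,
        9 * s ^ 11 + 10 * s ^ 10 * t + s ^ 9 * t ^ 2 - 21 * s ^ 8 * t ^ 3 + 6 * s ^ 7 * t ^ 4 + 9 * s ^ 6 * t ^ 5 - 33 * s ^ 5 * t ^ 6 + 72 * s ^ 4 * t ^ 7 - 75 * s ^ 3 * t ^ 8 + 42 * s ^ 2 * t ^ 9 - 11 * s * t ^ 10 + t ^ 11, by simp only [tateC₄]; ring⟩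
    have h4 : Meets (tateC₄ (s ^ 3) (s ^ 3 - t ^ 2 * (t - s)) (-(s * t ^ 2 * (t - s) * (t ^ 2 - t * s + s ^ 2)))) (-s ^ 3 - 3 * s ^ 2 * t + 6 * s * t ^ 2 - t ^ 3) (9 * s ^ 14) :=
      ⟨623 * s ^ 2 + 1925 * s * t - 377 * t ^ 2,
        614 * s ^ 11 + 83 * s ^ 10 * t - 4418 * s ^ 9 * t ^ 2 + 7482 * s ^ 8 * t ^ 3 - 1827 * s ^ 7 * t ^ 4 - 12843 * s ^ 6 * t ^ 5 + 28593 * s ^ 5 * t ^ 6 - 40128 * s ^ 4 * t ^ 7 + 33054 * s ^ 3 * t ^ 8 - 16582 * s ^ 2 * t ^ 9 + 4187 * s * t ^ 10 - 377 * t ^ 11, by simp only [tateC₄]; ring⟩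
    exact (((((h0.pow 9).mul (h1.pow 9)).mul (h2.pow 9)).mul (h3.pow 3)).mul (h4.pow 1)).congr
      (by simp only [tateDisc]; ring) (by push_cast; ring)
  resultant_right s t := by
    have h0 : Meets (tateC₄ (s ^ 3) (s ^ 3 - t ^ 2 * (t - s)) (-(s * t ^ 2 * (t - s) * (t ^ 2 - t * s + s ^ 2)))) (s) (1 * t ^ 12) :=
      ⟨1,
        -s ^ 11 + 12 * s ^ 9 * t ^ 2 - 28 * s ^ 8 * t ^ 3 + 18 * s ^ 7 * t ^ 4 + 36 * s ^ 6 * t ^ 5 - 114 * s ^ 5 * t ^ 6 + 180 * s ^ 4 * t ^ 7 - 189 * s ^ 3 * t ^ 8 + 128 * s ^ 2 * t ^ 9 - 54 * s * t ^ 10 + 12 * t ^ 11, by simp only [tateC₄]; ring⟩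
    have h1 : Meets (tateC₄ (s ^ 3) (s ^ 3 - t ^ 2 * (t - s)) (-(s * t ^ 2 * (t - s) * (t ^ 2 - t * s + s ^ 2)))) (t) (1 * t ^ 1) :=
      ⟨0,
        1, by simp only [tateC₄]; ring⟩
    have h2 : Meets (tateC₄ (s ^ 3) (s ^ 3 - t ^ 2 * (t - s)) (-(s * t ^ 2 * (t - s) * (t ^ 2 - t * s + s ^ 2)))) (s - t) (1 * t ^ 12) :=
      ⟨1,
        -s ^ 11 - s ^ 10 * t + 11 * s ^ 9 * t ^ 2 - 17 * s ^ 8 * t ^ 3 + s ^ 7 * t ^ 4 + 37 * s ^ 6 * t ^ 5 - 77 * s ^ 5 * t ^ 6 + 103 * s ^ 4 * t ^ 7 - 86 * s ^ 3 * t ^ 8 + 42 * s ^ 2 * t ^ 9 - 12 * s * t ^ 10, by simp only [tateC₄]; ring⟩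
    have h3 : Meets (tateC₄ (s ^ 3) (s ^ 3 - t ^ 2 * (t - s)) (-(s * t ^ 2 * (t - s) * (t ^ 2 - t * s + s ^ 2)))) (s ^ 2 - s * t + t ^ 2) (9 * t ^ 13) :=
      ⟨s - t,
        -s ^ 11 + 13 * s ^ 9 * t ^ 2 - 27 * s ^ 8 * t ^ 3 + 6 * s ^ 7 * t ^ 4 + 51 * s ^ 6 * t ^ 5 - 105 * s ^ 5 * t ^ 6 + 138 * s ^ 4 * t ^ 7 - 126 * s ^ 3 * t ^ 8 + 53 * s ^ 2 * t ^ 9 - 3 * s * t ^ 10 + 10 * t ^ 11, by simp only [tateC₄]; ring⟩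
    have h4 : Meets (tateC₄ (s ^ 3) (s ^ 3 - t ^ 2 * (t - s)) (-(s * t ^ 2 * (t - s) * (t ^ 2 - t * s + s ^ 2)))) (-s ^ 3 - 3 * s ^ 2 * t + 6 * s * t ^ 2 - t ^ 3) (9 * t ^ 14) :=
      ⟨-377 * s ^ 2 - 1171 * s * t + 2171 * t ^ 2,
        -377 * s ^ 11 - 40 * s ^ 10 * t + 4553 * s ^ 9 * t ^ 2 - 10026 * s ^ 8 * t ^ 3 + 5382 * s ^ 7 * t ^ 4 + 14583 * s ^ 6 * t ^ 5 - 41331 * s ^ 5 * t ^ 6 + 62319 * s ^ 4 * t ^ 7 - 62505 * s ^ 3 * t ^ 8 + 38917 * s ^ 2 * t ^ 9 - 14251 * s * t ^ 10 + 2162 * t ^ 11, by simp only [tateC₄]; ring⟩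
    exact (((((h0.pow 9).mul (h1.pow 9)).mul (h2.pow 9)).mul (h3.pow 3)).mul (h4.pow 1)).congr
      (by simp only [tateDisc]; ring) (by push_cast; ring)
  nonconstant := ⟨1, 2, by norm_num [tateC₄, tateC₆]⟩

/-- The family of curves with torsion subgroup containing `ℤ/10`. -/
def tenForms : TateForms 3 where
  -- t/s = e, with d = e²/(3e - e² - 1), c = e(d - 1), b = cd.
  ρ s t := s * (3 * t * s - t ^ 2 - s ^ 2)
  a₁ s t := s * (3 * t * s - t ^ 2 - s ^ 2) - t * (2 * t - s) * (t - s)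
  a₂ s t := -(s * t ^ 3 * (2 * t - s) * (t - s))
  map_ρ φ s t := by simp only [map_mul, map_sub, map_pow, map_ofNat]
  map_a₁ φ s t := by simp only [map_mul, map_sub, map_pow, map_ofNat]
  map_a₂ φ s t := by simp only [map_mul, map_sub, map_neg, map_pow, map_ofNat]
  homog_ρ c s t := by ring
  homog_a₁ c s t := by ring
  homog_a₂ c s t := by ring
  Cs := 5 ^ 2 * 5
  Ct := 16 ^ 5 * 5 ^ 2 * 16 ^ 5 * 80
  Cs_ne_zero := by norm_num
  Ct_ne_zero := by norm_num
  Ks := 344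
  Kt := 289
  resultant_left s t := by
    have h0 : Meets (tateC₄ (s * (3 * t * s - t ^ 2 - s ^ 2)) (s * (3 * t * s - t ^ 2 - s ^ 2) - t * (2 * t - s) * (t - s)) (-(s * t ^ 3 * (2 * t - s) * (t - s)))) (s) (1 * s ^ 1) :=
      ⟨0,
        1, by simp only [tateC₄]; ring⟩
    have h1 : Meets (tateC₄ (s * (3 * t * s - t ^ 2 - s ^ 2)) (s * (3 * t * s - t ^ 2 - s ^ 2) - t * (2 * t - s) * (t - s)) (-(s * t ^ 3 * (2 * t - s) * (t - s)))) (-s ^ 2 + 3 * s * t - t ^ 2) (5 * s ^ 13) :=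
      ⟨6765 * s - 2584 * t,
        6760 * s ^ 11 - 36424 * s ^ 10 * t + 12880 * s ^ 9 * t ^ 2 + 304320 * s ^ 8 * t ^ 3 - 826880 * s ^ 7 * t ^ 4 + 757680 * s ^ 6 * t ^ 5 + 251792 * s ^ 5 * t ^ 6 - 1289120 * s ^ 4 * t ^ 7 + 1495840 * s ^ 3 * t ^ 8 - 954640 * s ^ 2 * t ^ 9 + 314960 * s * t ^ 10 - 41344 * t ^ 11, by simp only [tateC₄]; ring⟩
    have h2 : Meets (tateC₄ (s * (3 * t * s - t ^ 2 - s ^ 2)) (s * (3 * t * s - t ^ 2 - s ^ 2) - t * (2 * t - s) * (t - s)) (-(s * t ^ 3 * (2 * t - s) * (t - s)))) (t) (1 * s ^ 12) :=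
      ⟨1,
        8 * s ^ 11 - 16 * s ^ 10 * t - 40 * s ^ 9 * t ^ 2 + 240 * s ^ 8 * t ^ 3 - 432 * s ^ 7 * t ^ 4 + 256 * s ^ 6 * t ^ 5 + 288 * s ^ 5 * t ^ 6 - 720 * s ^ 4 * t ^ 7 + 720 * s ^ 3 * t ^ 8 - 416 * s ^ 2 * t ^ 9 + 128 * s * t ^ 10 - 16 * t ^ 11, by simp only [tateC₄]; ring⟩
    have h3 : Meets (tateC₄ (s * (3 * t * s - t ^ 2 - s ^ 2)) (s * (3 * t * s - t ^ 2 - s ^ 2) - t * (2 * t - s) * (t - s)) (-(s * t ^ 3 * (2 * t - s) * (t - s)))) (s - t) (1 * s ^ 12) :=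
      ⟨1,
        8 * s ^ 10 * t - 8 * s ^ 9 * t ^ 2 - 48 * s ^ 8 * t ^ 3 + 192 * s ^ 7 * t ^ 4 - 240 * s ^ 6 * t ^ 5 + 16 * s ^ 5 * t ^ 6 + 304 * s ^ 4 * t ^ 7 - 416 * s ^ 3 * t ^ 8 + 304 * s ^ 2 * t ^ 9 - 112 * s * t ^ 10 + 16 * t ^ 11, by simp only [tateC₄]; ring⟩
    have h4 : Meets (tateC₄ (s * (3 * t * s - t ^ 2 - s ^ 2)) (s * (3 * t * s - t ^ 2 - s ^ 2) - t * (2 * t - s) * (t - s)) (-(s * t ^ 3 * (2 * t - s) * (t - s)))) (-s + 2 * t) (1 * s ^ 12) :=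
      ⟨256,
        255 * s ^ 11 - 1538 * s ^ 10 * t + 1020 * s ^ 9 * t ^ 2 + 12280 * s ^ 8 * t ^ 3 - 36880 * s ^ 7 * t ^ 4 + 36832 * s ^ 6 * t ^ 5 + 8128 * s ^ 5 * t ^ 6 - 57472 * s ^ 4 * t ^ 7 + 69376 * s ^ 3 * t ^ 8 - 45568 * s ^ 2 * t ^ 9 + 15360 * s * t ^ 10 - 2048 * t ^ 11, by simp only [tateC₄]; ring⟩
    have h5 : Meets (tateC₄ (s * (3 * t * s - t ^ 2 - s ^ 2)) (s * (3 * t * s - t ^ 2 - s ^ 2) - t * (2 * t - s) * (t - s)) (-(s * t ^ 3 * (2 * t - s) * (t - s)))) (-s ^ 2 - 2 * s * t + 4 * t ^ 2) (5 * s ^ 13) :=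
      ⟨1280 * s + 4096 * t,
        1275 * s ^ 11 - 8694 * s ^ 10 * t + 10200 * s ^ 9 * t ^ 2 + 61560 * s ^ 8 * t ^ 3 - 225680 * s ^ 7 * t ^ 4 + 267520 * s ^ 6 * t ^ 5 + 4032 * s ^ 5 * t ^ 6 - 355200 * s ^ 4 * t ^ 7 + 468480 * s ^ 3 * t ^ 8 - 330240 * s ^ 2 * t ^ 9 + 117760 * s * t ^ 10 - 16384 * t ^ 11, by simp only [tateC₄]; ring⟩
    exact ((((((h0.pow 5).mul (h1.pow 2)).mul (h2.pow 10)).mul (h3.pow 10)).mul (h4.pow 5)).mul (h5.pow 1)).congr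
      (by simp only [tateDisc]; ring) (by push_cast; ring)
  resultant_right s t := by
    have h0 : Meets (tateC₄ (s * (3 * t * s - t ^ 2 - s ^ 2)) (s * (3 * t * s - t ^ 2 - s ^ 2) - t * (2 * t - s) * (t - s)) (-(s * t ^ 3 * (2 * t - s) * (t - s)))) (s) (16 * t ^ 12) :=
      ⟨1,
        -s ^ 11 + 8 * s ^ 10 * t - 16 * s ^ 9 * t ^ 2 - 40 * s ^ 8 * t ^ 3 + 240 * s ^ 7 * t ^ 4 - 432 * s ^ 6 * t ^ 5 + 256 * s ^ 5 * t ^ 6 + 288 * s ^ 4 * t ^ 7 - 720 * s ^ 3 * t ^ 8 + 720 * s ^ 2 * t ^ 9 - 416 * s * t ^ 10 + 128 * t ^ 11, by simp only [tateC₄]; ring⟩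
    have h1 : Meets (tateC₄ (s * (3 * t * s - t ^ 2 - s ^ 2)) (s * (3 * t * s - t ^ 2 - s ^ 2) - t * (2 * t - s) * (t - s)) (-(s * t ^ 3 * (2 * t - s) * (t - s)))) (-s ^ 2 + 3 * s * t - t ^ 2) (5 * t ^ 13) :=
      ⟨-8 * s + 21 * t,
        -8 * s ^ 11 + 61 * s ^ 10 * t - 105 * s ^ 9 * t ^ 2 - 360 * s ^ 8 * t ^ 3 + 1785 * s ^ 7 * t ^ 4 - 2781 * s ^ 6 * t ^ 5 + 992 * s ^ 5 * t ^ 6 + 2685 * s ^ 4 * t ^ 7 - 4745 * s ^ 3 * t ^ 8 + 3960 * s ^ 2 * t ^ 9 - 1823 * s * t ^ 10 + 331 * t ^ 11, by simp only [tateC₄]; ring⟩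
    have h2 : Meets (tateC₄ (s * (3 * t * s - t ^ 2 - s ^ 2)) (s * (3 * t * s - t ^ 2 - s ^ 2) - t * (2 * t - s) * (t - s)) (-(s * t ^ 3 * (2 * t - s) * (t - s)))) (t) (1 * t ^ 1) :=
      ⟨0,
        1, by simp only [tateC₄]; ring⟩
    have h3 : Meets (tateC₄ (s * (3 * t * s - t ^ 2 - s ^ 2)) (s * (3 * t * s - t ^ 2 - s ^ 2) - t * (2 * t - s) * (t - s)) (-(s * t ^ 3 * (2 * t - s) * (t - s)))) (s - t) (1 * t ^ 12) :=
      ⟨1,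
        -s ^ 11 + 7 * s ^ 10 * t - 9 * s ^ 9 * t ^ 2 - 49 * s ^ 8 * t ^ 3 + 191 * s ^ 7 * t ^ 4 - 241 * s ^ 6 * t ^ 5 + 15 * s ^ 5 * t ^ 6 + 303 * s ^ 4 * t ^ 7 - 417 * s ^ 3 * t ^ 8 + 303 * s ^ 2 * t ^ 9 - 113 * s * t ^ 10 + 15 * t ^ 11, by simp only [tateC₄]; ring⟩
    have h4 : Meets (tateC₄ (s * (3 * t * s - t ^ 2 - s ^ 2)) (s * (3 * t * s - t ^ 2 - s ^ 2) - t * (2 * t - s) * (t - s)) (-(s * t ^ 3 * (2 * t - s) * (t - s)))) (-s + 2 * t) (16 * t ^ 12) :=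
      ⟨1,
        s ^ 11 - 6 * s ^ 10 * t + 4 * s ^ 9 * t ^ 2 + 48 * s ^ 8 * t ^ 3 - 144 * s ^ 7 * t ^ 4 + 144 * s ^ 6 * t ^ 5 + 32 * s ^ 5 * t ^ 6 - 224 * s ^ 4 * t ^ 7 + 272 * s ^ 3 * t ^ 8 - 176 * s ^ 2 * t ^ 9 + 64 * s * t ^ 10, by simp only [tateC₄]; ring⟩
    have h5 : Meets (tateC₄ (s * (3 * t * s - t ^ 2 - s ^ 2)) (s * (3 * t * s - t ^ 2 - s ^ 2) - t * (2 * t - s) * (t - s)) (-(s * t ^ 3 * (2 * t - s) * (t - s)))) (-s ^ 2 - 2 * s * t + 4 * t ^ 2) (80 * t ^ 13) :=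
      ⟨1292 * s + 4181 * t,
        1292 * s ^ 11 - 8739 * s ^ 10 * t + 9870 * s ^ 9 * t ^ 2 + 63880 * s ^ 8 * t ^ 3 - 231120 * s ^ 7 * t ^ 4 + 272464 * s ^ 6 * t ^ 5 + 6032 * s ^ 5 * t ^ 6 - 364640 * s ^ 4 * t ^ 7 + 479520 * s ^ 3 * t ^ 8 - 337520 * s ^ 2 * t ^ 9 + 120272 * s * t ^ 10 - 16704 * t ^ 11, by simp only [tateC₄]; ring⟩
    exact ((((((h0.pow 5).mul (h1.pow 2)).mul (h2.pow 10)).mul (h3.pow 10)).mul (h4.pow 5)).mul (h5.pow 1)).congr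
      (by simp only [tateDisc]; ring) (by push_cast; ring)
  nonconstant := ⟨1, 2, by norm_num [tateC₄, tateC₆]⟩

/-- The family of curves with torsion subgroup containing `ℤ/12`. -/
def twelveForms : TateForms 4 where
  -- t/s = τ, with e = (3τ² - 3τ + 1)/(1 - τ)² and d = (2τ² - 2τ + 1)/(1 - τ).
  ρ s t := s * (t - s) ^ 3
  a₁ s t := s * (t - s) ^ 3 + (3 * t * s - 3 * t ^ 2 - s ^ 2) * t * (s - 2 * t)
  a₂ s t := (t - s) ^ 2 * (3 * t * s - 3 * t ^ 2 - s ^ 2) * t * (s - 2 * t) * (2 * t * s - 2 * t ^ 2 - s ^ 2)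
  map_ρ φ s t := by simp only [map_mul, map_sub, map_pow]
  map_a₁ φ s t := by simp only [map_mul, map_sub, map_add, map_pow, map_ofNat]
  map_a₂ φ s t := by simp only [map_mul, map_sub, map_pow, map_ofNat]
  homog_ρ c s t := by ring
  homog_a₁ c s t := by ring
  homog_a₂ c s t := by ring
  Cs := 1
  Ct := 144 ^ 2 * 16 ^ 6 * 9 ^ 4 * 16 ^ 3 * 144
  Cs_ne_zero := by norm_num
  Ct_ne_zero := by norm_num
  Ks := 610
  Kt := 465
  resultant_left s t := by
    have h0 : Meets (tateC₄ (s * (t - s) ^ 3) (s * (t - s) ^ 3 + (3 * t * s - 3 * t ^ 2 - s ^ 2) * t * (s - 2 * t)) ((t - s) ^ 2 * (3 * t * s - 3 * t ^ 2 - s ^ 2) * t * (s - 2 * t) * (2 * t * s - 2 * t ^ 2 - s ^ 2))) (s) (1 * s ^ 1) :=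
      ⟨0,
        1, by simp only [tateC₄]; ring⟩
    have h1 : Meets (tateC₄ (s * (t - s) ^ 3) (s * (t - s) ^ 3 + (3 * t * s - 3 * t ^ 2 - s ^ 2) * t * (s - 2 * t)) ((t - s) ^ 2 * (3 * t * s - 3 * t ^ 2 - s ^ 2) * t * (s - 2 * t) * (2 * t * s - 2 * t ^ 2 - s ^ 2))) (s - t) (1 * s ^ 16) :=
      ⟨1,
        24 * s ^ 14 * t - 240 * s ^ 13 * t ^ 2 + 1536 * s ^ 12 * t ^ 3 - 6672 * s ^ 11 * t ^ 4 + 21024 * s ^ 10 * t ^ 5 - 49632 * s ^ 9 * t ^ 6 + 89376 * s ^ 8 * t ^ 7 - 123504 * s ^ 7 * t ^ 8 + 130416 * s ^ 6 * t ^ 9 - 103584 * s ^ 5 * t ^ 10 + 60000 * s ^ 4 * t ^ 11 - 24048 * s ^ 3 * t ^ 12 + 6192 * s ^ 2 * t ^ 13 - 1008 * s * t ^ 14 + 144 * t ^ 15, by simp only [tateC₄]; ring⟩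
    have h2 : Meets (tateC₄ (s * (t - s) ^ 3) (s * (t - s) ^ 3 + (3 * t * s - 3 * t ^ 2 - s ^ 2) * t * (s - 2 * t)) ((t - s) ^ 2 * (3 * t * s - 3 * t ^ 2 - s ^ 2) * t * (s - 2 * t) * (2 * t * s - 2 * t ^ 2 - s ^ 2))) (t) (1 * s ^ 16) :=
      ⟨1,
        24 * s ^ 15 - 264 * s ^ 14 * t + 1776 * s ^ 13 * t ^ 2 - 8208 * s ^ 12 * t ^ 3 + 27696 * s ^ 11 * t ^ 4 - 70656 * s ^ 10 * t ^ 5 + 139008 * s ^ 9 * t ^ 6 - 212880 * s ^ 8 * t ^ 7 + 253920 * s ^ 7 * t ^ 8 - 234000 * s ^ 6 * t ^ 9 + 163584 * s ^ 5 * t ^ 10 - 84048 * s ^ 4 * t ^ 11 + 30240 * s ^ 3 * t ^ 12 - 7200 * s ^ 2 * t ^ 13 + 1152 * s * t ^ 14 - 144 * t ^ 15, by simp only [tateC₄]; ring⟩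
    have h3 : Meets (tateC₄ (s * (t - s) ^ 3) (s * (t - s) ^ 3 + (3 * t * s - 3 * t ^ 2 - s ^ 2) * t * (s - 2 * t)) ((t - s) ^ 2 * (3 * t * s - 3 * t ^ 2 - s ^ 2) * t * (s - 2 * t) * (2 * t * s - 2 * t ^ 2 - s ^ 2))) (-s + 2 * t) (1 * s ^ 16) :=
      ⟨4096,
        4095 * s ^ 15 - 90114 * s ^ 14 * t + 901116 * s ^ 13 * t ^ 2 - 5472264 * s ^ 12 * t ^ 3 + 22675440 * s ^ 11 * t ^ 4 - 68091936 * s ^ 10 * t ^ 5 + 153223104 * s ^ 9 * t ^ 6 - 262930560 * s ^ 8 * t ^ 7 + 346095360 * s ^ 7 * t ^ 8 - 347865600 * s ^ 6 * t ^ 9 + 262732800 * s ^ 5 * t ^ 10 - 144574464 * s ^ 4 * t ^ 11 + 55111680 * s ^ 3 * t ^ 12 - 13639680 * s ^ 2 * t ^ 13 + 2211840 * s * t ^ 14 - 294912 * t ^ 15, by simp only [tateC₄]; ring⟩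
    have h4 : Meets (tateC₄ (s * (t - s) ^ 3) (s * (t - s) ^ 3 + (3 * t * s - 3 * t ^ 2 - s ^ 2) * t * (s - 2 * t)) ((t - s) ^ 2 * (3 * t * s - 3 * t ^ 2 - s ^ 2) * t * (s - 2 * t) * (2 * t * s - 2 * t ^ 2 - s ^ 2))) (-s ^ 2 + 3 * s * t - 3 * t ^ 2) (1 * s ^ 16) :=
      ⟨729,
        728 * s ^ 14 - 15312 * s ^ 13 * t + 144336 * s ^ 12 * t ^ 2 - 815760 * s ^ 11 * t ^ 3 + 3103344 * s ^ 10 * t ^ 4 - 8433072 * s ^ 9 * t ^ 5 + 16898976 * s ^ 8 * t ^ 6 - 25340688 * s ^ 7 * t ^ 7 + 28470528 * s ^ 6 * t ^ 8 - 23674032 * s ^ 5 * t ^ 9 + 14152320 * s ^ 4 * t ^ 10 - 5773680 * s ^ 3 * t ^ 11 + 1492992 * s ^ 2 * t ^ 12 - 244944 * s * t ^ 13 + 34992 * t ^ 14, by simp only [tateC₄]; ring⟩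
    have h5 : Meets (tateC₄ (s * (t - s) ^ 3) (s * (t - s) ^ 3 + (3 * t * s - 3 * t ^ 2 - s ^ 2) * t * (s - 2 * t)) ((t - s) ^ 2 * (3 * t * s - 3 * t ^ 2 - s ^ 2) * t * (s - 2 * t) * (2 * t * s - 2 * t ^ 2 - s ^ 2))) (s ^ 2 - 2 * s * t + 2 * t ^ 2) (1 * s ^ 16) :=
      ⟨16,
        -15 * s ^ 14 + 354 * s ^ 13 * t - 3486 * s ^ 12 * t ^ 2 + 20736 * s ^ 11 * t ^ 3 - 82884 * s ^ 10 * t ^ 4 + 235896 * s ^ 9 * t ^ 5 - 492936 * s ^ 8 * t ^ 6 + 766464 * s ^ 7 * t ^ 7 - 887280 * s ^ 6 * t ^ 8 + 755232 * s ^ 5 * t ^ 9 - 458976 * s ^ 4 * t ^ 10 + 188928 * s ^ 3 * t ^ 11 - 48960 * s ^ 2 * t ^ 12 + 8064 * s * t ^ 13 - 1152 * t ^ 14, by simp only [tateC₄]; ring⟩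
    have h6 : Meets (tateC₄ (s * (t - s) ^ 3) (s * (t - s) ^ 3 + (3 * t * s - 3 * t ^ 2 - s ^ 2) * t * (s - 2 * t)) ((t - s) ^ 2 * (3 * t * s - 3 * t ^ 2 - s ^ 2) * t * (s - 2 * t) * (2 * t * s - 2 * t ^ 2 - s ^ 2))) (s ^ 2 - 6 * s * t + 6 * t ^ 2) (1 * s ^ 16) :=
      ⟨11664,
        -11663 * s ^ 14 + 209958 * s ^ 13 * t - 1749570 * s ^ 12 * t ^ 2 + 8958096 * s ^ 11 * t ^ 3 - 31492116 * s ^ 10 * t ^ 4 + 80344872 * s ^ 9 * t ^ 5 - 153109656 * s ^ 8 * t ^ 6 + 220662144 * s ^ 7 * t ^ 7 - 240401520 * s ^ 6 * t ^ 8 + 195340896 * s ^ 5 * t ^ 9 - 114921504 * s ^ 4 * t ^ 10 + 46469376 * s ^ 3 * t ^ 11 - 11990592 * s ^ 2 * t ^ 12 + 1959552 * s * t ^ 13 - 279936 * t ^ 14, by simp only [tateC₄]; ring⟩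
    exact (((((((h0.pow 2).mul (h1.pow 12)).mul (h2.pow 12)).mul (h3.pow 6)).mul (h4.pow 4)).mul (h5.pow 3)).mul (h6.pow 1)).congr
      (by simp only [tateDisc]; ring) (by push_cast; ring)
  resultant_right s t := by
    have h0 : Meets (tateC₄ (s * (t - s) ^ 3) (s * (t - s) ^ 3 + (3 * t * s - 3 * t ^ 2 - s ^ 2) * t * (s - 2 * t)) ((t - s) ^ 2 * (3 * t * s - 3 * t ^ 2 - s ^ 2) * t * (s - 2 * t) * (2 * t * s - 2 * t ^ 2 - s ^ 2))) (s) (144 * t ^ 16) :=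
      ⟨1,
        -s ^ 15 + 24 * s ^ 14 * t - 264 * s ^ 13 * t ^ 2 + 1776 * s ^ 12 * t ^ 3 - 8208 * s ^ 11 * t ^ 4 + 27696 * s ^ 10 * t ^ 5 - 70656 * s ^ 9 * t ^ 6 + 139008 * s ^ 8 * t ^ 7 - 212880 * s ^ 7 * t ^ 8 + 253920 * s ^ 6 * t ^ 9 - 234000 * s ^ 5 * t ^ 10 + 163584 * s ^ 4 * t ^ 11 - 84048 * s ^ 3 * t ^ 12 + 30240 * s ^ 2 * t ^ 13 - 7200 * s * t ^ 14 + 1152 * t ^ 15, by simp only [tateC₄]; ring⟩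
    have h1 : Meets (tateC₄ (s * (t - s) ^ 3) (s * (t - s) ^ 3 + (3 * t * s - 3 * t ^ 2 - s ^ 2) * t * (s - 2 * t)) ((t - s) ^ 2 * (3 * t * s - 3 * t ^ 2 - s ^ 2) * t * (s - 2 * t) * (2 * t * s - 2 * t ^ 2 - s ^ 2))) (s - t) (1 * t ^ 16) :=
      ⟨1,
        -s ^ 15 + 23 * s ^ 14 * t - 241 * s ^ 13 * t ^ 2 + 1535 * s ^ 12 * t ^ 3 - 6673 * s ^ 11 * t ^ 4 + 21023 * s ^ 10 * t ^ 5 - 49633 * s ^ 9 * t ^ 6 + 89375 * s ^ 8 * t ^ 7 - 123505 * s ^ 7 * t ^ 8 + 130415 * s ^ 6 * t ^ 9 - 103585 * s ^ 5 * t ^ 10 + 59999 * s ^ 4 * t ^ 11 - 24049 * s ^ 3 * t ^ 12 + 6191 * s ^ 2 * t ^ 13 - 1009 * s * t ^ 14 + 143 * t ^ 15, by simp only [tateC₄]; ring⟩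
    have h2 : Meets (tateC₄ (s * (t - s) ^ 3) (s * (t - s) ^ 3 + (3 * t * s - 3 * t ^ 2 - s ^ 2) * t * (s - 2 * t)) ((t - s) ^ 2 * (3 * t * s - 3 * t ^ 2 - s ^ 2) * t * (s - 2 * t) * (2 * t * s - 2 * t ^ 2 - s ^ 2))) (t) (1 * t ^ 1) :=
      ⟨0,
        1, by simp only [tateC₄]; ring⟩
    have h3 : Meets (tateC₄ (s * (t - s) ^ 3) (s * (t - s) ^ 3 + (3 * t * s - 3 * t ^ 2 - s ^ 2) * t * (s - 2 * t)) ((t - s) ^ 2 * (3 * t * s - 3 * t ^ 2 - s ^ 2) * t * (s - 2 * t) * (2 * t * s - 2 * t ^ 2 - s ^ 2))) (-s + 2 * t) (16 * t ^ 16) :=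
      ⟨1,
        s ^ 15 - 22 * s ^ 14 * t + 220 * s ^ 13 * t ^ 2 - 1336 * s ^ 12 * t ^ 3 + 5536 * s ^ 11 * t ^ 4 - 16624 * s ^ 10 * t ^ 5 + 37408 * s ^ 9 * t ^ 6 - 64192 * s ^ 8 * t ^ 7 + 84496 * s ^ 7 * t ^ 8 - 84928 * s ^ 6 * t ^ 9 + 64144 * s ^ 5 * t ^ 10 - 35296 * s ^ 4 * t ^ 11 + 13456 * s ^ 3 * t ^ 12 - 3328 * s ^ 2 * t ^ 13 + 544 * s * t ^ 14 - 64 * t ^ 15, by simp only [tateC₄]; ring⟩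
    have h4 : Meets (tateC₄ (s * (t - s) ^ 3) (s * (t - s) ^ 3 + (3 * t * s - 3 * t ^ 2 - s ^ 2) * t * (s - 2 * t)) ((t - s) ^ 2 * (3 * t * s - 3 * t ^ 2 - s ^ 2) * t * (s - 2 * t) * (2 * t * s - 2 * t ^ 2 - s ^ 2))) (-s ^ 2 + 3 * s * t - 3 * t ^ 2) (9 * t ^ 17) :=
      ⟨-s + t,
        -s ^ 15 + 22 * s ^ 14 * t - 219 * s ^ 13 * t ^ 2 + 1317 * s ^ 12 * t ^ 3 - 5376 * s ^ 11 * t ^ 4 + 15825 * s ^ 10 * t ^ 5 - 34749 * s ^ 9 * t ^ 6 + 57942 * s ^ 8 * t ^ 7 - 73815 * s ^ 7 * t ^ 8 + 71529 * s ^ 6 * t ^ 9 - 51888 * s ^ 5 * t ^ 10 + 27333 * s ^ 4 * t ^ 11 - 9969 * s ^ 3 * t ^ 12 + 2382 * s ^ 2 * t ^ 13 - 387 * s * t ^ 14 + 45 * t ^ 15, by simp only [tateC₄]; ring⟩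
    have h5 : Meets (tateC₄ (s * (t - s) ^ 3) (s * (t - s) ^ 3 + (3 * t * s - 3 * t ^ 2 - s ^ 2) * t * (s - 2 * t)) ((t - s) ^ 2 * (3 * t * s - 3 * t ^ 2 - s ^ 2) * t * (s - 2 * t) * (2 * t * s - 2 * t ^ 2 - s ^ 2))) (s ^ 2 - 2 * s * t + 2 * t ^ 2) (16 * t ^ 16) :=
      ⟨1,
        -s ^ 14 + 22 * s ^ 13 * t - 218 * s ^ 12 * t ^ 2 + 1296 * s ^ 11 * t ^ 3 - 5180 * s ^ 10 * t ^ 4 + 14744 * s ^ 9 * t ^ 5 - 30808 * s ^ 8 * t ^ 6 + 47904 * s ^ 7 * t ^ 7 - 55456 * s ^ 6 * t ^ 8 + 47200 * s ^ 5 * t ^ 9 - 28688 * s ^ 4 * t ^ 10 + 11808 * s ^ 3 * t ^ 11 - 3056 * s ^ 2 * t ^ 12 + 512 * s * t ^ 13 - 64 * t ^ 14, by simp only [tateC₄]; ring⟩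
    have h6 : Meets (tateC₄ (s * (t - s) ^ 3) (s * (t - s) ^ 3 + (3 * t * s - 3 * t ^ 2 - s ^ 2) * t * (s - 2 * t)) ((t - s) ^ 2 * (3 * t * s - 3 * t ^ 2 - s ^ 2) * t * (s - 2 * t) * (2 * t * s - 2 * t ^ 2 - s ^ 2))) (s ^ 2 - 6 * s * t + 6 * t ^ 2) (144 * t ^ 17) :=
      ⟨-10864 * s + 51409 * t,
        10864 * s ^ 15 - 246961 * s ^ 14 * t + 2554962 * s ^ 13 * t ^ 2 - 16054902 * s ^ 12 * t ^ 3 + 68814912 * s ^ 11 * t ^ 4 - 213635532 * s ^ 10 * t ^ 5 + 496727784 * s ^ 9 * t ^ 6 - 880357320 * s ^ 8 * t ^ 7 + 1196479968 * s ^ 7 * t ^ 8 - 1241511072 * s ^ 6 * t ^ 9 + 968003040 * s ^ 5 * t ^ 10 - 549797904 * s ^ 4 * t ^ 11 + 215981664 * s ^ 3 * t ^ 12 - 54673584 * s ^ 2 * t ^ 13 + 8897472 * s * t ^ 14 - 1233792 * t ^ 15, by simp only [tateC₄]; ring⟩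
    exact (((((((h0.pow 2).mul (h1.pow 12)).mul (h2.pow 12)).mul (h3.pow 6)).mul (h4.pow 4)).mul (h5.pow 3)).mul (h6.pow 1)).congr
      (by simp only [tateDisc]; ring) (by push_cast; ring)
  nonconstant := ⟨1, 2, by norm_num [tateC₄, tateC₆]⟩

/-- The family of curves with torsion subgroup containing `ℤ/2 × ℤ/4`. -/
def twoFourForms : TateForms 1 where
  -- c = 0, and t/s is the first coordinate of a second point of order two.
  ρ s t := s
  a₁ s t := s
  a₂ s t := -(t * (4 * t + s))
  map_ρ φ s t := rfl
  map_a₁ φ s t := rfl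
  map_a₂ φ s t := by simp only [map_mul, map_add, map_neg, map_ofNat]
  homog_ρ c s t := by ring
  homog_a₁ c s t := by ring
  homog_a₂ c s t := by ring
  Cs := 1
  Ct := 256 ^ 2 * 256 ^ 4 * 256 ^ 2
  Cs_ne_zero := by norm_num
  Ct_ne_zero := by norm_num
  Ks := 42
  Kt := 36
  resultant_left s t := by
    have h0 : Meets (tateC₄ (s) (s) (-(t * (4 * t + s)))) (s) (1 * s ^ 1) :=
      ⟨0,
        1, by simp only [tateC₄]; ring⟩
    have h1 : Meets (tateC₄ (s) (s) (-(t * (4 * t + s)))) (t) (1 * s ^ 4) :=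
      ⟨1,
        -16 * s ^ 3 - 80 * s ^ 2 * t - 128 * s * t ^ 2 - 256 * t ^ 3, by simp only [tateC₄]; ring⟩
    have h2 : Meets (tateC₄ (s) (s) (-(t * (4 * t + s)))) (s + 4 * t) (1 * s ^ 4) :=
      ⟨1,
        -16 * s ^ 2 * t - 16 * s * t ^ 2 - 64 * t ^ 3, by simp only [tateC₄]; ring⟩
    have h3 : Meets (tateC₄ (s) (s) (-(t * (4 * t + s)))) (s + 8 * t) (1 * s ^ 4) :=
      ⟨16,
        -15 * s ^ 3 - 136 * s ^ 2 * t - 192 * s * t ^ 2 - 512 * t ^ 3, by simp only [tateC₄]; ring⟩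
    exact ((((h0.pow 2).mul (h1.pow 4)).mul (h2.pow 4)).mul (h3.pow 2)).congr
      (by simp only [tateDisc]; ring) (by push_cast; ring)
  resultant_right s t := by
    have h0 : Meets (tateC₄ (s) (s) (-(t * (4 * t + s)))) (s) (256 * t ^ 4) :=
      ⟨1,
        -s ^ 3 - 16 * s ^ 2 * t - 80 * s * t ^ 2 - 128 * t ^ 3, by simp only [tateC₄]; ring⟩
    have h1 : Meets (tateC₄ (s) (s) (-(t * (4 * t + s)))) (t) (1 * t ^ 1) :=
      ⟨0,
        1, by simp only [tateC₄]; ring⟩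
    have h2 : Meets (tateC₄ (s) (s) (-(t * (4 * t + s)))) (s + 4 * t) (256 * t ^ 4) :=
      ⟨1,
        -s ^ 3 - 12 * s ^ 2 * t - 32 * s * t ^ 2, by simp only [tateC₄]; ring⟩
    have h3 : Meets (tateC₄ (s) (s) (-(t * (4 * t + s)))) (s + 8 * t) (256 * t ^ 4) :=
      ⟨1,
        -s ^ 3 - 8 * s ^ 2 * t - 16 * s * t ^ 2, by simp only [tateC₄]; ring⟩
    exact ((((h0.pow 2).mul (h1.pow 4)).mul (h2.pow 4)).mul (h3.pow 2)).congr
      (by simp only [tateDisc]; ring) (by push_cast; ring)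
  nonconstant := ⟨1, 2, by norm_num [tateC₄, tateC₆]⟩

/-- The family of curves with torsion subgroup containing `ℤ/2 × ℤ/6`. -/
def twoSixForms : TateForms 2 where
  -- t/s is x/(1 + c), where x is the first coordinate of a second point of order two.
  ρ s t := s * (3 * t + s)
  a₁ s t := s ^ 2 + 2 * s * t - 4 * t ^ 2
  a₂ s t := -(t * (4 * t + s) * (s + 2 * t) ^ 2)
  map_ρ φ s t := by simp only [map_mul, map_add, map_ofNat]
  map_a₁ φ s t := by simp only [map_mul, map_sub, map_add, map_pow, map_ofNat]
  map_a₂ φ s t := by simp only [map_mul, map_add, map_neg, map_pow, map_ofNat]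
  homog_ρ c s t := by ring
  homog_a₁ c s t := by ring
  homog_a₂ c s t := by ring
  Cs := 1
  Ct := 2304 ^ 2 * 9 ^ 2 * 256 ^ 6 * 256 ^ 6 * 2304 ^ 2
  Cs_ne_zero := by norm_num
  Ct_ne_zero := by norm_num
  Ks := 178
  Kt := 150
  resultant_left s t := by
    have h0 : Meets (tateC₄ (s * (3 * t + s)) (s ^ 2 + 2 * s * t - 4 * t ^ 2) (-(t * (4 * t + s) * (s + 2 * t) ^ 2))) (s) (1 * s ^ 1) :=
      ⟨0,
        1, by simp only [tateC₄]; ring⟩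
    have h1 : Meets (tateC₄ (s * (3 * t + s)) (s ^ 2 + 2 * s * t - 4 * t ^ 2) (-(t * (4 * t + s) * (s + 2 * t) ^ 2))) (s + 3 * t) (1 * s ^ 8) :=
      ⟨729,
        -728 * s ^ 7 - 15312 * s ^ 6 * t - 129024 * s ^ 5 * t ^ 2 - 557712 * s ^ 4 * t ^ 3 - 1301184 * s ^ 3 * t ^ 4 - 1555200 * s ^ 2 * t ^ 5 - 933120 * s * t ^ 6 - 559872 * t ^ 7, by simp only [tateC₄]; ring⟩
    have h2 : Meets (tateC₄ (s * (3 * t + s)) (s ^ 2 + 2 * s * t - 4 * t ^ 2) (-(t * (4 * t + s) * (s + 2 * t) ^ 2))) (t) (1 * s ^ 8) :=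
      ⟨1,
        -24 * s ^ 7 - 240 * s ^ 6 * t - 1296 * s ^ 5 * t ^ 2 - 4080 * s ^ 4 * t ^ 3 - 7488 * s ^ 3 * t ^ 4 - 7680 * s ^ 2 * t ^ 5 - 4608 * s * t ^ 6 - 2304 * t ^ 7, by simp only [tateC₄]; ring⟩
    have h3 : Meets (tateC₄ (s * (3 * t + s)) (s ^ 2 + 2 * s * t - 4 * t ^ 2) (-(t * (4 * t + s) * (s + 2 * t) ^ 2))) (s + 2 * t) (1 * s ^ 8) :=
      ⟨1,
        -24 * s ^ 6 * t - 192 * s ^ 5 * t ^ 2 - 912 * s ^ 4 * t ^ 3 - 2256 * s ^ 3 * t ^ 4 - 2976 * s ^ 2 * t ^ 5 - 1728 * s * t ^ 6 - 1152 * t ^ 7, by simp only [tateC₄]; ring⟩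
    have h4 : Meets (tateC₄ (s * (3 * t + s)) (s ^ 2 + 2 * s * t - 4 * t ^ 2) (-(t * (4 * t + s) * (s + 2 * t) ^ 2))) (s + 4 * t) (1 * s ^ 8) :=
      ⟨256,
        -255 * s ^ 7 - 5124 * s ^ 6 * t - 40944 * s ^ 5 * t ^ 2 - 168000 * s ^ 4 * t ^ 3 - 372480 * s ^ 3 * t ^ 4 - 427008 * s ^ 2 * t ^ 5 - 258048 * s * t ^ 6 - 147456 * t ^ 7, by simp only [tateC₄]; ring⟩
    have h5 : Meets (tateC₄ (s * (3 * t + s)) (s ^ 2 + 2 * s * t - 4 * t ^ 2) (-(t * (4 * t + s) * (s + 2 * t) ^ 2))) (s + 6 * t) (1 * s ^ 8) :=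
      ⟨729,
        -728 * s ^ 7 - 13128 * s ^ 6 * t - 96192 * s ^ 5 * t ^ 2 - 367632 * s ^ 4 * t ^ 3 - 768528 * s ^ 3 * t ^ 4 - 847584 * s ^ 2 * t ^ 5 - 513216 * s * t ^ 6 - 279936 * t ^ 7, by simp only [tateC₄]; ring⟩
    exact ((((((h0.pow 2).mul (h1.pow 2)).mul (h2.pow 6)).mul (h3.pow 6)).mul (h4.pow 6)).mul (h5.pow 2)).congr
      (by simp only [tateDisc]; ring) (by push_cast; ring)
  resultant_right s t := by
    have h0 : Meets (tateC₄ (s * (3 * t + s)) (s ^ 2 + 2 * s * t - 4 * t ^ 2) (-(t * (4 * t + s) * (s + 2 * t) ^ 2))) (s) (2304 * t ^ 8) :=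
      ⟨1,
        -s ^ 7 - 24 * s ^ 6 * t - 240 * s ^ 5 * t ^ 2 - 1296 * s ^ 4 * t ^ 3 - 4080 * s ^ 3 * t ^ 4 - 7488 * s ^ 2 * t ^ 5 - 7680 * s * t ^ 6 - 4608 * t ^ 7, by simp only [tateC₄]; ring⟩
    have h1 : Meets (tateC₄ (s * (3 * t + s)) (s ^ 2 + 2 * s * t - 4 * t ^ 2) (-(t * (4 * t + s) * (s + 2 * t) ^ 2))) (s + 3 * t) (9 * t ^ 8) :=
      ⟨1,
        -s ^ 7 - 21 * s ^ 6 * t - 177 * s ^ 5 * t ^ 2 - 765 * s ^ 4 * t ^ 3 - 1785 * s ^ 3 * t ^ 4 - 2133 * s ^ 2 * t ^ 5 - 1281 * s * t ^ 6 - 765 * t ^ 7, by simp only [tateC₄]; ring⟩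
    have h2 : Meets (tateC₄ (s * (3 * t + s)) (s ^ 2 + 2 * s * t - 4 * t ^ 2) (-(t * (4 * t + s) * (s + 2 * t) ^ 2))) (t) (1 * t ^ 1) :=
      ⟨0,
        1, by simp only [tateC₄]; ring⟩
    have h3 : Meets (tateC₄ (s * (3 * t + s)) (s ^ 2 + 2 * s * t - 4 * t ^ 2) (-(t * (4 * t + s) * (s + 2 * t) ^ 2))) (s + 2 * t) (256 * t ^ 8) :=
      ⟨1,
        -s ^ 7 - 22 * s ^ 6 * t - 196 * s ^ 5 * t ^ 2 - 904 * s ^ 4 * t ^ 3 - 2272 * s ^ 3 * t ^ 4 - 2944 * s ^ 2 * t ^ 5 - 1792 * s * t ^ 6 - 1024 * t ^ 7, by simp only [tateC₄]; ring⟩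
    have h4 : Meets (tateC₄ (s * (3 * t + s)) (s ^ 2 + 2 * s * t - 4 * t ^ 2) (-(t * (4 * t + s) * (s + 2 * t) ^ 2))) (s + 4 * t) (256 * t ^ 8) :=
      ⟨1,
        -s ^ 7 - 20 * s ^ 6 * t - 160 * s ^ 5 * t ^ 2 - 656 * s ^ 4 * t ^ 3 - 1456 * s ^ 3 * t ^ 4 - 1664 * s ^ 2 * t ^ 5 - 1024 * s * t ^ 6 - 512 * t ^ 7, by simp only [tateC₄]; ring⟩
    have h5 : Meets (tateC₄ (s * (3 * t + s)) (s ^ 2 + 2 * s * t - 4 * t ^ 2) (-(t * (4 * t + s) * (s + 2 * t) ^ 2))) (s + 6 * t) (2304 * t ^ 8) :=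
      ⟨1,
        -s ^ 7 - 18 * s ^ 6 * t - 132 * s ^ 5 * t ^ 2 - 504 * s ^ 4 * t ^ 3 - 1056 * s ^ 3 * t ^ 4 - 1152 * s ^ 2 * t ^ 5 - 768 * s * t ^ 6, by simp only [tateC₄]; ring⟩
    exact ((((((h0.pow 2).mul (h1.pow 2)).mul (h2.pow 6)).mul (h3.pow 6)).mul (h4.pow 6)).mul (h5.pow 2)).congr
      (by simp only [tateDisc]; ring) (by push_cast; ring)
  nonconstant := ⟨1, 2, by norm_num [tateC₄, tateC₆]⟩

/-- The family of curves with torsion subgroup containing `ℤ/2 × ℤ/8`. -/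
def twoEightForms : TateForms 4 where
  -- The ℤ/8 family at the parameter d = 2(4 + k)/(8 - k²), where k = t/s.
  ρ s t := (8 * s ^ 2 - t ^ 2) * (2 * s * (4 * s + t))
  a₁ s t := (8 * s ^ 2 - t ^ 2) * (2 * s * (4 * s + t)) - (2 * s * (4 * s + t) - (8 * s ^ 2 - t ^ 2)) * (2 * (2 * s * (4 * s + t)) - (8 * s ^ 2 - t ^ 2))
  a₂ s t := -((2 * s * (4 * s + t)) ^ 2 * (2 * s * (4 * s + t) - (8 * s ^ 2 - t ^ 2)) * (2 * (2 * s * (4 * s + t)) - (8 * s ^ 2 - t ^ 2)))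
  map_ρ φ s t := by simp only [map_mul, map_sub, map_add, map_pow, map_ofNat]
  map_a₁ φ s t := by simp only [map_mul, map_sub, map_add, map_pow, map_ofNat]
  map_a₂ φ s t := by simp only [map_mul, map_sub, map_add, map_neg, map_pow, map_ofNat]
  homog_ρ c s t := by ring
  homog_a₁ c s t := by ring
  homog_a₂ c s t := by ring
  Cs := 16777216 ^ 8 * 16777216 ^ 2 * 16777216 ^ 8 * 65536 ^ 8 * 16777216 ^ 4 * 16777216 ^ 2 * 256
  Ct := 256
  Cs_ne_zero := by norm_num
  Ct_ne_zero := by norm_num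
  Ks := 524
  Kt := 524
  resultant_left s t := by
    have h0 : Meets (tateC₄ ((8 * s ^ 2 - t ^ 2) * (2 * s * (4 * s + t))) ((8 * s ^ 2 - t ^ 2) * (2 * s * (4 * s + t)) - (2 * s * (4 * s + t) - (8 * s ^ 2 - t ^ 2)) * (2 * (2 * s * (4 * s + t)) - (8 * s ^ 2 - t ^ 2))) (-((2 * s * (4 * s + t)) ^ 2 * (2 * s * (4 * s + t) - (8 * s ^ 2 - t ^ 2)) * (2 * (2 * s * (4 * s + t)) - (8 * s ^ 2 - t ^ 2))))) (s) (1 * s ^ 1) :=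
      ⟨0,
        1, by simp only [tateC₄]; ring⟩
    have h1 : Meets (tateC₄ ((8 * s ^ 2 - t ^ 2) * (2 * s * (4 * s + t))) ((8 * s ^ 2 - t ^ 2) * (2 * s * (4 * s + t)) - (2 * s * (4 * s + t) - (8 * s ^ 2 - t ^ 2)) * (2 * (2 * s * (4 * s + t)) - (8 * s ^ 2 - t ^ 2))) (-((2 * s * (4 * s + t)) ^ 2 * (2 * s * (4 * s + t) - (8 * s ^ 2 - t ^ 2)) * (2 * (2 * s * (4 * s + t)) - (8 * s ^ 2 - t ^ 2))))) (4 * s + t) (16777216 * s ^ 16) :=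
      ⟨1,
        -16777216 * s ^ 14 * t - 25165824 * s ^ 13 * t ^ 2 - 23068672 * s ^ 12 * t ^ 3 - 12320768 * s ^ 11 * t ^ 4 - 3473408 * s ^ 10 * t ^ 5 + 49152 * s ^ 9 * t ^ 6 + 462848 * s ^ 8 * t ^ 7 + 180224 * s ^ 7 * t ^ 8 + 14336 * s ^ 6 * t ^ 9 - 16384 * s ^ 5 * t ^ 10 - 8704 * s ^ 4 * t ^ 11 - 2240 * s ^ 3 * t ^ 12 - 336 * s ^ 2 * t ^ 13 - 28 * s * t ^ 14 - t ^ 15, by simp only [tateC₄]; ring⟩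
    have h2 : Meets (tateC₄ ((8 * s ^ 2 - t ^ 2) * (2 * s * (4 * s + t))) ((8 * s ^ 2 - t ^ 2) * (2 * s * (4 * s + t)) - (2 * s * (4 * s + t) - (8 * s ^ 2 - t ^ 2)) * (2 * (2 * s * (4 * s + t)) - (8 * s ^ 2 - t ^ 2))) (-((2 * s * (4 * s + t)) ^ 2 * (2 * s * (4 * s + t) - (8 * s ^ 2 - t ^ 2)) * (2 * (2 * s * (4 * s + t)) - (8 * s ^ 2 - t ^ 2))))) (8 * s ^ 2 - t ^ 2) (16777216 * s ^ 17) :=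
      ⟨577 * s - 204 * t,
        -1207959552 * s ^ 15 - 4412407808 * s ^ 14 * t - 6910115840 * s ^ 13 * t ^ 2 - 6027214848 * s ^ 12 * t ^ 3 - 3087400960 * s ^ 11 * t ^ 4 - 799145984 * s ^ 10 * t ^ 5 + 46202880 * s ^ 9 * t ^ 6 + 120741888 * s ^ 8 * t ^ 7 + 42689024 * s ^ 7 * t ^ 8 + 2041856 * s ^ 6 * t ^ 9 - 4414656 * s ^ 5 * t ^ 10 - 2131968 * s ^ 4 * t ^ 11 - 520248 * s ^ 3 * t ^ 12 - 74560 * s ^ 2 * t ^ 13 - 5951 * s * t ^ 14 - 204 * t ^ 15, by simp only [tateC₄]; ring⟩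
    have h3 : Meets (tateC₄ ((8 * s ^ 2 - t ^ 2) * (2 * s * (4 * s + t))) ((8 * s ^ 2 - t ^ 2) * (2 * s * (4 * s + t)) - (2 * s * (4 * s + t) - (8 * s ^ 2 - t ^ 2)) * (2 * (2 * s * (4 * s + t)) - (8 * s ^ 2 - t ^ 2))) (-((2 * s * (4 * s + t)) ^ 2 * (2 * s * (4 * s + t) - (8 * s ^ 2 - t ^ 2)) * (2 * (2 * s * (4 * s + t)) - (8 * s ^ 2 - t ^ 2))))) (t) (16777216 * s ^ 16) :=
      ⟨1,
        -67108864 * s ^ 15 - 117440512 * s ^ 14 * t - 117440512 * s ^ 13 * t ^ 2 - 72351744 * s ^ 12 * t ^ 3 - 26214400 * s ^ 11 * t ^ 4 - 3276800 * s ^ 10 * t ^ 5 + 1900544 * s ^ 9 * t ^ 6 + 1183744 * s ^ 8 * t ^ 7 + 237568 * s ^ 7 * t ^ 8 - 51200 * s ^ 6 * t ^ 9 - 51200 * s ^ 5 * t ^ 10 - 17664 * s ^ 4 * t ^ 11 - 3584 * s ^ 3 * t ^ 12 - 448 * s ^ 2 * t ^ 13 - 32 * s * t ^ 14 - t ^ 15,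 by simp only [tateC₄]; ring⟩
    have h4 : Meets (tateC₄ ((8 * s ^ 2 - t ^ 2) * (2 * s * (4 * s + t))) ((8 * s ^ 2 - t ^ 2) * (2 * s * (4 * s + t)) - (2 * s * (4 * s + t) - (8 * s ^ 2 - t ^ 2)) * (2 * (2 * s * (4 * s + t)) - (8 * s ^ 2 - t ^ 2))) (-((2 * s * (4 * s + t)) ^ 2 * (2 * s * (4 * s + t) - (8 * s ^ 2 - t ^ 2)) * (2 * (2 * s * (4 * s + t)) - (8 * s ^ 2 - t ^ 2))))) (2 * s + t) (65536 * s ^ 16) :=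
      ⟨1,
        -8355840 * s ^ 15 - 29376512 * s ^ 14 * t - 44032000 * s ^ 13 * t ^ 2 - 36704256 * s ^ 12 * t ^ 3 - 17823744 * s ^ 11 * t ^ 4 - 4195328 * s ^ 10 * t ^ 5 + 459264 * s ^ 9 * t ^ 6 + 720640 * s ^ 8 * t ^ 7 + 231552 * s ^ 7 * t ^ 8 + 3008 * s ^ 6 * t ^ 9 - 27104 * s ^ 5 * t ^ 10 - 12048 * s ^ 4 * t ^ 11 - 2808 * s ^ 3 * t ^ 12 - 388 * s ^ 2 * t ^ 13 - 30 * s * t ^ 14 - t ^ 15, by simp only [tateC₄]; ring⟩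
    have h5 : Meets (tateC₄ ((8 * s ^ 2 - t ^ 2) * (2 * s * (4 * s + t))) ((8 * s ^ 2 - t ^ 2) * (2 * s * (4 * s + t)) - (2 * s * (4 * s + t) - (8 * s ^ 2 - t ^ 2)) * (2 * (2 * s * (4 * s + t)) - (8 * s ^ 2 - t ^ 2))) (-((2 * s * (4 * s + t)) ^ 2 * (2 * s * (4 * s + t) - (8 * s ^ 2 - t ^ 2)) * (2 * (2 * s * (4 * s + t)) - (8 * s ^ 2 - t ^ 2))))) (8 * s ^ 2 + 4 * s * t + t ^ 2) (16777216 * s ^ 16) :=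
      ⟨1,
        -8388608 * s ^ 13 * t - 10485760 * s ^ 12 * t ^ 2 - 8388608 * s ^ 11 * t ^ 3 - 3538944 * s ^ 10 * t ^ 4 - 458752 * s ^ 9 * t ^ 5 + 262144 * s ^ 8 * t ^ 6 + 163840 * s ^ 7 * t ^ 7 + 33280 * s ^ 6 * t ^ 8 - 7424 * s ^ 5 * t ^ 9 - 6848 * s ^ 4 * t ^ 10 - 2048 * s ^ 3 * t ^ 11 - 328 * s ^ 2 * t ^ 12 - 28 * s * t ^ 13 - t ^ 14, by simp only [tateC₄]; ring⟩
    have h6 : Meets (tateC₄ ((8 * s ^ 2 - t ^ 2) * (2 * s * (4 * s + t))) ((8 * s ^ 2 - t ^ 2) * (2 * s * (4 * s + t)) - (2 * s * (4 * s + t) - (8 * s ^ 2 - t ^ 2)) * (2 * (2 * s * (4 * s + t)) - (8 * s ^ 2 - t ^ 2))) (-((2 * s * (4 * s + t)) ^ 2 * (2 * s * (4 * s + t) - (8 * s ^ 2 - t ^ 2)) * (2 * (2 * s * (4 * s + t)) - (8 * s ^ 2 - t ^ 2))))) (8 * s ^ 2 + 8 * s * t + t ^ 2) (16777216 * s ^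 17) :=
      ⟨1393 * s + 204 * t,
        -2919235584 * s ^ 15 - 9193914368 * s ^ 14 * t - 12601786368 * s ^ 13 * t ^ 2 - 9693036544 * s ^ 12 * t ^ 3 - 4324720640 * s ^ 11 * t ^ 4 - 873201664 * s ^ 10 * t ^ 5 + 174751744 * s ^ 9 * t ^ 6 + 181772288 * s ^ 8 * t ^ 7 + 50967040 * s ^ 7 * t ^ 8 - 2136576 * s ^ 6 * t ^ 9 - 7091520 * s ^ 5 * t ^ 10 - 2862208 * s ^ 4 * t ^ 11 - 632696 * s ^ 3 * t ^ 12 - 84024 * s ^ 2 * t ^ 13 - 6289 * s * t ^ 14 - 204 * t ^ 15, by simp only [tateC₄]; ring⟩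
    have hc : Meets (tateC₄ ((8 * s ^ 2 - t ^ 2) * (2 * s * (4 * s + t))) ((8 * s ^ 2 - t ^ 2) * (2 * s * (4 * s + t)) - (2 * s * (4 * s + t) - (8 * s ^ 2 - t ^ 2)) * (2 * (2 * s * (4 * s + t)) - (8 * s ^ 2 - t ^ 2))) (-((2 * s * (4 * s + t)) ^ 2 * (2 * s * (4 * s + t) - (8 * s ^ 2 - t ^ 2)) * (2 * (2 * s * (4 * s + t)) - (8 * s ^ 2 - t ^ 2))))) (256) (256) := ⟨0, 1, by ring⟩
    exact ((((((((h0.pow 8).mul (h1.pow 8)).mul (h2.pow 2)).mul (h3.pow 8)).mul (h4.pow 8)).mul (h5.pow 4)).mul (h6.pow 2)).mul hc).congr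
      (by simp only [tateDisc]; ring) (by push_cast; ring)
  resultant_right s t := by
    have h0 : Meets (tateC₄ ((8 * s ^ 2 - t ^ 2) * (2 * s * (4 * s + t))) ((8 * s ^ 2 - t ^ 2) * (2 * s * (4 * s + t)) - (2 * s * (4 * s + t) - (8 * s ^ 2 - t ^ 2)) * (2 * (2 * s * (4 * s + t)) - (8 * s ^ 2 - t ^ 2))) (-((2 * s * (4 * s + t)) ^ 2 * (2 * s * (4 * s + t) - (8 * s ^ 2 - t ^ 2)) * (2 * (2 * s * (4 * s + t)) - (8 * s ^ 2 - t ^ 2))))) (s) (1 * t ^ 16) :=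
      ⟨1,
        -16777216 * s ^ 15 - 67108864 * s ^ 14 * t - 117440512 * s ^ 13 * t ^ 2 - 117440512 * s ^ 12 * t ^ 3 - 72351744 * s ^ 11 * t ^ 4 - 26214400 * s ^ 10 * t ^ 5 - 3276800 * s ^ 9 * t ^ 6 + 1900544 * s ^ 8 * t ^ 7 + 1183744 * s ^ 7 * t ^ 8 + 237568 * s ^ 6 * t ^ 9 - 51200 * s ^ 5 * t ^ 10 - 51200 * s ^ 4 * t ^ 11 - 17664 * s ^ 3 * t ^ 12 - 3584 * s ^ 2 * t ^ 13 - 448 * s * t ^ 14 - 32 * t ^ 15, by simp only [tateC₄]; ring⟩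
    have h1 : Meets (tateC₄ ((8 * s ^ 2 - t ^ 2) * (2 * s * (4 * s + t))) ((8 * s ^ 2 - t ^ 2) * (2 * s * (4 * s + t)) - (2 * s * (4 * s + t) - (8 * s ^ 2 - t ^ 2)) * (2 * (2 * s * (4 * s + t)) - (8 * s ^ 2 - t ^ 2))) (-((2 * s * (4 * s + t)) ^ 2 * (2 * s * (4 * s + t) - (8 * s ^ 2 - t ^ 2)) * (2 * (2 * s * (4 * s + t)) - (8 * s ^ 2 - t ^ 2))))) (4 * s + t) (1 * t ^ 16) :=
      ⟨256,
        -1073741824 * s ^ 15 - 4026531840 * s ^ 14 * t - 6509559808 * s ^ 13 * t ^ 2 - 5888802816 * s ^ 12 * t ^ 3 - 3158310912 * s ^ 11 * t ^ 4 - 888143872 * s ^ 10 * t ^ 5 + 12320768 * s ^ 9 * t ^ 6 + 118554624 * s ^ 8 * t ^ 7 + 46120960 * s ^ 7 * t ^ 8 + 3674112 * s ^ 6 * t ^ 9 - 4195328 * s ^ 5 * t ^ 10 - 2227968 * s ^ 4 * t ^ 11 - 573504 * s ^ 3 * t ^ 12 - 86000 * s ^ 2 * t ^ 13 - 7172 *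 s * t ^ 14 - 255 * t ^ 15, by simp only [tateC₄]; ring⟩
    have h2 : Meets (tateC₄ ((8 * s ^ 2 - t ^ 2) * (2 * s * (4 * s + t))) ((8 * s ^ 2 - t ^ 2) * (2 * s * (4 * s + t)) - (2 * s * (4 * s + t) - (8 * s ^ 2 - t ^ 2)) * (2 * (2 * s * (4 * s + t)) - (8 * s ^ 2 - t ^ 2))) (-((2 * s * (4 * s + t)) ^ 2 * (2 * s * (4 * s + t) - (8 * s ^ 2 - t ^ 2)) * (2 * (2 * s * (4 * s + t)) - (8 * s ^ 2 - t ^ 2))))) (8 * s ^ 2 - t ^ 2) (1 * t ^ 17) :=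
      ⟨-1632 * s + 577 * t,
        3422552064 * s ^ 15 + 12480151552 * s ^ 14 * t + 19545456640 * s ^ 13 * t ^ 2 + 17047486464 * s ^ 12 * t ^ 3 + 8732540928 * s ^ 11 * t ^ 4 + 2260303872 * s ^ 10 * t ^ 5 - 130678784 * s ^ 9 * t ^ 6 - 341512192 * s ^ 8 * t ^ 7 - 120741888 * s ^ 7 * t ^ 8 - 5775360 * s ^ 6 * t ^ 9 + 12486656 * s ^ 5 * t ^ 10 + 6030080 * s ^ 4 * t ^ 11 + 1471488 * s ^ 3 * t ^ 12 + 210880 * s ^ 2 * t ^ 13 + 16832 * s * t ^ 14 + 576 * t ^ 15, by simp only [tateC₄]; ring⟩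
    have h3 : Meets (tateC₄ ((8 * s ^ 2 - t ^ 2) * (2 * s * (4 * s + t))) ((8 * s ^ 2 - t ^ 2) * (2 * s * (4 * s + t)) - (2 * s * (4 * s + t) - (8 * s ^ 2 - t ^ 2)) * (2 * (2 * s * (4 * s + t)) - (8 * s ^ 2 - t ^ 2))) (-((2 * s * (4 * s + t)) ^ 2 * (2 * s * (4 * s + t) - (8 * s ^ 2 - t ^ 2)) * (2 * (2 * s * (4 * s + t)) - (8 * s ^ 2 - t ^ 2))))) (t) (1 * t ^ 1) :=
      ⟨0,
        1, by simp only [tateC₄]; ring⟩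
    have h4 : Meets (tateC₄ ((8 * s ^ 2 - t ^ 2) * (2 * s * (4 * s + t))) ((8 * s ^ 2 - t ^ 2) * (2 * s * (4 * s + t)) - (2 * s * (4 * s + t) - (8 * s ^ 2 - t ^ 2)) * (2 * (2 * s * (4 * s + t)) - (8 * s ^ 2 - t ^ 2))) (-((2 * s * (4 * s + t)) ^ 2 * (2 * s * (4 * s + t) - (8 * s ^ 2 - t ^ 2)) * (2 * (2 * s * (4 * s + t)) - (8 * s ^ 2 - t ^ 2))))) (2 * s + t) (1 * t ^ 16) :=
      ⟨1,
        -8388608 * s ^ 15 - 29360128 * s ^ 14 * t - 44040192 * s ^ 13 * t ^ 2 - 36700160 * s ^ 12 * t ^ 3 - 17825792 * s ^ 11 * t ^ 4 - 4194304 * s ^ 10 * t ^ 5 + 458752 * s ^ 9 * t ^ 6 + 720896 * s ^ 8 * t ^ 7 + 231424 * s ^ 7 * t ^ 8 + 3072 * s ^ 6 * t ^ 9 - 27136 * s ^ 5 * t ^ 10 - 12032 * s ^ 4 * t ^ 11 - 2816 * s ^ 3 * t ^ 12 - 384 * s ^ 2 * t ^ 13 - 32 * s * t ^ 14, by simp only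 [tateC₄]; ring⟩
    have h5 : Meets (tateC₄ ((8 * s ^ 2 - t ^ 2) * (2 * s * (4 * s + t))) ((8 * s ^ 2 - t ^ 2) * (2 * s * (4 * s + t)) - (2 * s * (4 * s + t) - (8 * s ^ 2 - t ^ 2)) * (2 * (2 * s * (4 * s + t)) - (8 * s ^ 2 - t ^ 2))) (-((2 * s * (4 * s + t)) ^ 2 * (2 * s * (4 * s + t) - (8 * s ^ 2 - t ^ 2)) * (2 * (2 * s * (4 * s + t)) - (8 * s ^ 2 - t ^ 2))))) (8 * s ^ 2 + 4 * s * t + t ^ 2) (1 * t ^ 16) :=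
      ⟨1,
        -2097152 * s ^ 14 - 7340032 * s ^ 13 * t - 10747904 * s ^ 12 * t ^ 2 - 8388608 * s ^ 11 * t ^ 3 - 3506176 * s ^ 10 * t ^ 4 - 475136 * s ^ 9 * t ^ 5 + 266240 * s ^ 8 * t ^ 6 + 163840 * s ^ 7 * t ^ 7 + 32768 * s ^ 6 * t ^ 8 - 7168 * s ^ 5 * t ^ 9 - 6912 * s ^ 4 * t ^ 10 - 2048 * s ^ 3 * t ^ 11 - 320 * s ^ 2 * t ^ 12 - 32 * s * t ^ 13, by simp only [tateC₄]; ring⟩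
    have h6 : Meets (tateC₄ ((8 * s ^ 2 - t ^ 2) * (2 * s * (4 * s + t))) ((8 * s ^ 2 - t ^ 2) * (2 * s * (4 * s + t)) - (2 * s * (4 * s + t) - (8 * s ^ 2 - t ^ 2)) * (2 * (2 * s * (4 * s + t)) - (8 * s ^ 2 - t ^ 2))) (-((2 * s * (4 * s + t)) ^ 2 * (2 * s * (4 * s + t) - (8 * s ^ 2 - t ^ 2)) * (2 * (2 * s * (4 * s + t)) - (8 * s ^ 2 - t ^ 2))))) (8 * s ^ 2 + 8 * s * t + t ^ 2) (1 * t ^ 17) :=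
      ⟨1632 * s + 1393 * t,
        -3422552064 * s ^ 15 - 13188988928 * s ^ 14 * t - 22026387456 * s ^ 13 * t ^ 2 - 20732182528 * s ^ 12 * t ^ 3 - 11723603968 * s ^ 11 * t ^ 4 - 3630858240 * s ^ 10 * t ^ 5 - 136740864 * s ^ 9 * t ^ 6 + 407736320 * s ^ 8 * t ^ 7 + 181772288 * s ^ 7 * t ^ 8 + 21843968 * s ^ 6 * t ^ 9 - 13643776 * s ^ 5 * t ^ 10 - 8446720 * s ^ 4 * t ^ 11 - 2366464 * s ^ 3 * t ^ 12 - 384576 * s ^ 2 * t ^ 13 - 35072 * s * t ^ 14 - 1392 * t ^ 15, by simp only [tateC₄]; ring⟩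
    have hc : Meets (tateC₄ ((8 * s ^ 2 - t ^ 2) * (2 * s * (4 * s + t))) ((8 * s ^ 2 - t ^ 2) * (2 * s * (4 * s + t)) - (2 * s * (4 * s + t) - (8 * s ^ 2 - t ^ 2)) * (2 * (2 * s * (4 * s + t)) - (8 * s ^ 2 - t ^ 2))) (-((2 * s * (4 * s + t)) ^ 2 * (2 * s * (4 * s + t) - (8 * s ^ 2 - t ^ 2)) * (2 * (2 * s * (4 * s + t)) - (8 * s ^ 2 - t ^ 2))))) (256) (256) := ⟨0, 1, by ring⟩
    exact ((((((((h0.pow 8).mul (h1.pow 8)).mul (h2.pow 2)).mul (h3.pow 8)).mul (h4.pow 8)).mul (h5.pow 4)).mul (h6.pow 2)).mul hc).congr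
      (by simp only [tateDisc]; ring) (by push_cast; ring)
  nonconstant := ⟨1, 2, by norm_num [tateC₄, tateC₆]⟩

/-- The family of curves with torsion subgroup containing `ℤ/4 × ℤ/4`. -/
def fourFourForms : TateForms 2 where
  -- c = 0 and 16b = κ⁴ - 1, where κ = t/s.
  ρ s t := 4 * s ^ 2
  a₁ s t := 4 * s ^ 2
  a₂ s t := s ^ 4 - t ^ 4
  map_ρ φ s t := by simp only [map_mul, map_pow, map_ofNat]
  map_a₁ φ s t := by simp only [map_mul, map_pow, map_ofNat]
  map_a₂ φ s t := by simp only [map_sub, map_pow]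
  homog_ρ c s t := by ring
  homog_a₁ c s t := by ring
  homog_a₂ c s t := by ring
  Cs := 256 ^ 4 * 256 ^ 4 * 256 ^ 4 * 16 ^ 4 * 256
  Ct := 16 ^ 4 * 256 ^ 4 * 256 ^ 4 * 256 ^ 4 * 256
  Cs_ne_zero := by norm_num
  Ct_ne_zero := by norm_num
  Ks := 132
  Kt := 132
  resultant_left s t := by
    have h0 : Meets (tateC₄ (4 * s ^ 2) (4 * s ^ 2) (s ^ 4 - t ^ 4)) (s) (1 * s ^ 1) :=
      ⟨0,
        1, by simp only [tateC₄]; ring⟩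
    have h1 : Meets (tateC₄ (4 * s ^ 2) (4 * s ^ 2) (s ^ 4 - t ^ 4)) (s - t) (256 * s ^ 8) :=
      ⟨1,
        240 * s ^ 7 + 240 * s ^ 6 * t + 240 * s ^ 5 * t ^ 2 + 240 * s ^ 4 * t ^ 3 + 16 * s ^ 3 * t ^ 4 + 16 * s ^ 2 * t ^ 5 + 16 * s * t ^ 6 + 16 * t ^ 7, by simp only [tateC₄]; ring⟩
    have h2 : Meets (tateC₄ (4 * s ^ 2) (4 * s ^ 2) (s ^ 4 - t ^ 4)) (s + t) (256 * s ^ 8) :=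
      ⟨1,
        240 * s ^ 7 - 240 * s ^ 6 * t + 240 * s ^ 5 * t ^ 2 - 240 * s ^ 4 * t ^ 3 + 16 * s ^ 3 * t ^ 4 - 16 * s ^ 2 * t ^ 5 + 16 * s * t ^ 6 - 16 * t ^ 7, by simp only [tateC₄]; ring⟩
    have h3 : Meets (tateC₄ (4 * s ^ 2) (4 * s ^ 2) (s ^ 4 - t ^ 4)) (s ^ 2 + t ^ 2) (256 * s ^ 8) :=
      ⟨1,
        240 * s ^ 6 - 240 * s ^ 4 * t ^ 2 + 16 * s ^ 2 * t ^ 4 - 16 * t ^ 6, by simp only [tateC₄]; ring⟩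
    have h4 : Meets (tateC₄ (4 * s ^ 2) (4 * s ^ 2) (s ^ 4 - t ^ 4)) (t) (16 * s ^ 8) :=
      ⟨1,
        -224 * s ^ 4 * t ^ 3 - 16 * t ^ 7, by simp only [tateC₄]; ring⟩
    have hc : Meets (tateC₄ (4 * s ^ 2) (4 * s ^ 2) (s ^ 4 - t ^ 4)) (256) (256) := ⟨0, 1, by ring⟩
    exact ((((((h0.pow 4).mul (h1.pow 4)).mul (h2.pow 4)).mul (h3.pow 4)).mul (h4.pow 4)).mul hc).congr
      (by simp only [tateDisc]; ring) (by push_cast; ring)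
  resultant_right s t := by
    have h0 : Meets (tateC₄ (4 * s ^ 2) (4 * s ^ 2) (s ^ 4 - t ^ 4)) (s) (16 * t ^ 8) :=
      ⟨1,
        -16 * s ^ 7 - 224 * s ^ 3 * t ^ 4, by simp only [tateC₄]; ring⟩
    have h1 : Meets (tateC₄ (4 * s ^ 2) (4 * s ^ 2) (s ^ 4 - t ^ 4)) (s - t) (256 * t ^ 8) :=
      ⟨1,
        -16 * s ^ 7 - 16 * s ^ 6 * t - 16 * s ^ 5 * t ^ 2 - 16 * s ^ 4 * t ^ 3 - 240 * s ^ 3 * t ^ 4 - 240 * s ^ 2 * t ^ 5 - 240 * s * t ^ 6 - 240 * t ^ 7, by simp only [tateC₄]; ring⟩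
    have h2 : Meets (tateC₄ (4 * s ^ 2) (4 * s ^ 2) (s ^ 4 - t ^ 4)) (s + t) (256 * t ^ 8) :=
      ⟨1,
        -16 * s ^ 7 + 16 * s ^ 6 * t - 16 * s ^ 5 * t ^ 2 + 16 * s ^ 4 * t ^ 3 - 240 * s ^ 3 * t ^ 4 + 240 * s ^ 2 * t ^ 5 - 240 * s * t ^ 6 + 240 * t ^ 7, by simp only [tateC₄]; ring⟩
    have h3 : Meets (tateC₄ (4 * s ^ 2) (4 * s ^ 2) (s ^ 4 - t ^ 4)) (s ^ 2 + t ^ 2) (256 * t ^ 8) :=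
      ⟨1,
        -16 * s ^ 6 + 16 * s ^ 4 * t ^ 2 - 240 * s ^ 2 * t ^ 4 + 240 * t ^ 6, by simp only [tateC₄]; ring⟩
    have h4 : Meets (tateC₄ (4 * s ^ 2) (4 * s ^ 2) (s ^ 4 - t ^ 4)) (t) (1 * t ^ 1) :=
      ⟨0,
        1, by simp only [tateC₄]; ring⟩
    have hc : Meets (tateC₄ (4 * s ^ 2) (4 * s ^ 2) (s ^ 4 - t ^ 4)) (256) (256) := ⟨0, 1, by ring⟩
    exact ((((((h0.pow 4).mul (h1.pow 4)).mul (h2.pow 4)).mul (h3.pow 4)).mul (h4.pow 4)).mul hc).congr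
      (by simp only [tateDisc]; ring) (by push_cast; ring)
  nonconstant := ⟨1, 2, by norm_num [tateC₄, tateC₆]⟩

end TateForms

/-! ### Tate curves with prescribed torsion belong to the families. -/

set_option linter.unusedSectionVars false

theorem addOrderOf_eq_of_prime_nsmul_ne_zero {A : Type*} [AddGroup A] {P : A} {n : ℕ} (hn : 0 < n)
    (h : n • P = 0) (hd : ∀ p ≤ n, p.Prime → p ∣ n → (n / p) • P ≠ 0) : addOrderOf P = n :=
  addOrderOf_eq_of_nsmul_and_div_prime_nsmul hn h fun p hp hpn =>
    hd p (Nat.le_of_dvd hn hpn) hp hpn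

theorem WeierstrassCurve.Affine.Point.exists_slope_of_two_nsmul_eq {F : Type*} [Field F]
    [DecidableEq F] {W : Affine F} {x y z w : F} {h : W.Nonsingular x y} {h' : W.Nonsingular z w}
    (h2 : 2 • Point.some x y h = .some z w h') :
    ∃ ℓ, ℓ * (2 * y + W.a₁ * x + W.a₃) = 3 * x ^ 2 + 2 * W.a₂ * x + W.a₄ - W.a₁ * y ∧
      z = ℓ ^ 2 + W.a₁ * ℓ - W.a₂ - x - x ∧ w = -(ℓ * (z - x) + y) - W.a₁ * z - W.a₃ := by
  have hne : y ≠ W.negY x y := by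
    intro h0
    rw [two_nsmul, Point.add_self_of_Y_eq h0] at h2
    exact Point.some_ne_zero _ h2.symm
  have e0 : y - W.negY x y = 2 * y + W.a₁ * x + W.a₃ := by simp only [negY]; ring
  have hd : 2 * y + W.a₁ * x + W.a₃ ≠ 0 := by rw [← e0]; exact sub_ne_zero.2 hne
  rw [two_nsmul, Point.add_self_of_Y_ne hne, Point.some.injEq] at h2
  obtain ⟨hz, hw⟩ := h2
  refine ⟨W.slope x x y y, ?_, hz.symm, ?_⟩
  · rw [slope_of_Y_ne rfl hne, e0, div_mul_cancel₀ _ hd]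
  · rw [← hw, ← hz]
    rfl

namespace tateCurve

variable {F : Type} [Field F] [DecidableEq F] [CharZero F] {b c : F}

-- The 2-division polynomial: 2y = b - (1 - c)x inserted into four times the equation. A multiple of
-- P of order two provides a known root, and a second point of order two is a root of the remaining
-- quadratic.
omit [CharZero F] in
theorem two_torsion_cubic {x y : F} (h : (tateCurve b c).Nonsingular x y)
    (h2 : 2 • Point.some x y h = 0) : (b - (1 - c) * x) ^ 2 + 4 * x ^ 2 * (x - b) = 0 := by
  have h1 := equation_iff.1 h.1
  rw [Point.two_nsmul_some_eq_zero_iff] at h2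
  simp only [tateCurve] at h2
  linear_combination -4 * h1 + (2 * y + (1 - c) * x - b) * h2

theorem exists_two_torsion (hΔ : (tateCurve b c).Δ ≠ 0) {x : F}
    (hx : (b - (1 - c) * x) ^ 2 + 4 * x ^ 2 * (x - b) = 0) :
    ∃ (y : F) (h : (tateCurve b c).Nonsingular x y), 2 • Point.some x y h = 0 := by
  refine ⟨(b - (1 - c) * x) / 2, nonsingular hΔ ?_, ?_⟩
  · linear_combination -(1 / 4) * hx
  · rw [Point.two_nsmul_some_eq_zero_iff]
    simp only [tateCurve]
    ring

variable (hΔ : (tateCurve b c).Δ ≠ 0)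
include hΔ

omit [DecidableEq F] [CharZero F] in
theorem exists_mul_eq (hc : c ≠ 0) :
    ∃ d, b = c * d ∧ d ≠ 0 := by
  refine ⟨b / c, by field_simp, div_ne_zero (b_ne_zero hΔ) hc⟩

-- 4P ≠ 0 excludes c = 0 and 5P ≠ 0 excludes d = 1, so both denominators in d = b/c and e = c/(d -
-- 1) are nonzero.
omit [CharZero F] in
theorem exists_mul_sub_one_eq (h4 : 4 • origin hΔ ≠ 0) (h5 : 5 • origin hΔ ≠ 0) :
    ∃ d e, b = c * d ∧ c = e * (d - 1) ∧ c ≠ 0 ∧ d ≠ 0 ∧ d - 1 ≠ 0 ∧ e ≠ 0 := by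
  have hc : c ≠ 0 := fun h => h4 ((four_nsmul_origin_eq_zero_iff hΔ).2 h)
  obtain ⟨d, hd, hd0⟩ := exists_mul_eq hΔ hc
  have hd1 : d - 1 ≠ 0 := fun h => h5 ((five_nsmul_origin_eq_zero_iff hΔ).2 (by
    rw [hd, sub_eq_zero.1 h, mul_one]))
  exact ⟨d, c / (d - 1), hd, by field_simp, hc, hd0, hd1, div_ne_zero hc hd1⟩

theorem exists_fiveForms (h5 : 5 • origin hΔ = 0) : ∃ τ : F, TateForms.fiveForms.ρ 1 τ ≠ 0 ∧
    TateForms.fiveForms.ρ 1 τ * (1 - c) = TateForms.fiveForms.a₁ 1 τ ∧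
    TateForms.fiveForms.ρ 1 τ ^ 2 * b = -TateForms.fiveForms.a₂ 1 τ := by
  rw [five_nsmul_origin_eq_zero_iff] at h5
  refine ⟨c, ?_, ?_, ?_⟩ <;> simp only [TateForms.fiveForms]
  · exact one_ne_zero
  · ring
  · rw [h5]; ring

theorem exists_sixForms (h6 : 6 • origin hΔ = 0) : ∃ τ : F, TateForms.sixForms.ρ 1 τ ≠ 0 ∧
    TateForms.sixForms.ρ 1 τ * (1 - c) = TateForms.sixForms.a₁ 1 τ ∧
    TateForms.sixForms.ρ 1 τ ^ 2 * b = -TateForms.sixForms.a₂ 1 τ := by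
  rw [six_nsmul_origin_eq_zero_iff] at h6
  refine ⟨c, ?_, ?_, ?_⟩ <;> simp only [TateForms.sixForms]
  · exact one_ne_zero
  · ring
  · rw [h6]; ring

theorem exists_sevenForms (h4 : 4 • origin hΔ ≠ 0) (h7 : 7 • origin hΔ = 0) :
    ∃ τ : F, TateForms.sevenForms.ρ 1 τ ≠ 0 ∧
    TateForms.sevenForms.ρ 1 τ * (1 - c) = TateForms.sevenForms.a₁ 1 τ ∧
    TateForms.sevenForms.ρ 1 τ ^ 2 * b = -TateForms.sevenForms.a₂ 1 τ := by
  have hc : c ≠ 0 := fun h => h4 ((four_nsmul_origin_eq_zero_iff hΔ).2 h)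
  obtain ⟨d, hd, hd0⟩ := exists_mul_eq hΔ hc
  rw [seven_nsmul_origin_eq_zero_iff hΔ hd] at h7
  refine ⟨d, ?_, ?_, ?_⟩ <;> simp only [TateForms.sevenForms]
  · simp
  · rw [h7]; ring
  · rw [hd, h7]; ring

omit [CharZero F] in
theorem exists_eight (h4 : 4 • origin hΔ ≠ 0) (h8 : 8 • origin hΔ = 0) :
    ∃ d : F, d ≠ 0 ∧ b = c * d ∧ d * c = (d - 1) * (2 * d - 1) := by
  have hc : c ≠ 0 := fun h => h4 ((four_nsmul_origin_eq_zero_iff hΔ).2 h)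
  obtain ⟨d, hd, hd0⟩ := exists_mul_eq hΔ hc
  exact ⟨d, hd0, hd, (eight_nsmul_origin_eq_zero_iff hΔ hd).1 h8⟩

theorem exists_eightForms (h4 : 4 • origin hΔ ≠ 0) (h8 : 8 • origin hΔ = 0) :
    ∃ τ : F, TateForms.eightForms.ρ 1 τ ≠ 0 ∧
    TateForms.eightForms.ρ 1 τ * (1 - c) = TateForms.eightForms.a₁ 1 τ ∧
    TateForms.eightForms.ρ 1 τ ^ 2 * b = -TateForms.eightForms.a₂ 1 τ := by
  obtain ⟨d, hd0, hd, h⟩ := exists_eight hΔ h4 h8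
  refine ⟨d, ?_, ?_, ?_⟩ <;> simp only [TateForms.eightForms]
  · simpa using hd0
  · linear_combination -h
  · rw [hd]; linear_combination d ^ 2 * h

theorem exists_nineForms (h4 : 4 • origin hΔ ≠ 0) (h5 : 5 • origin hΔ ≠ 0)
    (h9 : 9 • origin hΔ = 0) : ∃ τ : F, TateForms.nineForms.ρ 1 τ ≠ 0 ∧
    TateForms.nineForms.ρ 1 τ * (1 - c) = TateForms.nineForms.a₁ 1 τ ∧
    TateForms.nineForms.ρ 1 τ ^ 2 * b = -TateForms.nineForms.a₂ 1 τ := by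
  obtain ⟨d, e, hd, he, hc, hd0, hd1, he0⟩ := exists_mul_sub_one_eq hΔ h4 h5
  rw [nine_nsmul_origin_eq_zero_iff hΔ hd he] at h9
  refine ⟨e, ?_, ?_, ?_⟩ <;> simp only [TateForms.nineForms]
  · simp
  · rw [he, h9]; ring
  · rw [hd, he, h9]; ring

theorem exists_tenForms (h4 : 4 • origin hΔ ≠ 0) (h5 : 5 • origin hΔ ≠ 0)
    (h10 : 10 • origin hΔ = 0) : ∃ τ : F, TateForms.tenForms.ρ 1 τ ≠ 0 ∧
    TateForms.tenForms.ρ 1 τ * (1 - c) = TateForms.tenForms.a₁ 1 τ ∧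
    TateForms.tenForms.ρ 1 τ ^ 2 * b = -TateForms.tenForms.a₂ 1 τ := by
  obtain ⟨d, e, hd, he, hc, hd0, hd1, he0⟩ := exists_mul_sub_one_eq hΔ h4 h5
  rw [ten_nsmul_origin_eq_zero_iff hΔ hd he] at h10
  refine ⟨e, ?_, ?_, ?_⟩ <;> simp only [TateForms.tenForms]
  · intro h0
    apply pow_ne_zero 2 he0
    linear_combination -h10 + d * h0
  · rw [he]; linear_combination -e * h10
  · rw [hd, he]
    linear_combination (e * (d * (3 * e - e ^ 2 - 1) + e ^ 2 - (3 * e - e ^ 2 - 1))) * h10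

theorem exists_twelveForms (h4 : 4 • origin hΔ ≠ 0) (h5 : 5 • origin hΔ ≠ 0)
    (h6 : 6 • origin hΔ ≠ 0) (h12 : 12 • origin hΔ = 0) :
    ∃ τ : F, TateForms.twelveForms.ρ 1 τ ≠ 0 ∧
    TateForms.twelveForms.ρ 1 τ * (1 - c) = TateForms.twelveForms.a₁ 1 τ ∧
    TateForms.twelveForms.ρ 1 τ ^ 2 * b = -TateForms.twelveForms.a₂ 1 τ := by
  obtain ⟨d, e, hd, he, hc, hd0, hd1, he0⟩ := exists_mul_sub_one_eq hΔ h4 h5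
  have he1 : e ≠ 1 := fun h => h6 ((six_nsmul_origin_eq_zero_iff hΔ).2 (by
    rw [h, one_mul] at he
    rw [hd, he]; ring))
  have he1' : 1 - e ≠ 0 := sub_ne_zero.2 he1.symm
  -- 6P ≠ 0 rules out e = 1, the only obstruction to defining τ.
  set τ := (d - e) / (1 - e) with hτdef
  have hτ : d = e * (1 - τ) + τ := by rw [hτdef]; field_simp; ring
  clear_value τ
  rw [twelve_nsmul_origin_eq_zero_iff hΔ hd he he1 hτ] at h12
  have hτ1 : 1 - τ ≠ 0 := by
    intro h0
    apply hd1
    rw [hτ]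
    linear_combination (e - 1) * h0
  have h12' : (1 - τ) ^ 2 * (e - 1) = 2 * τ ^ 2 - τ := by linear_combination h12
  have hd' : (1 - τ) * d = 2 * τ ^ 2 - 2 * τ + 1 := by rw [hτ]; linear_combination h12
  have hd1' : (1 - τ) * (d - 1) = 2 * τ ^ 2 - τ := by linear_combination hd'
  have hc' : (1 - τ) ^ 3 * c = (3 * τ ^ 2 - 3 * τ + 1) * (2 * τ ^ 2 - τ) := by
    rw [← h12, ← hd1', he]; ring
  refine ⟨τ, ?_, ?_, ?_⟩ <;> simp only [TateForms.twelveForms]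
  · rw [one_mul]
    refine pow_ne_zero 3 fun h0 => hτ1 ?_
    linear_combination -h0
  · linear_combination hc'
  · rw [hd]
    linear_combination (1 - τ) ^ 3 * d * hc' +
      (1 - τ) ^ 2 * (3 * τ ^ 2 - 3 * τ + 1) * (2 * τ ^ 2 - τ) * hd'

/-- For c = 0 the cubic is (x - b)(4x² + x - b), and b is the first coordinate of 2P. -/
theorem exists_twoFourForms (h4 : 4 • origin hΔ = 0) {Q : (tateCurve b c).Point} (hQ : Q ≠ 0)
    (hQ2 : 2 • Q = 0) (hne : Q ≠ 2 • origin hΔ) :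
    c = 0 ∧ ∃ x y h, Q = .some x y h ∧ b = x * (4 * x + 1) := by
  have hc := (four_nsmul_origin_eq_zero_iff hΔ).1 h4
  refine ⟨hc, ?_⟩
  rcases Q with _ | ⟨x, y, h⟩
  · exact absurd rfl hQ
  refine ⟨x, y, h, rfl, ?_⟩
  obtain ⟨h', h2⟩ := two_nsmul_origin hΔ
  have hx : x ≠ b := Point.X_ne_of_two_nsmul_eq_zero two_ne_zero h h' (h2 ▸ hne) hQ2
    (by rw [← h2, ← mul_nsmul]; exact h4)
  have hcub := two_torsion_cubic h hQ2
  rw [hc] at hcub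
  apply mul_left_cancel₀ (sub_ne_zero.2 hx)
  linear_combination -hcub

/-- Removing the root c of 3P leaves a quadratic in x. With x = (1 + c)z it becomes linear in c,
namely (3z + 1)c = z(4z + 1), so z is the parameter. -/
theorem exists_twoSixForms (h6 : 6 • origin hΔ = 0) {Q : (tateCurve b c).Point} (hQ : Q ≠ 0)
    (hQ2 : 2 • Q = 0) (hne : Q ≠ 3 • origin hΔ) : ∃ τ : F, TateForms.twoSixForms.ρ 1 τ ≠ 0 ∧
    TateForms.twoSixForms.ρ 1 τ * (1 - c) = TateForms.twoSixForms.a₁ 1 τ ∧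
    TateForms.twoSixForms.ρ 1 τ ^ 2 * b = -TateForms.twoSixForms.a₂ 1 τ := by
  have hb := b_ne_zero hΔ
  have hbc := (six_nsmul_origin_eq_zero_iff hΔ).1 h6
  have hc1 : 1 + c ≠ 0 := fun h0 => hb (by rw [hbc]; linear_combination c * h0)
  rcases Q with _ | ⟨x, y, h⟩
  · exact absurd rfl hQ
  obtain ⟨h', h3⟩ := three_nsmul_origin hΔ
  have hx : x ≠ c := Point.X_ne_of_two_nsmul_eq_zero two_ne_zero h h' (h3 ▸ hne) hQ2
    (by rw [← h3, ← mul_nsmul]; exact h6)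
  have hcub := two_torsion_cubic h hQ2
  have hquad : 4 * x ^ 2 + (1 + c) * (1 - 3 * c) * x - c * (1 + c) ^ 2 = 0 := by
    apply mul_left_cancel₀ (sub_ne_zero.2 hx)
    rw [hbc] at hcub
    linear_combination hcub
  obtain ⟨z, hz⟩ : ∃ z, x = (1 + c) * z := ⟨x / (1 + c), by field_simp⟩
  have hcz : (3 * z + 1) * c = z * (4 * z + 1) := by
    apply mul_left_cancel₀ (pow_ne_zero 2 hc1)
    rw [hz] at hquad
    linear_combination -hquad
  refine ⟨z, ?_, ?_, ?_⟩ <;> simp only [TateForms.twoSixForms]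
  · intro h0
    rw [one_mul] at h0
    rw [h0, zero_mul] at hcz
    have : (1 : F) = 0 := by linear_combination -9 * hcz - (12 * z - 1) * h0
    exact one_ne_zero this
  · linear_combination -hcz
  · rw [hbc]
    linear_combination ((3 * z + 1) * (1 + c) + z * (4 * z + 1)) * hcz

/-- Removing the root d(d - 1) of 4P leaves a quadratic in x that must have a rational root. Its
discriminant is a square times 8d² - 8d + 1, which leads to the conic w² = 8d² - 8d + 1. -/
theorem exists_twoEightForms (h4 : 4 • origin hΔ ≠ 0) (h8 : 8 • origin hΔ = 0)
    {Q : (tateCurve b c).Point} (hQ : Q ≠ 0) (hQ2 : 2 • Q = 0) (hne : Q ≠ 4 • origin hΔ) :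
    ∃ τ : F, TateForms.twoEightForms.ρ 1 τ ≠ 0 ∧
    TateForms.twoEightForms.ρ 1 τ * (1 - c) = TateForms.twoEightForms.a₁ 1 τ ∧
    TateForms.twoEightForms.ρ 1 τ ^ 2 * b = -TateForms.twoEightForms.a₂ 1 τ := by
  have hb := b_ne_zero hΔ
  obtain ⟨d, hd0, hd, hdc⟩ := exists_eight hΔ h4 h8
  have hb' : b = (d - 1) * (2 * d - 1) := by rw [hd]; linear_combination hdc
  have hd2 : 2 * d - 1 ≠ 0 := fun h0 => hb (by rw [hb', h0, mul_zero])
  rcases Q with _ | ⟨x, y, h⟩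
  · exact absurd rfl hQ
  obtain ⟨h', h4'⟩ := four_nsmul_origin hΔ hd
  have hx : x ≠ d * (d - 1) := Point.X_ne_of_two_nsmul_eq_zero two_ne_zero h h' (h4' ▸ hne) hQ2
    (by rw [← h4', ← mul_nsmul]; exact h8)
  have hcub := two_torsion_cubic h hQ2
  have hquad : 4 * d ^ 2 * x ^ 2 + (-8 * d ^ 3 + 16 * d ^ 2 - 8 * d + 1) * x -
      d * (d - 1) * (2 * d - 1) ^ 2 = 0 := by
    apply mul_left_cancel₀ (sub_ne_zero.2 hx)
    have e : d ^ 2 * ((b - (1 - c) * x) ^ 2 + 4 * x ^ 2 * (x - b)) =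
        (d * b - (d - d * c) * x) ^ 2 + 4 * d ^ 2 * x ^ 2 * (x - b) := by ring
    rw [hcub, mul_zero, hdc, hb'] at e
    linear_combination -e
  -- k is the slope of the line w = 1 + kd through the rational point (0,1) of the conic.
  obtain ⟨k, hk⟩ : ∃ k, (2 * d - 1) ^ 2 * (1 + k * d) =
      8 * d ^ 2 * x - 8 * d ^ 3 + 16 * d ^ 2 - 8 * d + 1 :=
    ⟨((8 * d ^ 2 * x - 8 * d ^ 3 + 16 * d ^ 2 - 8 * d + 1) / (2 * d - 1) ^ 2 - 1) / d, by
      field_simp; ring⟩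
  have hk2 : (1 + k * d) ^ 2 = 8 * d ^ 2 - 8 * d + 1 := by
    apply mul_left_cancel₀ (pow_ne_zero 4 hd2)
    linear_combination ((2 * d - 1) ^ 2 * (1 + k * d) +
      (8 * d ^ 2 * x - 8 * d ^ 3 + 16 * d ^ 2 - 8 * d + 1)) * hk + 16 * d ^ 2 * hquad
  have hkd : (8 - k ^ 2) * d = 2 * (4 + k) := by
    apply mul_left_cancel₀ hd0
    linear_combination -hk2
  have h8k : 8 - k ^ 2 ≠ 0 := by
    intro h0
    rw [h0, zero_mul] at hkd
    have : (8 : F) = 0 := by linear_combination -h0 - (4 - k) * (1 / 2) * hkd * (-1) * (-1)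
    norm_num at this
  refine ⟨k, ?_, ?_, ?_⟩ <;> simp only [TateForms.twoEightForms] <;>
    simp only [one_pow, mul_one, ← hkd]
  · exact mul_ne_zero h8k (mul_ne_zero h8k hd0)
  · linear_combination -(8 - k ^ 2) ^ 2 * hdc
  · rw [hb']; ring

/-- Let T = 2R have first coordinate z. Halving T gives (x - z)² = -(8z + 1)z² for the first
coordinate x of R, so -(8z + 1) is a square κ². Then b = z(4z + 1) becomes (κ⁴ - 1)/16. -/
theorem exists_fourFourForms (h4 : 4 • origin hΔ = 0) {R : (tateCurve b c).Point}
    (hR2 : 2 • R ≠ 0) (hR4 : 4 • R = 0) (hne : 2 • R ≠ 2 • origin hΔ) :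
    ∃ τ : F, TateForms.fourFourForms.ρ 1 τ ≠ 0 ∧
    TateForms.fourFourForms.ρ 1 τ * (1 - c) = TateForms.fourFourForms.a₁ 1 τ ∧
    TateForms.fourFourForms.ρ 1 τ ^ 2 * b = -TateForms.fourFourForms.a₂ 1 τ := by
  have hb := b_ne_zero hΔ
  have hT2 : 2 • (2 • R) = 0 := by rw [← mul_nsmul]; exact hR4
  obtain ⟨hc, z, w, hT, hRT, hbz⟩ := exists_twoFourForms hΔ h4 hR2 hT2 hne
  have hz0 : z ≠ 0 := by rintro rfl; exact hb (by rw [hbz, zero_mul])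
  have hw : w = 2 * z ^ 2 := by
    rw [hRT, Point.two_nsmul_some_eq_zero_iff] at hT2
    simp only [tateCurve, hc, hbz] at hT2
    linear_combination (1 / 2) * hT2
  rcases R with _ | ⟨x, y, h⟩
  · exact absurd (smul_zero 2) hR2
  have key : (x - z) ^ 2 = -(8 * z + 1) * z ^ 2 := by
    obtain ⟨ℓ, hℓ, hsum, hline⟩ := Point.exists_slope_of_two_nsmul_eq hRT
    simp only [tateCurve, hc, hbz] at hℓ hsum hline
    have hy : y = 2 * z ^ 2 + ℓ * (x - z) := by linear_combination hline - hw
    rw [hy] at hℓ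
    linear_combination hℓ - 2 * (z - x) * hsum
  obtain ⟨κ, hκ⟩ : ∃ κ, x - z = κ * z := ⟨(x - z) / z, by field_simp⟩
  have hκ2 : κ ^ 2 = -(8 * z + 1) := by
    apply mul_left_cancel₀ (pow_ne_zero 2 hz0)
    rw [hκ] at key
    linear_combination key
  refine ⟨κ, ?_, ?_, ?_⟩ <;> simp only [TateForms.fourFourForms]
  · norm_num
  · rw [hc]; ring
  · rw [hbz]
    linear_combination -(κ ^ 2 - (8 * z + 1)) * hκ2

end tateCurve

/-! ### Conversely, the members of the families have the torsion. -/

namespace tateCurve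

variable {F : Type} [Field F] [DecidableEq F] [CharZero F] {b c : F}
  (hΔ : (tateCurve b c).Δ ≠ 0) {s t : F}
include hΔ

theorem addOrderOf_origin_eq_six (h : b = c + c ^ 2) : addOrderOf (origin hΔ) = 6 := by
  refine addOrderOf_eq_of_prime_nsmul_ne_zero (by norm_num)
    ((six_nsmul_origin_eq_zero_iff hΔ).2 h) fun p hp hpp hpn => ?_
  interval_cases p <;> first | (exfalso; revert hpp; norm_num; done) | (exfalso; omega) | skip
  · exact three_nsmul_origin_ne_zero hΔ
  · exact two_nsmul_origin_ne_zero hΔ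

theorem addOrderOf_origin_eq_four (h : c = 0) : addOrderOf (origin hΔ) = 4 := by
  refine addOrderOf_eq_of_prime_nsmul_ne_zero (by norm_num)
    ((four_nsmul_origin_eq_zero_iff hΔ).2 h) fun p hp hpp hpn => ?_
  interval_cases p <;> first | (exfalso; revert hpp; norm_num; done) | (exfalso; omega) | skip
  exact two_nsmul_origin_ne_zero hΔ

theorem addOrderOf_origin_eq_eight {d : F} (hd : b = c * d)
    (h : d * c = (d - 1) * (2 * d - 1)) : addOrderOf (origin hΔ) = 8 := by
  refine addOrderOf_eq_of_prime_nsmul_ne_zero (by norm_num)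
    ((eight_nsmul_origin_eq_zero_iff hΔ hd).2 h) fun p hp hpp hpn => ?_
  interval_cases p <;> first | (exfalso; revert hpp; norm_num; done) | (exfalso; omega) | skip
  obtain ⟨h', h4⟩ := four_nsmul_origin hΔ hd
  change 4 • origin hΔ ≠ 0
  rw [h4]
  exact Point.some_ne_zero _

theorem fiveForms_embeds (hs : s ≠ 0) (h₁ : TateForms.fiveForms.ρ s t * (1 - c) = TateForms.fiveForms.a₁ s t)
    (h₂ : TateForms.fiveForms.ρ s t ^ 2 * b = -TateForms.fiveForms.a₂ s t) :
    ∃ φ : ZMod 5 →+ (tateCurve b c).Point, Function.Injective φ := by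
  simp only [TateForms.fiveForms] at h₁ h₂
  have : Fact (Nat.Prime 5) := ⟨by norm_num⟩
  have hbc : b = c := by
    apply mul_left_cancel₀ (pow_ne_zero 2 hs)
    linear_combination h₂ + s * h₁
  obtain ⟨φ, hφ, -⟩ := exists_zmod_hom_injective
    (addOrderOf_eq_prime ((five_nsmul_origin_eq_zero_iff hΔ).2 hbc) (origin_ne_zero hΔ))
  exact ⟨φ, hφ⟩

theorem sixForms_embeds (hs : s ≠ 0) (h₁ : TateForms.sixForms.ρ s t * (1 - c) = TateForms.sixForms.a₁ s t)
    (h₂ : TateForms.sixForms.ρ s t ^ 2 * b = -TateForms.sixForms.a₂ s t) :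
    ∃ φ : ZMod 6 →+ (tateCurve b c).Point, Function.Injective φ := by
  simp only [TateForms.sixForms] at h₁ h₂
  have hbc : b = c + c ^ 2 := by
    apply mul_left_cancel₀ (pow_ne_zero 2 hs)
    linear_combination h₂ + (s + s * c + t) * h₁
  obtain ⟨φ, hφ, -⟩ := exists_zmod_hom_injective (addOrderOf_origin_eq_six hΔ hbc)
  exact ⟨φ, hφ⟩

theorem sevenForms_embeds (hs : s ≠ 0)
    (h₁ : TateForms.sevenForms.ρ s t * (1 - c) = TateForms.sevenForms.a₁ s t)
    (h₂ : TateForms.sevenForms.ρ s t ^ 2 * b = -TateForms.sevenForms.a₂ s t) :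
    ∃ φ : ZMod 7 →+ (tateCurve b c).Point, Function.Injective φ := by
  simp only [TateForms.sevenForms] at h₁ h₂
  have : Fact (Nat.Prime 7) := ⟨by norm_num⟩
  have hc : c = t * (t - s) / s ^ 2 := by field_simp; linear_combination -h₁
  have hd : b = c * (t / s) := by
    rw [hc]; field_simp
    apply mul_left_cancel₀ hs
    linear_combination h₂
  obtain ⟨φ, hφ, -⟩ := exists_zmod_hom_injective (addOrderOf_eq_prime
    ((seven_nsmul_origin_eq_zero_iff hΔ hd).2 (by rw [hc]; field_simp)) (origin_ne_zero hΔ))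
  exact ⟨φ, hφ⟩

theorem eightForms_embeds (hs : s ≠ 0) (ht : t ≠ 0)
    (h₁ : TateForms.eightForms.ρ s t * (1 - c) = TateForms.eightForms.a₁ s t)
    (h₂ : TateForms.eightForms.ρ s t ^ 2 * b = -TateForms.eightForms.a₂ s t) :
    ∃ φ : ZMod 8 →+ (tateCurve b c).Point, Function.Injective φ := by
  simp only [TateForms.eightForms] at h₁ h₂
  have hc : c = (t - s) * (2 * t - s) / (s * t) := by field_simp; linear_combination -h₁
  have hb : b = (t - s) * (2 * t - s) / s ^ 2 := by
    field_simp
    apply mul_left_cancel₀ (pow_ne_zero 2 ht)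
    linear_combination h₂
  obtain ⟨φ, hφ, -⟩ := exists_zmod_hom_injective (addOrderOf_origin_eq_eight hΔ (d := t / s)
    (by rw [hc, hb]; field_simp) (by rw [hc]; field_simp))
  exact ⟨φ, hφ⟩

theorem nineForms_embeds (hs : s ≠ 0)
    (h₁ : TateForms.nineForms.ρ s t * (1 - c) = TateForms.nineForms.a₁ s t)
    (h₂ : TateForms.nineForms.ρ s t ^ 2 * b = -TateForms.nineForms.a₂ s t) :
    ∃ φ : ZMod 9 →+ (tateCurve b c).Point, Function.Injective φ := by
  simp only [TateForms.nineForms] at h₁ h₂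
  have hc : c = t ^ 2 * (t - s) / s ^ 3 := by field_simp; linear_combination -h₁
  have hb : b = t ^ 2 * (t - s) * (t ^ 2 - t * s + s ^ 2) / s ^ 5 := by
    field_simp
    apply mul_left_cancel₀ hs
    linear_combination h₂
  have hd : b = c * ((t ^ 2 - t * s + s ^ 2) / s ^ 2) := by rw [hb, hc]; field_simp
  have he : c = t / s * ((t ^ 2 - t * s + s ^ 2) / s ^ 2 - 1) := by rw [hc]; field_simp; ring
  obtain ⟨φ, hφ, -⟩ := exists_zmod_hom_injective
    (addOrderOf_eq_of_prime_nsmul_ne_zero (P := origin hΔ) (n := 9) (by norm_num)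
      ((nine_nsmul_origin_eq_zero_iff hΔ hd he).2 (by field_simp)) fun p hp hpp hpn => by
        interval_cases p <;>
          first | (exfalso; revert hpp; norm_num; done) | (exfalso; omega) | skip
        exact three_nsmul_origin_ne_zero hΔ)
  exact ⟨φ, hφ⟩

theorem tenForms_embeds (hρ : TateForms.tenForms.ρ s t ≠ 0)
    (h₁ : TateForms.tenForms.ρ s t * (1 - c) = TateForms.tenForms.a₁ s t)
    (h₂ : TateForms.tenForms.ρ s t ^ 2 * b = -TateForms.tenForms.a₂ s t) :
    ∃ φ : ZMod 10 →+ (tateCurve b c).Point, Function.Injective φ := by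
  simp only [TateForms.tenForms] at hρ h₁ h₂
  obtain ⟨hs, hq⟩ := mul_ne_zero_iff.1 hρ
  set q := 3 * t * s - t ^ 2 - s ^ 2 with hqdef
  have hc : c = t * (2 * t - s) * (t - s) / (s * q) := by
    field_simp; linear_combination -h₁
  have hb : b = t ^ 3 * (2 * t - s) * (t - s) / (s * q ^ 2) := by
    field_simp
    apply mul_left_cancel₀ hs
    linear_combination h₂
  have hd : b = c * (t ^ 2 / q) := by rw [hb, hc]; field_simp
  have he : c = t / s * (t ^ 2 / q - 1) := by rw [hc]; field_simp; rw [hqdef]; ring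
  obtain ⟨φ, hφ, -⟩ := exists_zmod_hom_injective
    (addOrderOf_eq_of_prime_nsmul_ne_zero (P := origin hΔ) (n := 10) (by norm_num)
      ((ten_nsmul_origin_eq_zero_iff hΔ hd he).2 (by field_simp; rw [hqdef]; ring))
      fun p hp hpp hpn => by
        interval_cases p <;>
          first | (exfalso; revert hpp; norm_num; done) | (exfalso; omega) | skip
        · obtain ⟨h', h5⟩ := five_nsmul_origin hΔ hd he
          change 5 • origin hΔ ≠ 0
          rw [h5]
          exact Point.some_ne_zero _
        · exact two_nsmul_origin_ne_zero hΔ)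
  exact ⟨φ, hφ⟩

theorem twelveForms_embeds (hρ : TateForms.twelveForms.ρ s t ≠ 0)
    (h₁ : TateForms.twelveForms.ρ s t * (1 - c) = TateForms.twelveForms.a₁ s t)
    (h₂ : TateForms.twelveForms.ρ s t ^ 2 * b = -TateForms.twelveForms.a₂ s t) :
    ∃ φ : ZMod 12 →+ (tateCurve b c).Point, Function.Injective φ := by
  simp only [TateForms.twelveForms] at hρ h₁ h₂
  obtain ⟨hs, hv3⟩ := mul_ne_zero_iff.1 hρ
  have hv : t - s ≠ 0 := fun h => hv3 (by rw [h]; ring)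
  have hb0 := b_ne_zero hΔ
  set v := t - s with hvdef
  set h := 3 * t * s - 3 * t ^ 2 - s ^ 2 with hh
  have hc : c = -h * t * (s - 2 * t) / (s * v ^ 3) := by
    field_simp; linear_combination -h₁
  have hb : b = -h * t * (s - 2 * t) * (2 * t * s - 2 * t ^ 2 - s ^ 2) / (s ^ 2 * v ^ 4) := by
    field_simp
    apply mul_left_cancel₀ (pow_ne_zero 2 hv)
    linear_combination h₂
  have hd : b = c * ((2 * t * s - 2 * t ^ 2 - s ^ 2) / (s * v)) := by rw [hb, hc]; field_simp
  have he : c = -h / v ^ 2 * ((2 * t * s - 2 * t ^ 2 - s ^ 2) / (s * v) - 1) := by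
    rw [hc]; field_simp; rw [hvdef]; ring
  have he1 : -h / v ^ 2 ≠ 1 := by
    intro h0
    rw [div_eq_one_iff_eq (pow_ne_zero 2 hv)] at h0
    have h1 : t * (s - 2 * t) = 0 := by
      rw [hh, hvdef] at h0
      linear_combination -h0
    apply hb0
    rw [hd, hc, mul_assoc (-h), h1]
    ring
  have hτ : (2 * t * s - 2 * t ^ 2 - s ^ 2) / (s * v) = -h / v ^ 2 * (1 - t / s) + t / s := by
    field_simp; rw [hh, hvdef]; ring
  obtain ⟨φ, hφ, -⟩ := exists_zmod_hom_injective
    (addOrderOf_eq_of_prime_nsmul_ne_zero (P := origin hΔ) (n := 12) (by norm_num)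
      ((twelve_nsmul_origin_eq_zero_iff hΔ hd he he1 hτ).2
        (by field_simp; rw [hh, hvdef]; ring))
      fun p hp hpp hpn => by
        interval_cases p <;>
          first | (exfalso; revert hpp; norm_num; done) | (exfalso; omega) | skip
        · obtain ⟨h', h6⟩ := six_nsmul_origin hΔ hd he he1 hτ
          change 6 • origin hΔ ≠ 0
          rw [h6]
          exact Point.some_ne_zero _
        · obtain ⟨h', h4⟩ := four_nsmul_origin hΔ hd
          change 4 • origin hΔ ≠ 0
          rw [h4]
          exact Point.some_ne_zero _)
  exact ⟨φ, hφ⟩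

theorem twoFourForms_embeds (hs : s ≠ 0) (ht : t ≠ 0)
    (h₁ : TateForms.twoFourForms.ρ s t * (1 - c) = TateForms.twoFourForms.a₁ s t)
    (h₂ : TateForms.twoFourForms.ρ s t ^ 2 * b = -TateForms.twoFourForms.a₂ s t) :
    ∃ φ : ZMod 2 × ZMod 4 →+ (tateCurve b c).Point, Function.Injective φ := by
  simp only [TateForms.twoFourForms] at h₁ h₂
  have hc : c = 0 := by
    apply mul_left_cancel₀ hs
    linear_combination -h₁
  have hb : b = t / s * (4 * (t / s) + 1) := by field_simp; linear_combination h₂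
  have hz : t / s ≠ 0 := div_ne_zero ht hs
  set z := t / s
  obtain ⟨y, h, hQ⟩ := exists_two_torsion hΔ (x := z) (by rw [hc, hb]; ring)
  refine exists_zmod_two_prod_hom_injective (k := 2) (addOrderOf_origin_eq_four hΔ hc)
    (Point.some_ne_zero h) hQ ?_ (by decide)
  -- The new point equals 2P only if z(4z + 1) = z, that is z = 0, which t ≠ 0 excludes.
  obtain ⟨h', h2⟩ := two_nsmul_origin hΔ
  rw [h2]
  intro h0
  have hx := (Point.some.inj h0).1
  rw [hb] at hx
  apply pow_ne_zero 2 hz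
  linear_combination -(1 / 4) * hx

theorem twoSixForms_embeds (ht : t ≠ 0) (hρ : TateForms.twoSixForms.ρ s t ≠ 0)
    (h₁ : TateForms.twoSixForms.ρ s t * (1 - c) = TateForms.twoSixForms.a₁ s t)
    (h₂ : TateForms.twoSixForms.ρ s t ^ 2 * b = -TateForms.twoSixForms.a₂ s t) :
    ∃ φ : ZMod 2 × ZMod 6 →+ (tateCurve b c).Point, Function.Injective φ := by
  simp only [TateForms.twoSixForms] at hρ h₁ h₂
  obtain ⟨hs, hr⟩ := mul_ne_zero_iff.1 hρ
  obtain ⟨z, rfl⟩ : ∃ z, t = z * s := ⟨t / s, by field_simp⟩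
  have hz : z ≠ 0 := left_ne_zero_of_mul ht
  have hz1 : 3 * z + 1 ≠ 0 := fun h => hr (by linear_combination s * h)
  have hc : (3 * z + 1) * c = z * (4 * z + 1) := by
    apply mul_left_cancel₀ (pow_ne_zero 2 hs)
    linear_combination -h₁
  have hb : b = c + c ^ 2 := by
    have hb' : (3 * z + 1) ^ 2 * b = z * (4 * z + 1) * (1 + 2 * z) ^ 2 := by
      apply mul_left_cancel₀ (pow_ne_zero 4 hs)
      linear_combination h₂
    apply mul_left_cancel₀ (pow_ne_zero 2 hz1)
    linear_combination hb' - (3 * z + 1 + (3 * z + 1) * c + z * (4 * z + 1)) * hc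
  obtain ⟨y, h, hQ⟩ := exists_two_torsion hΔ (x := (1 + c) * z) (by
    rw [hb]
    linear_combination (1 + c) ^ 2 * ((1 - z) * c - z) * hc)
  refine exists_zmod_two_prod_hom_injective (k := 3) (addOrderOf_origin_eq_six hΔ hb)
    (Point.some_ne_zero h) hQ ?_ (by decide)
  obtain ⟨h', h3⟩ := three_nsmul_origin hΔ
  rw [h3]
  intro h0
  have hx := (Point.some.inj h0).1
  apply pow_ne_zero 3 hz
  linear_combination (1 / 4) * ((3 * z + 1) * hx - (z - 1) * hc)

theorem twoEightForms_embeds (hρ : TateForms.twoEightForms.ρ s t ≠ 0)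
    (h₁ : TateForms.twoEightForms.ρ s t * (1 - c) = TateForms.twoEightForms.a₁ s t)
    (h₂ : TateForms.twoEightForms.ρ s t ^ 2 * b = -TateForms.twoEightForms.a₂ s t) :
    ∃ φ : ZMod 2 × ZMod 8 →+ (tateCurve b c).Point, Function.Injective φ := by
  simp only [TateForms.twoEightForms] at hρ h₁ h₂
  have hb0 := b_ne_zero hΔ
  obtain ⟨hS, hT⟩ := mul_ne_zero_iff.1 hρ
  have hs : s ≠ 0 := fun h => hT (by rw [h]; ring)
  obtain ⟨d, hd⟩ : ∃ d, 2 * s * (4 * s + t) = (8 * s ^ 2 - t ^ 2) * d :=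
    ⟨2 * s * (4 * s + t) / (8 * s ^ 2 - t ^ 2), by rw [mul_div_assoc', mul_div_cancel_left₀ _ hS]⟩
  -- The point of the conic w² = 8d² - 8d + 1 on the line of slope t/s through (0,1).
  have hk2 : (1 + t / s * d) ^ 2 = 8 * d ^ 2 - 8 * d + 1 := by
    field_simp
    linear_combination d * hd
  set k := t / s
  clear_value k
  rw [hd] at hT h₁ h₂
  have hd0 : d ≠ 0 := right_ne_zero_of_mul hT
  have hdc : d * c = (d - 1) * (2 * d - 1) := by
    apply mul_left_cancel₀ (pow_ne_zero 2 hS)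
    linear_combination -h₁
  have hb : b = (d - 1) * (2 * d - 1) := by
    apply mul_left_cancel₀ (mul_ne_zero (pow_ne_zero 4 hS) (pow_ne_zero 2 hd0))
    linear_combination h₂
  have hcd : b = c * d := by rw [hb, ← hdc]; ring
  have hw : d * (d - 1) ≠ 0 := mul_ne_zero hd0 fun h => hb0 (by rw [hb, h, zero_mul])
  -- The quadratic formula with square root (2d - 1)²(1 + kd), after cancelling a factor d.
  obtain ⟨x, hx⟩ : ∃ x, 8 * d * x = (2 * d - 1) * (k * (2 * d - 1) + 4 * (d - 1)) :=
    ⟨(2 * d - 1) * (k * (2 * d - 1) + 4 * (d - 1)) / (8 * d), by field_simp⟩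
  have hx' : 8 * d ^ 2 * x + (-8 * d ^ 3 + 16 * d ^ 2 - 8 * d + 1) =
      (2 * d - 1) ^ 2 * (1 + k * d) := by
    linear_combination d * hx
  have hquad : 4 * d ^ 2 * x ^ 2 + (-8 * d ^ 3 + 16 * d ^ 2 - 8 * d + 1) * x -
      d * (d - 1) * (2 * d - 1) ^ 2 = 0 := by
    apply mul_left_cancel₀ (mul_ne_zero (by norm_num : (16 : F) ≠ 0) (pow_ne_zero 2 hd0))
    linear_combination (8 * d ^ 2 * x + (-8 * d ^ 3 + 16 * d ^ 2 - 8 * d + 1) +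
      (2 * d - 1) ^ 2 * (1 + k * d)) * hx' + (2 * d - 1) ^ 4 * hk2
  have hcub : (b - (1 - c) * x) ^ 2 + 4 * x ^ 2 * (x - b) = 0 := by
    apply mul_left_cancel₀ (pow_ne_zero 2 hd0)
    have e : d ^ 2 * ((b - (1 - c) * x) ^ 2 + 4 * x ^ 2 * (x - b)) =
        (d * b - (d - d * c) * x) ^ 2 + 4 * d ^ 2 * x ^ 2 * (x - b) := by ring
    rw [e, hdc, hb]
    linear_combination (x - d * (d - 1)) * hquad
  obtain ⟨y, h, hQ⟩ := exists_two_torsion hΔ hcub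
  refine exists_zmod_two_prod_hom_injective (k := 4) (addOrderOf_origin_eq_eight hΔ hcd hdc)
    (Point.some_ne_zero h) hQ ?_ (by decide)
  obtain ⟨h', h4⟩ := four_nsmul_origin hΔ hcd
  rw [h4]
  intro h0
  have hxw := (Point.some.inj h0).1
  -- At x = d(d - 1) the quadratic takes the value 4d²(d - 1)⁴, so its roots differ from the first
  -- coordinate of 4P.
  apply pow_ne_zero 4 hw
  rw [hxw] at hx'
  linear_combination (1 / 64) * ((8 * d ^ 2 * (d * (d - 1)) +
    (-8 * d ^ 3 + 16 * d ^ 2 - 8 * d + 1) + (2 * d - 1) ^ 2 * (1 + k * d)) * hx' +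
    (2 * d - 1) ^ 4 * hk2)

theorem fourFourForms_embeds {i : F} (hi : i ^ 2 = -1) (hs : s ≠ 0) (ht : t ≠ 0)
    (h₁ : TateForms.fourFourForms.ρ s t * (1 - c) = TateForms.fourFourForms.a₁ s t)
    (h₂ : TateForms.fourFourForms.ρ s t ^ 2 * b = -TateForms.fourFourForms.a₂ s t) :
    ∃ φ : ZMod 4 × ZMod 4 →+ (tateCurve b c).Point, Function.Injective φ := by
  simp only [TateForms.fourFourForms] at h₁ h₂
  have hb0 := b_ne_zero hΔ
  have hc : c = 0 := by
    apply mul_left_cancel₀ (mul_ne_zero (by norm_num : (4 : F) ≠ 0) (pow_ne_zero 2 hs))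
    linear_combination -h₁
  have hκ : t / s ≠ 0 := div_ne_zero ht hs
  have hb : 16 * b = (t / s) ^ 4 - 1 := by field_simp; linear_combination h₂
  set κ := t / s
  clear_value κ
  have hκ1 : 1 + κ ≠ 0 := fun h => hb0 (by
    linear_combination (1 / 16) * hb + (1 / 16) * (κ ^ 2 + 1) * (κ - 1) * h)
  have hκ2 : 1 + κ ^ 2 ≠ 0 := fun h => hb0 (by
    linear_combination (1 / 16) * hb + (1 / 16) * (κ ^ 2 - 1) * h)
  obtain ⟨z, hz⟩ : ∃ z, 8 * z = -(1 + κ ^ 2) := ⟨-(1 + κ ^ 2) / 8, by field_simp⟩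
  have hz0 : z ≠ 0 := by
    rintro rfl
    apply hκ2
    linear_combination hz
  have hbz : b = z * (4 * z + 1) := by
    linear_combination (1 / 16) * hb - (1 / 16) * (8 * z - (1 + κ ^ 2) + 2) * hz
  have hκz : κ ^ 2 = -(8 * z + 1) := by linear_combination hz
  have hz' : z = -(1 + κ ^ 2) / 8 := by linear_combination (1 / 8) * hz
  -- r - 1/2 will be the tangent slope at the point R with 2R = T. The doubling formula asks for r²
  -- = -(1 + κ)⁴/16, and this is where a square root of -1 is indispensable.
  set r := i * (1 + κ) ^ 2 / 4 with hr
  have hr2 : r ^ 2 = -(1 + κ) ^ 4 / 16 := by rw [hr]; linear_combination (1 + κ) ^ 4 / 16 * hi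
  have hr0 : r ≠ 0 := by
    intro h0
    rw [h0] at hr2
    apply pow_ne_zero 4 hκ1
    linear_combination 16 * hr2
  have hT : (tateCurve b c).Nonsingular z (2 * z ^ 2) := nonsingular hΔ (by rw [hc, hbz]; ring)
  have hR : (tateCurve b c).Nonsingular (z + κ * z)
      (r * κ * z - (z + κ * z - b) / 2) := nonsingular hΔ (by
    rw [hc, hbz]
    subst hz'
    linear_combination (κ ^ 2 * (-(1 + κ ^ 2) / 8) ^ 2) * hr2)
  have hRT : 2 • Point.some _ _ hR = Point.some _ _ hT := by
    rw [two_nsmul]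
    refine Point.some_add_self (r - 1 / 2) _ _ ?_ ?_ ?_ ?_ <;> simp only [tateCurve, hc]
    · have h2 : 2 * r * κ * z ≠ 0 :=
        mul_ne_zero (mul_ne_zero (mul_ne_zero two_ne_zero hr0) hκ) hz0
      contrapose! h2
      linear_combination h2
    · rw [hbz, hz']
      linear_combination (2 * κ * (-(1 + κ ^ 2) / 8)) * hr2
    · rw [hbz, hz']
      linear_combination -hr2
    · rw [hbz]
      ring
  have hR4 : 4 • Point.some _ _ hR = 0 := by
    rw [show 4 = 2 * 2 by norm_num, mul_nsmul, hRT, Point.two_nsmul_some_eq_zero_iff]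
    simp only [tateCurve, hc, hbz]
    ring
  refine exists_zmod_four_prod_hom_injective (addOrderOf_origin_eq_four hΔ hc) (R := .some _ _ hR)
    ?_ ?_
  · refine addOrderOf_eq_of_prime_nsmul_ne_zero (by norm_num) hR4 fun p hp hpp hpn => ?_
    interval_cases p <;> first | (exfalso; revert hpp; norm_num; done) | (exfalso; omega) | skip
    change 2 • Point.some _ _ hR ≠ 0
    rw [hRT]
    exact Point.some_ne_zero _
  · obtain ⟨h', h2⟩ := two_nsmul_origin hΔ
    rw [hRT, h2]
    intro h0
    have hx := (Point.some.inj h0).1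
    rw [hbz] at hx
    apply pow_ne_zero 2 hz0
    linear_combination -(1 / 4) * hx

end tateCurve

/-! ### The groups ℤ/2 × ℤ/2 and ℤ/4 on the short equation. -/

/-- The pair parametrising cubics `x³ + A x + B` with two given roots. -/
def twoTwoPair : WeightedPair 1 1 where
  F s t := -(s ^ 2 + s * t + t ^ 2)
  G s t := s * t * (s + t)
  map_F φ s t := by simp only [map_neg, map_add, map_mul, map_pow]
  map_G φ s t := by simp only [map_add, map_mul]
  homog_F c s t := by ring
  homog_G c s t := by ring
  C := 1
  C_ne_zero := one_ne_zero
  K := 3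
  resultant_left s t := ⟨-s, -1, by push_cast; ring⟩
  resultant_right s t := ⟨-t, -1, by push_cast; ring⟩
  nonconstant := ⟨1, 0, by norm_num⟩

/-- The pair parametrising equations `y² = x³ + A x + B` with a point of order four: `s` is the
slope of the tangent at the point, `t` the difference of the first coordinates of the point and of
its double. -/
def fourPair : WeightedPair 2 2 where
  F s t := 27 * (3 * t ^ 2 - (s ^ 2 - 2 * t) ^ 2)
  G s t := 27 * (s ^ 2 - 2 * t) * (2 * (s ^ 2 - 2 * t) ^ 2 - 9 * t ^ 2)
  map_F φ s t := by simp only [map_sub, map_mul, map_pow, map_ofNat]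
  map_G φ s t := by simp only [map_sub, map_mul, map_pow, map_ofNat]
  homog_F c s t := by ring
  homog_G c s t := by ring
  C := 243
  C_ne_zero := by norm_num
  K := 12
  resultant_left s t := by
    -- In terms of a one has -3aF - G = 27a³ and (3t² - 2a²)F - aG = 243t⁴. Every monomial of s¹² =
    -- (a + 2t)⁶ is divisible by a³ or by t⁴.
    obtain ⟨a, ha⟩ : ∃ a, a = s ^ 2 - 2 * t := ⟨_, rfl⟩
    rw [← ha]
    refine ⟨9 * (a ^ 3 + 12 * a ^ 2 * t + 60 * a * t ^ 2 + 160 * t ^ 3) * (-3 * a) +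
      (240 * a ^ 2 + 192 * a * t + 64 * t ^ 2) * (3 * t ^ 2 + a ^ 2 - 3 * a ^ 2),
      -9 * (a ^ 3 + 12 * a ^ 2 * t + 60 * a * t ^ 2 + 160 * t ^ 3) -
      (240 * a ^ 2 + 192 * a * t + 64 * t ^ 2) * a, ?_⟩
    have hs : s ^ 12 = (a + 2 * t) ^ 6 := by rw [ha]; ring
    push_cast
    rw [hs]
    ring
  resultant_right s t := by
    obtain ⟨a, ha⟩ : ∃ a, a = s ^ 2 - 2 * t := ⟨_, rfl⟩
    rw [← ha]
    refine ⟨t ^ 8 * (3 * t ^ 2 + a ^ 2 - 3 * a ^ 2), -t ^ 8 * a, ?_⟩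
    push_cast
    ring
  nonconstant := ⟨0, 1, by norm_num⟩

theorem GaussianRat.exists_algebraMap_eq_of_cubic {x : GaussianRat} (a b : GaussianInt)
    (h : x ^ 3 + algebraMap GaussianInt GaussianRat a * x + algebraMap GaussianInt GaussianRat b =
      0) : ∃ y : GaussianInt, algebraMap GaussianInt GaussianRat y = x := by
  rw [← IsIntegrallyClosed.isIntegral_iff (R := GaussianInt)]
  refine ⟨.X ^ 3 + .C a * .X + .C b, by monicity!, ?_⟩
  simpa using h

theorem GaussianRat.exists_algebraMap_eq_of_sq {x : GaussianRat} {a : GaussianInt}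
    (h : x ^ 2 = algebraMap GaussianInt GaussianRat a) :
    ∃ y : GaussianInt, algebraMap GaussianInt GaussianRat y = x := by
  rw [← IsIntegrallyClosed.isIntegral_iff (R := GaussianInt)]
  refine IsIntegral.of_pow two_pos ?_
  rw [h]
  exact isIntegral_algebraMap

theorem equation_shortCurve {A B : GaussianInt} {x y : GaussianRat}
    (h : (shortCurve A B).toAffine.Nonsingular x y) :
    y ^ 2 = x ^ 3 + algebraMap GaussianInt GaussianRat A * x +
      algebraMap GaussianInt GaussianRat B := by
  have := equation_of_nonsingular h
  simp only [shortCurve] at this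
  linear_combination this

theorem nonsingular_shortCurve {A B : GaussianInt} (hAB : IsEllipticPair A B) {x y : GaussianRat}
    (h : y ^ 2 = x ^ 3 + algebraMap GaussianInt GaussianRat A * x +
      algebraMap GaussianInt GaussianRat B) : (shortCurve A B).toAffine.Nonsingular x y := by
  refine (equation_iff_nonsingular_of_Δ_ne_zero hAB.Δ_shortCurve_ne_zero).1 ?_
  rw [equation_iff]
  simp only [shortCurve]
  linear_combination h

section

open Classical

theorem two_nsmul_shortCurve_eq_zero_iff {A B : GaussianInt} {x y : GaussianRat}
    (h : (shortCurve A B).toAffine.Nonsingular x y) :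
    2 • Point.some x y h = 0 ↔ y = 0 := by
  rw [Point.two_nsmul_some_eq_zero_iff]
  simp [shortCurve]

/-- The first coordinates of two points of order two are roots of a monic cubic over ℤ[i], hence
integral. The third root is -s - t because the x² term is missing. -/
theorem exists_twoTwoPair {A B : GaussianInt} (h : TorsionContains (ZMod 2 × ZMod 2) A B) :
    ∃ s t : GaussianInt, A = twoTwoPair.F s t ∧ B = twoTwoPair.G s t := by
  have hinj := IsFractionRing.injective GaussianInt GaussianRat
  obtain ⟨φ, hφ⟩ := torsionContains_iff.1 h
  have root (g : ZMod 2 × ZMod 2) (hg : g ≠ 0) (hg2 : 2 • g = 0) : ∃ (s : GaussianInt)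
      (hs : (shortCurve A B).toAffine.Nonsingular (algebraMap GaussianInt GaussianRat s) 0),
      φ g = .some _ _ hs ∧ s ^ 3 + A * s + B = 0 := by
    have h0 : φ g ≠ 0 := (map_ne_zero_iff φ hφ).2 hg
    have h2 : 2 • φ g = 0 := by rw [← map_nsmul, hg2, map_zero]
    generalize φ g = P at h0 h2
    rcases P with _ | ⟨x, y, hxy⟩
    · exact absurd rfl h0
    obtain rfl := (two_nsmul_shortCurve_eq_zero_iff hxy).1 h2
    have he := equation_shortCurve hxy
    obtain ⟨s, rfl⟩ := GaussianRat.exists_algebraMap_eq_of_cubic (x := x) A B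
      (by linear_combination -he)
    refine ⟨s, hxy, rfl, hinj ?_⟩
    simp only [map_add, map_mul, map_pow, map_zero]
    linear_combination -he
  obtain ⟨s, hs, hs', hs3⟩ := root (1, 0) (by decide) (by decide)
  obtain ⟨t, ht, ht', ht3⟩ := root (0, 1) (by decide) (by decide)
  have hst : s - t ≠ 0 := by
    intro h0
    obtain rfl := sub_eq_zero.1 h0
    have := hφ (hs'.trans ht'.symm)
    revert this
    decide
  have hA : A = -(s ^ 2 + s * t + t ^ 2) := by
    apply mul_left_cancel₀ hst
    linear_combination hs3 - ht3
  refine ⟨s, t, hA, ?_⟩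
  simp only [twoTwoPair]
  rw [hA] at hs3
  linear_combination hs3

theorem torsionContains_of_twoTwoPair {A B q s t : GaussianInt} (hq : q ≠ 0)
    (hAB : IsEllipticPair A B) (hF : q ^ 4 * A = twoTwoPair.F s t)
    (hG : q ^ 6 * B = twoTwoPair.G s t) : TorsionContains (ZMod 2 × ZMod 2) A B := by
  have hinj := IsFractionRing.injective GaussianInt GaussianRat
  simp only [twoTwoPair] at hF hG
  -- For s = t the cubic has a double root and 4A³ + 27B² vanishes.
  have hst : s ≠ t := by
    rintro rfl
    apply mul_ne_zero (pow_ne_zero 12 hq) hAB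
    linear_combination 4 * ((q ^ 4 * A) ^ 2 + q ^ 4 * A * (-3 * s ^ 2) + 9 * s ^ 4) * hF +
      27 * (q ^ 6 * B + 2 * s ^ 3) * hG
  have hF' := congrArg (algebraMap GaussianInt GaussianRat) hF
  have hG' := congrArg (algebraMap GaussianInt GaussianRat) hG
  simp only [map_neg, map_add, map_mul, map_pow] at hF' hG'
  have hq' : algebraMap GaussianInt GaussianRat q ≠ 0 := (map_ne_zero_iff _ hinj).2 hq
  have hst' := hinj.ne hst
  rw [torsionContains_iff]
  have key (x : GaussianRat) (hx : x ^ 3 + algebraMap GaussianInt GaussianRat q ^ 4 *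
      algebraMap GaussianInt GaussianRat A * x + algebraMap GaussianInt GaussianRat q ^ 6 *
      algebraMap GaussianInt GaussianRat B = 0) : (shortCurve A B).toAffine.Nonsingular
        (x / algebraMap GaussianInt GaussianRat q ^ 2) 0 := by
    apply nonsingular_shortCurve hAB
    field_simp
    linear_combination -hx
  have h₁ := key (algebraMap GaussianInt GaussianRat s) (by rw [hF', hG']; ring)
  have h₂ := key (algebraMap GaussianInt GaussianRat t) (by rw [hF', hG']; ring)
  refine exists_zmod_two_prod_hom_injective (k := 1) (P := Point.some _ _ h₁) (Q := Point.some _ _ h₂)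
    (addOrderOf_eq_prime (p := 2) ((two_nsmul_shortCurve_eq_zero_iff _).2 rfl) (Point.some_ne_zero _))
    (Point.some_ne_zero _) ((two_nsmul_shortCurve_eq_zero_iff _).2 rfl) ?_ (by decide)
  rw [one_nsmul]
  intro h0
  have hx := (Point.some.inj h0).1
  rw [div_left_inj' (pow_ne_zero 2 hq')] at hx
  exact hst' hx.symm

/-- Let 2P = (e,0), let t be the difference of first coordinates and ℓ the tangent slope at P. Then
t² = 3e² + A and ℓ² = 2t + 3e, so e, t and ℓ are all integral. The scaling factor 3 clears the
denominator in e = (ℓ² - 2t)/3. -/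
theorem exists_fourPair {A B : GaussianInt} (h : TorsionContains (ZMod 4) A B) :
    ∃ s t : GaussianInt, 3 ^ 4 * A = fourPair.F s t ∧ 3 ^ 6 * B = fourPair.G s t := by
  have hinj := IsFractionRing.injective GaussianInt GaussianRat
  obtain ⟨φ, hφ⟩ := torsionContains_iff.1 h
  have hP2 : 2 • φ 1 ≠ 0 := by rw [← map_nsmul, map_ne_zero_iff φ hφ]; decide
  have hP4 : 4 • φ 1 = 0 := by rw [← map_nsmul, map_eq_zero_iff φ hφ]; decide
  generalize φ 1 = P at hP2 hP4
  rcases P with _ | ⟨x, y, hxy⟩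
  · exact absurd (nsmul_zero (M := (shortCurve A B).toAffine.Point) 2) hP2
  rw [show 4 = 2 * 2 by norm_num, mul_nsmul] at hP4
  obtain ⟨Q, hQ⟩ : ∃ Q, Q = 2 • Point.some x y hxy := ⟨_, rfl⟩
  rw [← hQ] at hP2 hP4
  rcases Q with _ | ⟨e, w, hew⟩
  · exact absurd rfl hP2
  obtain rfl := (two_nsmul_shortCurve_eq_zero_iff hew).1 hP4
  obtain ⟨ℓ, h1, h2, h3⟩ := Point.exists_slope_of_two_nsmul_eq hQ.symm
  have hE := equation_shortCurve hew
  simp only [shortCurve] at h1 h2 h3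
  obtain ⟨e, rfl⟩ := GaussianRat.exists_algebraMap_eq_of_cubic (x := e) A B
    (by linear_combination -hE)
  have hy : y = ℓ * (x - algebraMap GaussianInt GaussianRat e) := by linear_combination h3
  have hc2 : (x - algebraMap GaussianInt GaussianRat e) ^ 2 =
      algebraMap GaussianInt GaussianRat (3 * e ^ 2 + A) := by
    simp only [map_add, map_mul, map_pow, map_ofNat]
    rw [hy] at h1
    linear_combination h1 + 2 * (x - algebraMap GaussianInt GaussianRat e) * h2
  obtain ⟨t, ht⟩ := GaussianRat.exists_algebraMap_eq_of_sq hc2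
  have hℓ2 : ℓ ^ 2 = algebraMap GaussianInt GaussianRat (2 * t + 3 * e) := by
    simp only [map_add, map_mul, map_ofNat, ht]
    linear_combination -h2
  obtain ⟨s, hs⟩ := GaussianRat.exists_algebraMap_eq_of_sq hℓ2
  rw [← ht, ← map_pow] at hc2
  rw [← hs, ← map_pow] at hℓ2
  have ht2 := hinj hc2
  have hs2 := hinj hℓ2
  have he : e ^ 3 + A * e + B = 0 := hinj (by
    simp only [map_add, map_mul, map_pow, map_zero]
    linear_combination -hE)
  refine ⟨s, t, ?_, ?_⟩ <;> simp only [fourPair] <;> rw [hs2]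
  · linear_combination -81 * ht2
  · linear_combination 729 * he + 729 * e * ht2

theorem torsionContains_of_fourPair {A B q s t : GaussianInt} (hq : q ≠ 0) (hs : s ≠ 0)
    (ht : t ≠ 0) (hAB : IsEllipticPair A B) (hF : q ^ 4 * A = fourPair.F s t)
    (hG : q ^ 6 * B = fourPair.G s t) : TorsionContains (ZMod 4) A B := by
  have hinj := IsFractionRing.injective GaussianInt GaussianRat
  simp only [fourPair] at hF hG
  have hF' := congrArg (algebraMap GaussianInt GaussianRat) hF
  have hG' := congrArg (algebraMap GaussianInt GaussianRat) hG
  simp only [map_sub, map_mul, map_pow, map_ofNat] at hF' hG'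
  have hq' : algebraMap GaussianInt GaussianRat q ≠ 0 := (map_ne_zero_iff _ hinj).2 hq
  have hs' : algebraMap GaussianInt GaussianRat s ≠ 0 := (map_ne_zero_iff _ hinj).2 hs
  have ht' : algebraMap GaussianInt GaussianRat t ≠ 0 := (map_ne_zero_iff _ hinj).2 ht
  rw [torsionContains_iff]
  have hP (x y : GaussianRat) (h : y ^ 2 = x ^ 3 + algebraMap GaussianInt GaussianRat A * x +
      algebraMap GaussianInt GaussianRat B) := nonsingular_shortCurve hAB h
  have hdouble (x y z ℓ : GaussianRat) (h : (shortCurve A B).toAffine.Nonsingular x y)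
      (h' : (shortCurve A B).toAffine.Nonsingular z 0) (hy : y ≠ 0)
      (hℓ : ℓ * (2 * y) = 3 * x ^ 2 + algebraMap GaussianInt GaussianRat A)
      (hz : z = ℓ ^ 2 - 2 * x) (hy' : y = ℓ * (x - z)) :
      2 • Point.some x y h = Point.some z 0 h' := by
    rw [two_nsmul]
    refine Point.some_add_self ℓ _ _ ?_ ?_ ?_ ?_ <;> simp only [shortCurve]
    · simpa using hy
    · linear_combination hℓ
    · linear_combination hz
    · linear_combination hy'
  generalize algebraMap GaussianInt GaussianRat A = A' at *
  generalize algebraMap GaussianInt GaussianRat B = B' at *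
  generalize algebraMap GaussianInt GaussianRat q = q at *
  generalize algebraMap GaussianInt GaussianRat s = s at *
  generalize algebraMap GaussianInt GaussianRat t = t at *
  have hA : A' = 27 * (3 * t ^ 2 - (s ^ 2 - 2 * t) ^ 2) / q ^ 4 := by
    field_simp
    linear_combination hF'
  have hB : B' = 27 * (s ^ 2 - 2 * t) * (2 * (s ^ 2 - 2 * t) ^ 2 - 9 * t ^ 2) / q ^ 6 := by
    field_simp
    linear_combination hG'
  -- On the equation scaled by q, with a = s² - 2t, the tangent at (3a + 9t, 27st) has slope 3s and
  -- passes through (3a,0), a point of order two. Since s and t are nonzero, the first point is not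
  -- itself 2-torsion.
  have h₁ := hP ((3 * (s ^ 2 - 2 * t) + 9 * t) / q ^ 2) (27 * s * t / q ^ 3)
    (by rw [hA, hB]; field_simp; ring)
  have h₂ := hP (3 * (s ^ 2 - 2 * t) / q ^ 2) 0 (by rw [hA, hB]; field_simp; ring)
  have h2 := hdouble _ _ _ (3 * s / q) h₁ h₂
    (div_ne_zero (mul_ne_zero (mul_ne_zero (by norm_num) hs') ht') (pow_ne_zero 3 hq'))
    (by rw [hA]; field_simp; ring) (by field_simp; ring) (by field_simp; ring)
  obtain ⟨φ, hφ, -⟩ := exists_zmod_hom_injective (n := 4) (P := Point.some _ _ h₁)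
    (addOrderOf_eq_of_prime_nsmul_ne_zero (by norm_num) (by
      rw [show 4 = 2 * 2 by norm_num, mul_nsmul, h2, two_nsmul_shortCurve_eq_zero_iff])
      fun p hp hpp hpn => by
        interval_cases p <;>
          first | (exfalso; revert hpp; norm_num; done) | (exfalso; omega) | skip
        change 2 • Point.some _ _ h₁ ≠ 0
        rw [h2]
        exact Point.some_ne_zero _)
  exact ⟨φ, hφ⟩

end

/-! ### The thirteen groups. -/

theorem GaussianRat.exists_sq_eq_neg_one : ∃ i : GaussianRat, i ^ 2 = -1 :=
  ⟨algebraMap GaussianInt GaussianRat ⟨0, 1⟩, by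
    rw [← map_pow, ← map_one (algebraMap GaussianInt GaussianRat), ← map_neg]
    congr 1⟩

theorem theorem3p3 (G : Type) [AddCommGroup G] (d : ℕ) (hG : TorsionTable G d) :
    ∃ K₁ K₂ X₀ : ℝ, 0 < K₁ ∧ 0 < K₂ ∧ 0 < X₀ ∧
      (∀ X : ℝ, X₀ ≤ X → K₁ * X ^ (1 / (d : ℝ)) ≤ (countContaining G X : ℝ)) ∧
      (∀ X : ℝ, 0 < X → (countContaining G X : ℝ) ≤ K₂ * X ^ (1 / (d : ℝ))) := by
  classical
  cases hG with
  | z4 =>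
    refine fourPair.countContaining_bounds two_ne_zero two_ne_zero (by norm_num) 3 ?_ ?_
    · intro A B _ _ h
      obtain ⟨s, t, hA, hB⟩ := exists_fourPair h
      exact ⟨3, s, t, by decide, by simp [map_ofNat GaussianInt.toComplex], hA, hB⟩
    · intro A B q s t hq hs ht hAB hF hG
      exact torsionContains_of_fourPair hq hs ht hAB hF hG
  | z2z2 =>
    refine twoTwoPair.countContaining_bounds one_ne_zero one_ne_zero (by norm_num) 1 ?_ ?_
    · intro A B _ _ h
      obtain ⟨s, t, hA, hB⟩ := exists_twoTwoPair h
      exact ⟨1, s, t, one_ne_zero, by norm_num, by rwa [one_pow, one_mul],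
        by rwa [one_pow, one_mul]⟩
    · intro A B q s t hq _ _ hAB hF hG
      exact torsionContains_of_twoTwoPair hq hAB hF hG
  | z5 =>
    refine TateForms.fiveForms.countContaining_bounds one_ne_zero (1 : ZMod 5) (by decide)
      (by decide) (fun b c hΔ φ hφ hg => ?_) fun s t b c hs ht hρ h₁ h₂ hΔ => ?_
    · have key (n : ℕ) : n • tateCurve.origin hΔ = 0 ↔ n • (1 : ZMod 5) = 0 := by
        rw [← hg, ← map_nsmul, map_eq_zero_iff φ hφ]
      exact tateCurve.exists_fiveForms hΔ ((key 5).2 (by decide))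
    · exact tateCurve.fiveForms_embeds hΔ hs h₁ h₂
  | z6 =>
    refine TateForms.sixForms.countContaining_bounds one_ne_zero (1 : ZMod 6) (by decide)
      (by decide) (fun b c hΔ φ hφ hg => ?_) fun s t b c hs ht hρ h₁ h₂ hΔ => ?_
    · have key (n : ℕ) : n • tateCurve.origin hΔ = 0 ↔ n • (1 : ZMod 6) = 0 := by
        rw [← hg, ← map_nsmul, map_eq_zero_iff φ hφ]
      exact tateCurve.exists_sixForms hΔ ((key 6).2 (by decide))
    · exact tateCurve.sixForms_embeds hΔ hs h₁ h₂
  | z7 =>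
    refine TateForms.sevenForms.countContaining_bounds two_ne_zero (1 : ZMod 7) (by decide)
      (by decide) (fun b c hΔ φ hφ hg => ?_) fun s t b c hs ht hρ h₁ h₂ hΔ => ?_
    · have key (n : ℕ) : n • tateCurve.origin hΔ = 0 ↔ n • (1 : ZMod 7) = 0 := by
        rw [← hg, ← map_nsmul, map_eq_zero_iff φ hφ]
      exact tateCurve.exists_sevenForms hΔ (mt (key 4).1 (by decide)) ((key 7).2 (by decide))
    · exact tateCurve.sevenForms_embeds hΔ hs h₁ h₂
  | z8 =>
    refine TateForms.eightForms.countContaining_bounds two_ne_zero (1 : ZMod 8) (by decide)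
      (by decide) (fun b c hΔ φ hφ hg => ?_) fun s t b c hs ht hρ h₁ h₂ hΔ => ?_
    · have key (n : ℕ) : n • tateCurve.origin hΔ = 0 ↔ n • (1 : ZMod 8) = 0 := by
        rw [← hg, ← map_nsmul, map_eq_zero_iff φ hφ]
      exact tateCurve.exists_eightForms hΔ (mt (key 4).1 (by decide)) ((key 8).2 (by decide))
    · exact tateCurve.eightForms_embeds hΔ hs ht h₁ h₂
  | z9 =>
    refine TateForms.nineForms.countContaining_bounds three_ne_zero (1 : ZMod 9) (by decide)
      (by decide) (fun b c hΔ φ hφ hg => ?_) fun s t b c hs ht hρ h₁ h₂ hΔ => ?_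
    · have key (n : ℕ) : n • tateCurve.origin hΔ = 0 ↔ n • (1 : ZMod 9) = 0 := by
        rw [← hg, ← map_nsmul, map_eq_zero_iff φ hφ]
      exact tateCurve.exists_nineForms hΔ (mt (key 4).1 (by decide)) (mt (key 5).1 (by decide))
        ((key 9).2 (by decide))
    · exact tateCurve.nineForms_embeds hΔ hs h₁ h₂
  | z10 =>
    refine TateForms.tenForms.countContaining_bounds three_ne_zero (1 : ZMod 10) (by decide)
      (by decide) (fun b c hΔ φ hφ hg => ?_) fun s t b c hs ht hρ h₁ h₂ hΔ => ?_
    · have key (n : ℕ) : n • tateCurve.origin hΔ = 0 ↔ n • (1 : ZMod 10) = 0 := by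
        rw [← hg, ← map_nsmul, map_eq_zero_iff φ hφ]
      exact tateCurve.exists_tenForms hΔ (mt (key 4).1 (by decide)) (mt (key 5).1 (by decide))
        ((key 10).2 (by decide))
    · exact tateCurve.tenForms_embeds hΔ hρ h₁ h₂
  | z12 =>
    refine TateForms.twelveForms.countContaining_bounds four_ne_zero (1 : ZMod 12) (by decide)
      (by decide) (fun b c hΔ φ hφ hg => ?_) fun s t b c hs ht hρ h₁ h₂ hΔ => ?_
    · have key (n : ℕ) : n • tateCurve.origin hΔ = 0 ↔ n • (1 : ZMod 12) = 0 := by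
        rw [← hg, ← map_nsmul, map_eq_zero_iff φ hφ]
      exact tateCurve.exists_twelveForms hΔ (mt (key 4).1 (by decide)) (mt (key 5).1 (by decide))
        (mt (key 6).1 (by decide)) ((key 12).2 (by decide))
    · exact tateCurve.twelveForms_embeds hΔ hρ h₁ h₂
  | z2z4 =>
    refine TateForms.twoFourForms.countContaining_bounds one_ne_zero ((0, 1) : ZMod 2 × ZMod 4)
      (by decide) (by decide) (fun b c hΔ φ hφ hg => ?_) fun s t b c hs ht hρ h₁ h₂ hΔ => ?_
    · have key (n : ℕ) : n • tateCurve.origin hΔ = 0 ↔ n • ((0, 1) : ZMod 2 × ZMod 4) = 0 := by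
        rw [← hg, ← map_nsmul, map_eq_zero_iff φ hφ]
      obtain ⟨hc, x, y, h, -, hb⟩ := tateCurve.exists_twoFourForms hΔ ((key 4).2 (by decide))
        (Q := φ (1, 0)) ((map_ne_zero_iff φ hφ).2 (by decide))
        (by rw [← map_nsmul, map_eq_zero_iff φ hφ]; decide)
        (by rw [← hg, ← map_nsmul]; exact hφ.ne (by decide))
      refine ⟨x, ?_, ?_, ?_⟩ <;> simp only [TateForms.twoFourForms]
      · exact one_ne_zero
      · rw [hc]; ring
      · rw [hb]; ring
    · exact tateCurve.twoFourForms_embeds hΔ hs ht h₁ h₂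
  | z2z6 =>
    refine TateForms.twoSixForms.countContaining_bounds two_ne_zero ((0, 1) : ZMod 2 × ZMod 6)
      (by decide) (by decide) (fun b c hΔ φ hφ hg => ?_) fun s t b c hs ht hρ h₁ h₂ hΔ => ?_
    · have key (n : ℕ) : n • tateCurve.origin hΔ = 0 ↔ n • ((0, 1) : ZMod 2 × ZMod 6) = 0 := by
        rw [← hg, ← map_nsmul, map_eq_zero_iff φ hφ]
      exact tateCurve.exists_twoSixForms hΔ ((key 6).2 (by decide))
        (Q := φ (1, 0)) ((map_ne_zero_iff φ hφ).2 (by decide))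
        (by rw [← map_nsmul, map_eq_zero_iff φ hφ]; decide)
        (by rw [← hg, ← map_nsmul]; exact hφ.ne (by decide))
    · exact tateCurve.twoSixForms_embeds hΔ ht hρ h₁ h₂
  | z2z8 =>
    refine TateForms.twoEightForms.countContaining_bounds four_ne_zero ((0, 1) : ZMod 2 × ZMod 8)
      (by decide) (by decide) (fun b c hΔ φ hφ hg => ?_) fun s t b c hs ht hρ h₁ h₂ hΔ => ?_
    · have key (n : ℕ) : n • tateCurve.origin hΔ = 0 ↔ n • ((0, 1) : ZMod 2 × ZMod 8) = 0 := by
        rw [← hg, ← map_nsmul, map_eq_zero_iff φ hφ]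
      exact tateCurve.exists_twoEightForms hΔ (mt (key 4).1 (by decide)) ((key 8).2 (by decide))
        (Q := φ (1, 0)) ((map_ne_zero_iff φ hφ).2 (by decide))
        (by rw [← map_nsmul, map_eq_zero_iff φ hφ]; decide)
        (by rw [← hg, ← map_nsmul]; exact hφ.ne (by decide))
    · exact tateCurve.twoEightForms_embeds hΔ hρ h₁ h₂
  | z4z4 =>
    refine TateForms.fourFourForms.countContaining_bounds two_ne_zero ((0, 1) : ZMod 4 × ZMod 4)
      (by decide) (by decide) (fun b c hΔ φ hφ hg => ?_) fun s t b c hs ht hρ h₁ h₂ hΔ => ?_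
    · have key (n : ℕ) : n • tateCurve.origin hΔ = 0 ↔ n • ((0, 1) : ZMod 4 × ZMod 4) = 0 := by
        rw [← hg, ← map_nsmul, map_eq_zero_iff φ hφ]
      exact tateCurve.exists_fourFourForms hΔ ((key 4).2 (by decide)) (R := φ (1, 0))
        (by rw [← map_nsmul, map_ne_zero_iff φ hφ]; decide)
        (by rw [← map_nsmul, map_eq_zero_iff φ hφ]; decide)
        (by rw [← hg, ← map_nsmul, ← map_nsmul]; exact hφ.ne (by decide))
    · obtain ⟨i, hi⟩ := GaussianRat.exists_sq_eq_neg_one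
      exact tateCurve.fourFourForms_embeds hΔ hi hs ht h₁ h₂
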